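/- Let $M$ be a smooth manifold modelled on convenient vector spaces in the sense of convenient calculus (Kriegl--Michor): convenient vector spaces are separated, $c^\infty$-complete real locally convex spaces, $c^\infty$-open sets are those whose preimages under smooth curves are open, and smooth maps are those that map smooth curves to smooth curves. Let $\omega\in\Omega^2(M)$ be a weak symplectic structure on $M$, that is: 1. $d\omega=0$; 2. $\check\omega_x:T_xM\to T_x^*M$, $X\mapsto\omega_x(X,\cdot)$, is injective for every $x\in M$; 3. the gradient of $\omega$ with respect to itself exists and is smooth: around each point of $M$ there is a chart, identifying its domain with a $c^\infty$-open subset $U$ of a convenient vector space $E$, and there are smooth maps $\Omega,\tilde\Omega:U\times E\times E\to E$, bilinear in $E\times E$, such that for all $x\in U$ and $X,Y,Z\in E$ $$d\omega(x)(X)(Y,Z)=\omega_x(\Omega_x(Y,Z),X)=\omega_x(\tilde\Omega_x(X,Y),Z),$$ where $d\omega(x)(X)$ denotes the directional derivative at $x$ in direction $X$ of the local representative $U\to L^2_{\mathrm{alt}}(E;\mathbb R)$ of $\omega$. Let $C^\infty_\omega(M,\mathbb R)$ be the set of smooth functions $f:M\to\mathbb R$ for which there is a smooth vector field $\operatorname{grad}^\omega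 f$ with $df=i_{\operatorname{grad}^\omega f}\omega=\omega(\operatorname{grad}^\omega f,\cdot)$; it is a subalgebra of $C^\infty(M,\mathbb R)$. Let $\mathfrak X(M,\omega)=\{X\in\mathfrak X(M):\mathcal L_X\omega=0\}$, and let $C^\infty(M\leftarrow T^\omega M)$ be the space of all $1$-forms $\check\omega\circ X$ with $X\in\mathfrak X(M)$. Then the following hold. (a) $\mathfrak X(M,\omega)$ is a Lie algebra under the Lie bracket of vector fields, and the Hamiltonian mapping $\operatorname{grad}^\omega:C^\infty_\omega(M,\mathbb R)\to\mathfrak X(M,\omega)$, determined by $i_{\operatorname{grad}^\omega f}\omega=df$, is well defined and linear. (b) The Poisson bracket $$\{f,g\}:=i_{\operatorname{grad}^\omega f}i_{\operatorname{grad}^\omega g}\omega=\omega(\operatorname{grad}^\omega g,\operatorname{grad}^\omega f)=dg(\operatorname{grad}^\omega f)$$ is well defined as a map $C^\infty_\omega(M,\mathbb R)\times C^\infty_\omega(M,\mathbb R)\to C^\infty_\omega(M,\mathbb R)$, makes $C^\infty_\omega(M,\mathbb R)$ a Lie algebra, and satisfies $\{f,gh\}=\{f,g\}h+g\{f,h\}$.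 (c) If $C^\infty_\omega(M,\mathbb R)$ carries the initial structure with respect to the inclusion into $C^\infty(M,\mathbb R)$ and to $\operatorname{grad}^\omega:C^\infty_\omega(M,\mathbb R)\to\mathfrak X(M)$, then the Poisson bracket is bounded bilinear: it maps pairs of bounded sets to bounded sets. Here a set of smooth functions (respectively vector fields) is bounded if in every chart of an atlas, for every smooth curve $c$ in the image of the chart, every $n\in\mathbb N$ and every compact $K\subset\mathbb R$, the $n$-th derivatives at the points of $K$ of the compositions with $c$ of the local representatives of its elements form a bounded set. (d) There is an exact sequence of Lie algebras and Lie algebra homomorphisms $$0\to H^0(M)\to C^\infty_\omega(M,\mathbb R)\xrightarrow{\operatorname{grad}^\omega}\mathfrak X(M,\omega)\xrightarrow{\ \gamma\ }H^1_\omega(M)\to0,\qquad \gamma(X)=[i_X\omega],$$ where $H^0(M)$ is the space of locally constant functions on $M$, $$H^1_\omega(M)=\frac{\{\varphi\in C^\infty(M\leftarrow T^\omega M):d\varphi=0\}}{\{df:f\in C^\infty_\omega(M,\mathbb R)\}},$$ and $H^0(M)$ and $H^1_\omega(M)$ carry the zero bracket. Moreover, the natural map from $H^1_\omega(M)$ to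 the de Rham cohomology space $H^1(M)$ is injective, so $H^1_\omega(M)$ is a linear subspace of $H^1(M)$. -/

import Mathlib

open Set Filter Topology

noncomputable section

/-! ## Convenient calculus -/

section Curves

variable {E : Type*} [AddCommGroup E] [Module ℝ E] [TopologicalSpace E]

/-- `v` is the derivative of the curve `c` at time `t`: the difference quotients converge to `v`. -/
def HasVelocity (c : ℝ → E) (v : E) (t : ℝ) : Prop :=
  Tendsto (fun s : ℝ => s⁻¹ • (c (t + s) - c t)) (𝓝[≠] 0) (𝓝 v)

/-- The derivative of a curve at time `t`, as the limit of the difference quotients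
(only meaningful where this limit exists). -/
def velocity (c : ℝ → E) (t : ℝ) : E :=
  limUnder (𝓝[≠] (0 : ℝ)) (fun s : ℝ => s⁻¹ • (c (t + s) - c t))

/-- A curve is smooth if all its iterated derivatives exist. -/
def SmoothCurve (c : ℝ → E) : Prop :=
  ∃ d : ℕ → ℝ → E, d 0 = c ∧ ∀ n t, HasVelocity (d n) (d (n + 1) t) t

/-- `U` is open for the `c^∞`-topology, the final topology with respect to all smooth curves. -/
def CInftyOpen (U : Set E) : Prop :=
  ∀ c : ℝ → E, SmoothCurve c → IsOpen (c ⁻¹' U)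

end Curves

/-- Convenient vector spaces: separated locally convex real vector spaces in which every curve that
is smooth along all continuous linear functionals is smooth (`c^∞`-completeness). -/
class ConvenientSpace (E : Type*) [AddCommGroup E] [Module ℝ E] [TopologicalSpace E] : Prop
    extends IsTopologicalAddGroup E, ContinuousSMul ℝ E, LocallyConvexSpace ℝ E, T2Space E where
  smoothCurve_of_scalarwise : ∀ c : ℝ → E,
    (∀ l : E →L[ℝ] ℝ, SmoothCurve (fun t => l (c t))) → SmoothCurve c

section Calculus

variable {E : Type*} [AddCommGroup E] [Module ℝ E] [TopologicalSpace E]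
  {F : Type*} [AddCommGroup F] [Module ℝ F] [TopologicalSpace F]

/-- A map is smooth on `U` if it maps smooth curves in `U` to smooth curves. -/
def CSmoothOn (f : E → F) (U : Set E) : Prop :=
  ∀ c : ℝ → E, SmoothCurve c → (∀ t, c t ∈ U) → SmoothCurve (fun t => f (c t))

/-- The derivative `df(x)(v)` of `f` at `x` in direction `v`. -/
def dirDeriv (f : E → F) (x v : E) : F :=
  velocity (fun t : ℝ => f (x + t • v)) 0

/-- Bounded sets of the space `C^∞(U, F)`: the structure of `C^∞(U, F)` is the initial one with
respect to `f ↦ f ∘ c`, for all smooth curves `c` in `U`, and `C^∞(ℝ, F)` carries the topology of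
uniform convergence on compact sets in each derivative separately. -/
def SmoothBounded (U : Set E) (B : Set (E → F)) : Prop :=
  ∀ c : ℝ → E, SmoothCurve c → (∀ t, c t ∈ U) → ∀ (n : ℕ) (K : Set ℝ), IsCompact K →
    Bornology.IsVonNBounded ℝ {y : F | ∃ f ∈ B, ∃ t ∈ K, y = velocity^[n] (fun s => f (c s)) t}

end Calculus

/-! ## Manifolds modelled on convenient vector spaces -/

/-- A smooth manifold structure on the set `M`: an atlas of charts onto `c^∞`-open subsets of
convenient vector spaces (which may vary with the chart), whose chart changes are defined on
`c^∞`-open sets and are smooth. -/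
structure ConvenientManifold {ι : Type*} (E : ι → Type*) [∀ i, AddCommGroup (E i)]
    [∀ i, Module ℝ (E i)] [∀ i, TopologicalSpace (E i)] [∀ i, ConvenientSpace (E i)]
    (M : Type*) where
  /-- The charts. -/
  chart : ∀ i, PartialEquiv M (E i)
  exists_mem_source : ∀ p : M, ∃ i, p ∈ (chart i).source
  isOpen_target : ∀ i, CInftyOpen (chart i).target
  isOpen_overlap : ∀ i j, CInftyOpen ((chart i).target ∩ (chart i).symm ⁻¹' (chart j).source)
  smooth_change : ∀ i j, CSmoothOn (fun x => chart j ((chart i).symm x))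
    ((chart i).target ∩ (chart i).symm ⁻¹' (chart j).source)

namespace ConvenientManifold

variable {ι : Type*} {E : ι → Type*} [∀ i, AddCommGroup (E i)]
  [∀ i, Module ℝ (E i)] [∀ i, TopologicalSpace (E i)] [∀ i, ConvenientSpace (E i)]
  {M : Type*} (A : ConvenientManifold E M)

/-- The natural topology of the manifold: a set is open if its images under the charts are
`c^∞`-open. -/
@[reducible] def naturalTopology : TopologicalSpace M where
  IsOpen W := ∀ i, CInftyOpen ((A.chart i).target ∩ (A.chart i).symm ⁻¹' W)
  isOpen_univ i := by simpa using A.isOpen_target i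
  isOpen_inter V W hV hW i c hc := by
    have h := (hV i c hc).inter (hW i c hc)
    rwa [← preimage_inter, ← inter_inter_distrib_left, ← preimage_inter] at h
  isOpen_sUnion S hS i c hc := by
    rw [sUnion_eq_biUnion, preimage_iUnion₂, inter_iUnion₂, preimage_iUnion₂]
    exact isOpen_biUnion fun W hW => hS W hW i c hc

/-- `χ` is a chart of the manifold, i.e. it may be added to the atlas. -/
def IsChart {F : Type*} [AddCommGroup F] [Module ℝ F] [TopologicalSpace F]
    (χ : PartialEquiv M F) : Prop :=
  CInftyOpen χ.target ∧ ∀ i,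
    CInftyOpen (χ.target ∩ χ.symm ⁻¹' (A.chart i).source) ∧
    CInftyOpen ((A.chart i).target ∩ (A.chart i).symm ⁻¹' χ.source) ∧
    CSmoothOn (fun x => A.chart i (χ.symm x)) (χ.target ∩ χ.symm ⁻¹' (A.chart i).source) ∧
    CSmoothOn (fun x => χ ((A.chart i).symm x))
      ((A.chart i).target ∩ (A.chart i).symm ⁻¹' χ.source)

/-- The index of a chosen chart of the atlas around `p`. -/
def index (p : M) : ι := (A.exists_mem_source p).choose

/-- The chosen chart of the atlas around `p`. -/
def chartAt (p : M) : PartialEquiv M (E (A.index p)) := A.chart (A.index p)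

/-- The (kinematic) tangent space at `p`: tangent vectors are represented in the chosen chart. -/
abbrev TangentSpace (p : M) : Type _ := E (A.index p)

section Coordinates

variable {F : Type*} [AddCommGroup F] [Module ℝ F] [TopologicalSpace F]

/-- The tangent map of a chart `χ` at `p`, as a map `T_pM → F`. -/
def toCoord (χ : PartialEquiv M F) (p : M) (v : A.TangentSpace p) : F :=
  dirDeriv (fun x => χ ((A.chartAt p).symm x)) (A.chartAt p p) v

/-- The tangent map of the inverse of a chart `χ` at the point `χ p`, as a map `F → T_pM`. -/
def ofCoord (χ : PartialEquiv M F) (p : M) (v : F) : A.TangentSpace p :=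
  dirDeriv (fun x => A.chartAt p (χ.symm x)) (χ p) v

end Coordinates

/-! ### Functions -/

/-- Smooth functions. -/
def SmoothFunction (f : M → ℝ) : Prop :=
  ∀ i, CSmoothOn (fun x => f ((A.chart i).symm x)) (A.chart i).target

/-- The differential `df(p)(v)`. -/
def differential (f : M → ℝ) (p : M) (v : A.TangentSpace p) : ℝ :=
  dirDeriv (fun x => f ((A.chartAt p).symm x)) (A.chartAt p p) v

/-- Bounded sets of `C^∞(M, ℝ)`. -/
def BoundedFunctions (B : Set (M → ℝ)) : Prop :=
  ∀ i, SmoothBounded (A.chart i).target ((fun f x => f ((A.chart i).symm x)) '' B)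

/-- `H^0(M)`: the locally constant functions. -/
def H0 : Submodule ℝ (M → ℝ) where
  carrier := {f | @IsLocallyConstant M ℝ A.naturalTopology f}
  zero_mem' := @IsLocallyConstant.const M ℝ A.naturalTopology 0
  add_mem' hf hg := letI := A.naturalTopology; IsLocallyConstant.add hf hg
  smul_mem' a _ hf := letI := A.naturalTopology; IsLocallyConstant.comp hf (fun y => a * y)

/-! ### Vector fields -/

/-- Not necessarily smooth sections of the tangent bundle. -/
abbrev Section : Type _ := ∀ p : M, A.TangentSpace p

section Coordinates

variable {F : Type*} [AddCommGroup F] [Module ℝ F] [TopologicalSpace F]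

/-- The representation of a section in a chart. -/
def rep (χ : PartialEquiv M F) (X : A.Section) (x : F) : F :=
  A.toCoord χ (χ.symm x) (X (χ.symm x))

end Coordinates

/-- `X ∈ 𝔛(M)`: smooth vector fields. -/
def SmoothField (X : A.Section) : Prop :=
  ∀ i, CSmoothOn (A.rep (A.chart i) X) (A.chart i).target

/-- Bounded sets of `𝔛(M)`. -/
def BoundedFields (B : Set A.Section) : Prop :=
  ∀ i, SmoothBounded (A.chart i).target (A.rep (A.chart i) '' B)

/-- The Lie bracket of vector fields, `[X, Y] = dY.X - dX.Y` in a chart. -/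
def lieBracket (X Y : A.Section) : A.Section := fun p =>
  dirDeriv (A.rep (A.chartAt p) Y) (A.chartAt p p) (X p) -
    dirDeriv (A.rep (A.chartAt p) X) (A.chartAt p p) (Y p)

/-! ### Differential forms of degree one -/

/-- Arbitrary real functions on the tangent spaces; `1`-forms are among them. -/
abbrev Cochain : Type _ := ∀ p : M, A.TangentSpace p → ℝ

/-- The representation of a `1`-form in the chart `χ`. -/
def rep₁ {F : Type*} [AddCommGroup F] [Module ℝ F] [TopologicalSpace F]
    (χ : PartialEquiv M F) (φ : A.Cochain) (x v : F) : ℝ :=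
  φ (χ.symm x) (A.ofCoord χ (χ.symm x) v)

/-- `φ ∈ Ω^1(M)`: smooth `1`-forms. -/
def SmoothOneForm (φ : A.Cochain) : Prop :=
  (∀ p, IsLinearMap ℝ (φ p)) ∧
  ∀ i, CSmoothOn (fun z : E i × E i => A.rep₁ (A.chart i) φ z.1 z.2)
    ((A.chart i).target ×ˢ univ)

/-- Closed smooth `1`-forms: `dφ(v, w) = d(φ(w))(v) - d(φ(v))(w)` vanishes in every chart. -/
def ClosedOneForm (φ : A.Cochain) : Prop :=
  A.SmoothOneForm φ ∧ ∀ i, ∀ x ∈ (A.chart i).target, ∀ v w : E i,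
    dirDeriv (fun y => A.rep₁ (A.chart i) φ y w) x v -
      dirDeriv (fun y => A.rep₁ (A.chart i) φ y v) x w = 0

/-! ### Differential forms of degree two -/

/-- Not necessarily smooth sections of bilinear forms on the tangent spaces. -/
abbrev BilinSection : Type _ := ∀ p : M, A.TangentSpace p →ₗ[ℝ] A.TangentSpace p →ₗ[ℝ] ℝ

variable {A}

namespace BilinSection

variable (ω : A.BilinSection)

/-- The representation of a `2`-form in the chart `χ`. -/
def rep₂ {F : Type*} [AddCommGroup F] [Module ℝ F] [TopologicalSpace F]
    (χ : PartialEquiv M F) (x v w : F) : ℝ :=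
  ω (χ.symm x) (A.ofCoord χ (χ.symm x) v) (A.ofCoord χ (χ.symm x) w)

/-- `ω ∈ Ω^2(M)`: smooth `2`-forms. -/
def SmoothTwoForm : Prop :=
  (∀ p, (ω p).IsAlt) ∧
  ∀ i, CSmoothOn (fun z : E i × E i × E i => rep₂ ω (A.chart i) z.1 z.2.1 z.2.2)
    ((A.chart i).target ×ˢ univ)

/-- `dω = 0`, in every chart. -/
def Closed : Prop :=
  ∀ i, ∀ x ∈ (A.chart i).target, ∀ u v w : E i,
    dirDeriv (fun y => rep₂ ω (A.chart i) y v w) x u -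
      dirDeriv (fun y => rep₂ ω (A.chart i) y u w) x v +
      dirDeriv (fun y => rep₂ ω (A.chart i) y u v) x w = 0

/-- The `ω`-gradient of `ω` exists and is smooth in the chart `χ`: with maps `G` and `G'` that are
smooth, and bilinear in the last two arguments,
`dω(x)(u)(v, w) = ω(G_x(v, w), u) = ω(G'_x(u, v), w)`. -/
def HasSelfGradientIn {F : Type*} [AddCommGroup F] [Module ℝ F] [TopologicalSpace F]
    (χ : PartialEquiv M F) : Prop :=
  ∃ G G' : F → F →ₗ[ℝ] F →ₗ[ℝ] F,
    CSmoothOn (fun z : F × F × F => G z.1 z.2.1 z.2.2) (χ.target ×ˢ univ) ∧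
    CSmoothOn (fun z : F × F × F => G' z.1 z.2.1 z.2.2) (χ.target ×ˢ univ) ∧
    ∀ x ∈ χ.target, ∀ u v w : F,
      dirDeriv (fun y => rep₂ ω χ y v w) x u = rep₂ ω χ x (G x v w) u ∧
      dirDeriv (fun y => rep₂ ω χ y v w) x u = rep₂ ω χ x (G' x u v) w

/-- Weak symplectic structures: closed smooth `2`-forms `ω` such that `v ↦ ω(v, ·)` is injective on
every tangent space and such that the `ω`-gradient of `ω` exists and is smooth (in suitable charts
of the manifold, around each point). -/
structure IsWeakSymplectic : Prop where
  smooth : SmoothTwoForm ω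
  closed : Closed ω
  injective : ∀ p, Function.Injective (ω p)
  selfGradient : ∀ p : M, ∃ (i : ι) (χ : PartialEquiv M (E i)),
    A.IsChart χ ∧ p ∈ χ.source ∧ HasSelfGradientIn ω χ

/-- The `1`-form `i_X ω = ω(X, ·)`. -/
def contract (X : A.Section) : A.Cochain := fun p v => ω p (X p) v

/-- `X` is a smooth `ω`-gradient of `f`: `df = i_X ω`. -/
def IsGradient (f : M → ℝ) (X : A.Section) : Prop :=
  A.SmoothField X ∧ A.differential f = contract ω X

/-- `f ∈ C^∞_ω(M, ℝ)`: smooth functions which admit a smooth `ω`-gradient. -/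
def OmegaSmooth (f : M → ℝ) : Prop :=
  A.SmoothFunction f ∧ ∃ X, IsGradient ω f X

/-- Bounded sets of `C^∞_ω(M, ℝ)`, for the initial structure with respect to the inclusion into
`C^∞(M, ℝ)` and the gradient map into `𝔛(M)`. -/
def OmegaBounded (B : Set (M → ℝ)) : Prop :=
  A.BoundedFunctions B ∧ A.BoundedFields {X | ∃ f ∈ B, IsGradient ω f X}

/-- `X ∈ 𝔛(M, ω)`: smooth vector fields with vanishing Lie derivative of `ω`; in a chart
`(L_X ω)(v, w) = dω(X)(v, w) + ω(dX.v, w) + ω(v, dX.w)`. -/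
def SymplecticField (X : A.Section) : Prop :=
  A.SmoothField X ∧ ∀ i, ∀ x ∈ (A.chart i).target, ∀ v w : E i,
    dirDeriv (fun y => rep₂ ω (A.chart i) y v w) x (A.rep (A.chart i) X x) +
      rep₂ ω (A.chart i) x (dirDeriv (A.rep (A.chart i) X) x v) w +
      rep₂ ω (A.chart i) x v (dirDeriv (A.rep (A.chart i) X) x w) = 0

/-- Closed `1`-forms that are smooth sections of the `ω`-smooth cotangent bundle `T^ωM`, whose
smooth structure is the one of `TM` under the isomorphism `v ↦ ω(v, ·)`. -/
def ClosedOmegaForm (φ : A.Cochain) : Prop :=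
  A.ClosedOneForm φ ∧ ∃ X, A.SmoothField X ∧ φ = contract ω X

end BilinSection

end ConvenientManifold

/-- A bilinear map is a Lie bracket: it is alternating and satisfies the Jacobi identity. -/
def IsLieBracket {L : Type*} [AddCommGroup L] [Module ℝ L] (b : L →ₗ[ℝ] L →ₗ[ℝ] L) : Prop :=
  (∀ x, b x x = 0) ∧ ∀ x y z, b x (b y z) = b (b x y) z + b y (b x z)

end

/-! The symplectic algebra rests on one identity: if $X$ and $Y$ are symplectic fields, then
$d(\omega(Y,X)) = i_{[X,Y]}\omega$. In a chart it follows from $d\omega=0$ and the two invariance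
equations (`IsClosedFormOn.dirDeriv_apply_of_invariant`). Since $d$ and $\omega$ are intrinsic and
$v\mapsto\omega(v,\cdot)$ is injective, the identity gives several facts at once. The bracket of
symplectic fields has the expected formula in every chart and is smooth and symplectic. The function
$\omega(Y,X)$ lies in $C^\infty_\omega$, so the Poisson bracket stays there. Moreover
$\operatorname{grad}\{f,g\}=[\operatorname{grad}f,\operatorname{grad}g]$, and brackets have class
zero in $H^1_\omega$. Adding the three invariance equations cyclically and using $d\omega=0$ once
more gives $\omega([Y,Z],X)+\omega([Z,X],Y)+\omega([X,Y],Z)=0$. This is the Jacobi identity for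
functions, and its differential is the Jacobi identity for fields.

Exactness uses Cartan's formula: $X$ is symplectic if and only if $i_X\omega$ is closed. The kernel
of the gradient consists of the functions with $df=0$, which are locally constant because they are
constant along smooth curves. The map $H^1_\omega\to H^1$ is injective because $i_X\omega=df$
already says that $X$ is a gradient of $f$.

All this needs a differential calculus in which only curves are known to be smooth. Scalar tests
reduce it to functions on the plane, where Boman's theorem (`contDiff_of_smooth_along_curves`) turns
smoothness along curves into ordinary smoothness. The chain rule, linearity of the derivative,
smoothness of the derivative and symmetry of second derivatives are then read off from suitable maps
of the plane into the space.

For boundedness, a bounded set of maps is regarded as one smooth map into an $\ell^\infty$ space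
(`SmoothBounded.exists_smooth_lp`). Directional derivatives along bounded sets of fields are then
bounded (`SmoothBounded.dirDeriv`). In charts $\{f,g\}$ is one such derivative, and its gradient is
a difference of two. -/

set_option linter.unusedSectionVars false

noncomputable section

section ConvenientCalculus

open scoped ContDiff

/-! ## Curves -/

section Curves

variable {E : Type*} [AddCommGroup E] [Module ℝ E] [TopologicalSpace E]
  {F : Type*} [AddCommGroup F] [Module ℝ F] [TopologicalSpace F]
  {G : Type*} [NormedAddCommGroup G] [NormedSpace ℝ G]

theorem hasVelocity_iff_hasDerivAt {c : ℝ → G} {v : G} {t : ℝ} :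
    HasVelocity c v t ↔ HasDerivAt c v t :=
  hasDerivAt_iff_tendsto_slope_zero.symm

theorem HasVelocity.velocity_eq [T2Space E] {c : ℝ → E} {v : E} {t : ℝ} (h : HasVelocity c v t) :
    velocity c t = v :=
  Tendsto.limUnder_eq h

theorem HasVelocity.unique [T2Space E] {c : ℝ → E} {v w : E} {t : ℝ} (h : HasVelocity c v t)
    (h' : HasVelocity c w t) : v = w :=
  tendsto_nhds_unique h h'

theorem HasVelocity.congr_of_eventuallyEq {c c' : ℝ → E} {v : E} {t : ℝ} (h : HasVelocity c v t)
    (hc : c' =ᶠ[𝓝 t] c) : HasVelocity c' v t := by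
  refine Tendsto.congr' ?_ h
  have h1 : Tendsto (fun s : ℝ => t + s) (𝓝[≠] 0) (𝓝 t) := by
    have : Tendsto (fun s : ℝ => t + s) (𝓝 0) (𝓝 (t + 0)) := (continuous_const_add t).tendsto 0
    rw [add_zero] at this
    exact this.mono_left nhdsWithin_le_nhds
  filter_upwards [h1.eventually hc] with s hs
  rw [hs, hc.self_of_nhds]

theorem velocity_congr [T2Space E] {c c' : ℝ → E} {t : ℝ} (hc : c' =ᶠ[𝓝 t] c) :
    velocity c' t = velocity c t := by
  unfold velocity limUnder
  congr 1
  refine Filter.map_congr ?_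
  have h1 : Tendsto (fun s : ℝ => t + s) (𝓝[≠] 0) (𝓝 t) := by
    have : Tendsto (fun s : ℝ => t + s) (𝓝 0) (𝓝 (t + 0)) := (continuous_const_add t).tendsto 0
    rw [add_zero] at this
    exact this.mono_left nhdsWithin_le_nhds
  filter_upwards [h1.eventually hc] with s hs
  rw [hs, hc.self_of_nhds]

theorem HasVelocity.map {c : ℝ → E} {v : E} {t : ℝ} (h : HasVelocity c v t) (l : E →L[ℝ] F) :
    HasVelocity (fun s => l (c s)) (l v) t := by
  have := (l.continuous.tendsto v).comp h
  refine this.congr fun s => ?_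
  simp

theorem HasVelocity.prodMk {c : ℝ → E} {c' : ℝ → F} {v : E} {v' : F} {t : ℝ}
    (h : HasVelocity c v t) (h' : HasVelocity c' v' t) :
    HasVelocity (fun s => (c s, c' s)) (v, v') t :=
  (Tendsto.prodMk_nhds h h').congr fun _ => rfl

theorem smoothCurve_iff_contDiff {c : ℝ → G} : SmoothCurve c ↔ ContDiff ℝ ∞ c := by
  constructor
  · rintro ⟨d, rfl, hd⟩
    rw [contDiff_infty]
    intro n
    suffices h : ∀ (n m : ℕ), ContDiff ℝ n (d m) from h n 0
    intro n
    induction n with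
    | zero =>
      intro m
      have : Differentiable ℝ (d m) := fun t =>
        (hasVelocity_iff_hasDerivAt.1 (hd m t)).differentiableAt
      exact contDiff_zero.2 this.continuous
    | succ n ih =>
      intro m
      have h1 : ∀ t, HasDerivAt (d m) (d (m + 1) t) t := fun t =>
        hasVelocity_iff_hasDerivAt.1 (hd m t)
      push_cast
      rw [contDiff_succ_iff_deriv]
      refine ⟨fun t => (h1 t).differentiableAt, by simp, ?_⟩
      rw [funext fun t => (h1 t).deriv]
      exact ih _
  · intro h
    refine ⟨fun n => iteratedDeriv n c, iteratedDeriv_zero, fun n t => ?_⟩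
    simp only [hasVelocity_iff_hasDerivAt, iteratedDeriv_succ, hasDerivAt_deriv_iff]
    exact h.differentiable_iteratedDeriv n (mod_cast ENat.natCast_lt_top n) t

/-- Limits in a Hausdorff space are unique, so any witness of smoothness is the sequence of iterated
velocities. Later formulas for iterated velocities are proved by exhibiting such a sequence. -/
theorem SmoothCurve.iterate_velocity_eq [T2Space E] {d : ℕ → ℝ → E}
    (hd : ∀ n t, HasVelocity (d n) (d (n + 1) t) t) (n : ℕ) : velocity^[n] (d 0) = d n := by
  induction n with
  | zero => rfl
  | succ n ih =>
    rw [Function.iterate_succ_apply', ih]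
    exact funext fun t => (hd n t).velocity_eq

theorem SmoothCurve.hasVelocity_iterate [T2Space E] {c : ℝ → E} (hc : SmoothCurve c) (n : ℕ)
    (t : ℝ) : HasVelocity (velocity^[n] c) (velocity^[n + 1] c t) t := by
  obtain ⟨d, rfl, hd⟩ := hc
  rw [SmoothCurve.iterate_velocity_eq hd, SmoothCurve.iterate_velocity_eq hd]
  exact hd n t

theorem SmoothCurve.hasVelocity [T2Space E] {c : ℝ → E} (hc : SmoothCurve c) (t : ℝ) :
    HasVelocity c (velocity c t) t :=
  hc.hasVelocity_iterate 0 t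

theorem SmoothCurve.velocity [T2Space E] {c : ℝ → E} (hc : SmoothCurve c) :
    SmoothCurve (velocity c) :=
  ⟨fun n => _root_.velocity^[n + 1] c, rfl, fun n t => hc.hasVelocity_iterate (n + 1) t⟩

theorem SmoothCurve.map {c : ℝ → E} (hc : SmoothCurve c) (l : E →L[ℝ] F) :
    SmoothCurve (fun t => l (c t)) := by
  obtain ⟨d, rfl, hd⟩ := hc
  exact ⟨fun n t => l (d n t), rfl, fun n t => (hd n t).map l⟩

theorem SmoothCurve.iterate_velocity_map [T2Space E] [T2Space F] {c : ℝ → E} (hc : SmoothCurve c)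
    (l : E →L[ℝ] F) (n : ℕ) :
    _root_.velocity^[n] (fun t => l (c t)) = fun t => l (_root_.velocity^[n] c t) :=
  SmoothCurve.iterate_velocity_eq (d := fun n t => l (_root_.velocity^[n] c t))
    (fun n t => (hc.hasVelocity_iterate n t).map l) n

theorem SmoothCurve.prodMk {c : ℝ → E} {c' : ℝ → F} (hc : SmoothCurve c) (hc' : SmoothCurve c') :
    SmoothCurve (fun t => (c t, c' t)) := by
  obtain ⟨d, rfl, hd⟩ := hc
  obtain ⟨d', rfl, hd'⟩ := hc'
  exact ⟨fun n t => (d n t, d' n t), rfl, fun n t => (hd n t).prodMk (hd' n t)⟩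

theorem SmoothCurve.fst {c : ℝ → E × F} (hc : SmoothCurve c) : SmoothCurve (fun t => (c t).1) :=
  hc.map (ContinuousLinearMap.fst ℝ E F)

theorem SmoothCurve.snd {c : ℝ → E × F} (hc : SmoothCurve c) : SmoothCurve (fun t => (c t).2) :=
  hc.map (ContinuousLinearMap.snd ℝ E F)

theorem SmoothCurve.contDiff {c : ℝ → G} (hc : SmoothCurve c) : ContDiff ℝ ∞ c :=
  smoothCurve_iff_contDiff.1 hc

theorem smoothCurve_const (x : E) : SmoothCurve (fun _ : ℝ => x) := by
  refine ⟨fun n _ => if n = 0 then x else 0, by simp, fun n t => ?_⟩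
  simp [HasVelocity, tendsto_const_nhds]

theorem SmoothCurve.contDiff_map {c : ℝ → E} (hc : SmoothCurve c) (l : E →L[ℝ] ℝ) :
    ContDiff ℝ ∞ (fun t => l (c t)) :=
  (hc.map l).contDiff

theorem hasVelocity_line (x v : E) (t : ℝ) : HasVelocity (fun s : ℝ => x + s • v) v t := by
  refine tendsto_const_nhds.congr' ?_
  filter_upwards [self_mem_nhdsWithin] with s hs
  rw [add_smul, add_sub_add_left_eq_sub, add_sub_cancel_left, smul_smul, inv_mul_cancel₀ hs,
    one_smul]

end Curves

/-! ### Convenient spaces and scalar tests for curves -/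

section Convenient

variable {E : Type*} [AddCommGroup E] [Module ℝ E] [TopologicalSpace E] [ConvenientSpace E]
  {F : Type*} [AddCommGroup F] [Module ℝ F] [TopologicalSpace F] [ConvenientSpace F]

instance : ConvenientSpace ℝ where
  smoothCurve_of_scalarwise _ h := h (ContinuousLinearMap.id ℝ ℝ)

instance : ConvenientSpace (E × F) where
  smoothCurve_of_scalarwise c h :=
    (ConvenientSpace.smoothCurve_of_scalarwise (fun t => (c t).1)
      fun l => h (l.comp (ContinuousLinearMap.fst ℝ E F))).prodMk
    (ConvenientSpace.smoothCurve_of_scalarwise (fun t => (c t).2)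
      fun l => h (l.comp (ContinuousLinearMap.snd ℝ E F)))

/-- By $c^\infty$-completeness, operations on smooth curves need checking only after composition
with a functional, where the usual rules for real functions apply. -/
theorem smoothCurve_iff_scalarwise {c : ℝ → E} :
    SmoothCurve c ↔ ∀ l : E →L[ℝ] ℝ, ContDiff ℝ ∞ (fun t => l (c t)) :=
  ⟨fun h l => (h.map l).contDiff, fun h => ConvenientSpace.smoothCurve_of_scalarwise c
    fun l => smoothCurve_iff_contDiff.2 (h l)⟩

theorem SmoothCurve.add {c c' : ℝ → E} (hc : SmoothCurve c) (hc' : SmoothCurve c') :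
    SmoothCurve (fun t => c t + c' t) :=
  smoothCurve_iff_scalarwise.2 fun l => by
    simpa using (hc.contDiff_map l).add (hc'.contDiff_map l)

theorem SmoothCurve.sub {c c' : ℝ → E} (hc : SmoothCurve c) (hc' : SmoothCurve c') :
    SmoothCurve (fun t => c t - c' t) :=
  smoothCurve_iff_scalarwise.2 fun l => by
    simpa using (hc.contDiff_map l).sub (hc'.contDiff_map l)

theorem SmoothCurve.smul {a : ℝ → ℝ} {c : ℝ → E} (ha : SmoothCurve a) (hc : SmoothCurve c) :
    SmoothCurve (fun t => a t • c t) :=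
  smoothCurve_iff_scalarwise.2 fun l => by
    simpa using ha.contDiff.mul (hc.contDiff_map l)

theorem SmoothCurve.comp {c : ℝ → E} {h : ℝ → ℝ} (hc : SmoothCurve c) (hh : SmoothCurve h) :
    SmoothCurve (fun t => c (h t)) :=
  smoothCurve_iff_scalarwise.2 fun l => (hc.contDiff_map l).comp hh.contDiff

theorem smoothCurve_id : SmoothCurve (fun t : ℝ => t) :=
  smoothCurve_iff_contDiff.2 contDiff_id

theorem smoothCurve_line (x v : E) : SmoothCurve (fun t : ℝ => x + t • v) :=
  (smoothCurve_const x).add (smoothCurve_id.smul (smoothCurve_const v))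

/-- Hahn–Banach separation of points. It reduces identities between vector-valued derivatives to
real ones. -/
theorem eq_of_forall_dual_eq {x y : E} (h : ∀ l : E →L[ℝ] ℝ, l x = l y) : x = y := by
  by_contra hxy
  obtain ⟨l, hl⟩ := geometric_hahn_banach_point_point hxy
  exact hl.ne (h l)

theorem HasVelocity.add {c c' : ℝ → E} {v v' : E} {t : ℝ} (h : HasVelocity c v t)
    (h' : HasVelocity c' v' t) : HasVelocity (fun s => c s + c' s) (v + v') t := by
  refine (Tendsto.add h h').congr fun s => ?_
  rw [← smul_add, add_sub_add_comm]

theorem HasVelocity.sub {c c' : ℝ → E} {v v' : E} {t : ℝ} (h : HasVelocity c v t)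
    (h' : HasVelocity c' v' t) : HasVelocity (fun s => c s - c' s) (v - v') t := by
  refine (Tendsto.sub h h').congr fun s => ?_
  rw [← smul_sub, sub_sub_sub_comm]

theorem HasVelocity.const_smul {c : ℝ → E} {v : E} {t : ℝ} (a : ℝ) (h : HasVelocity c v t) :
    HasVelocity (fun s => a • c s) (a • v) t := by
  refine (Tendsto.const_smul h a).congr fun s => ?_
  rw [smul_comm, smul_sub]

end Convenient

/-! ### Banach spaces are convenient -/

section Banach

variable {G : Type*} [NormedAddCommGroup G] [NormedSpace ℝ G]

/-- Weakly bounded families in a normed space are bounded. -/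
theorem exists_norm_le_of_forall_dual {J : Type*} (x : J → G)
    (h : ∀ l : G →L[ℝ] ℝ, ∃ C, ∀ j, |l (x j)| ≤ C) : ∃ C, ∀ j, ‖x j‖ ≤ C := by
  -- The vectors are viewed as functionals on the dual, which is complete whether or not `G` is.
  obtain ⟨C, hC⟩ := banach_steinhaus
    (g := fun j => NormedSpace.inclusionInDoubleDualLi (E := G) ℝ (x j)) (fun l => by
      obtain ⟨C, hC⟩ := h l
      exact ⟨C, fun j => hC j⟩)
  refine ⟨C, fun j => ?_⟩
  rw [← (NormedSpace.inclusionInDoubleDualLi (E := G) ℝ).norm_map]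
  exact hC j

/-- The mean value inequality is used twice: first for $q'$, then for $q(s)-(s-t)q'(t)$, whose
derivative is at most $C|h|$ in absolute value. The sharp factor $1/2$ is not needed. -/
theorem abs_sub_sub_mul_le {q q' : ℝ → ℝ} {q'' : ℝ → ℝ} {t h C : ℝ}
    (h1 : ∀ s, HasDerivAt q (q' s) s) (h2 : ∀ s, HasDerivAt q' (q'' s) s)
    (hC : ∀ s ∈ uIcc t (t + h), |q'' s| ≤ C) :
    |q (t + h) - q t - h * q' t| ≤ C * h ^ 2 := by
  have hb : ∀ s ∈ uIcc t (t + h), |q' s - q' t| ≤ C * |h| := by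
    intro s hs
    have h3 := (convex_uIcc t (t + h)).norm_image_sub_le_of_norm_hasDerivWithin_le
      (fun x _ => (h2 x).hasDerivWithinAt) (fun x hx => hC x hx) left_mem_uIcc hs
    refine h3.trans ?_
    have h4 : |s - t| ≤ |h| := by
      have := abs_sub_left_of_mem_uIcc hs
      simpa using this
    exact mul_le_mul_of_nonneg_left h4 ((abs_nonneg _).trans (hC t left_mem_uIcc))
  have h5 := (convex_uIcc t (t + h)).norm_image_sub_le_of_norm_hasDerivWithin_le
    (f := fun s => q s - (s - t) * q' t) (f' := fun s => q' s - 1 * q' t)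
    (fun x _ => ((h1 x).sub (((hasDerivAt_id x).sub_const t).mul_const _)).hasDerivWithinAt)
    (fun x hx => by simpa using hb x hx) left_mem_uIcc right_mem_uIcc
  have e : q (t + h) - (t + h - t) * q' t - (q t - (t - t) * q' t) =
      q (t + h) - q t - h * q' t := by ring
  rw [Real.norm_eq_abs, e, Real.norm_eq_abs, add_sub_cancel_left, mul_assoc, abs_mul_abs_self]
    at h5
  rwa [pow_two]

variable [CompleteSpace G]

/-- Taylor's estimate bounds each functional on $(Q(s)-Q(s'))/(|s|+|s'|)$, where $Q$ is the
difference quotient. Weakly bounded sets are norm bounded, so $Q$ is Cauchy at $0$ and completeness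
supplies the derivative. -/
theorem exists_hasDerivAt_of_scalarwise {c : ℝ → G}
    (h : ∀ l : G →L[ℝ] ℝ, ContDiff ℝ ∞ (fun t => l (c t))) (t : ℝ) : ∃ v, HasDerivAt c v t := by
  set Q : ℝ → G := fun s => s⁻¹ • (c (t + s) - c t) with hQ
  let J := {p : ℝ × ℝ // (p.1 ∈ Icc (-1 : ℝ) 1 ∧ p.1 ≠ 0) ∧ p.2 ∈ Icc (-1 : ℝ) 1 ∧ p.2 ≠ 0}
  obtain ⟨C, hC⟩ := exists_norm_le_of_forall_dual
    (fun p : J => (|p.1.1| + |p.1.2|)⁻¹ • (Q p.1.1 - Q p.1.2)) (by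
      intro l
      have hl := h l
      have h1 : ∀ s, HasDerivAt (fun t => l (c t)) (deriv (fun t => l (c t)) s) s := fun s =>
        (hl.differentiable (by simp) s).hasDerivAt
      have hl' := (contDiff_infty_iff_deriv.1 hl).2
      have h2 : ∀ s, HasDerivAt (deriv (fun t => l (c t))) (deriv (deriv fun t => l (c t)) s) s :=
        fun s => (hl'.differentiable (by simp) s).hasDerivAt
      obtain ⟨C, hC⟩ := (isCompact_Icc (a := t - 1) (b := t + 1)).exists_bound_of_continuousOn
        (contDiff_infty_iff_deriv.1 hl').2.continuous.continuousOn
      have key : ∀ s ∈ Icc (-1 : ℝ) 1, s ≠ 0 →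
          |l (Q s) - deriv (fun t => l (c t)) t| ≤ C * |s| := by
        intro s hs hs0
        have h3 := abs_sub_sub_mul_le h1 h2 (t := t) (h := s) (C := C) (fun x hx => hC x (by
          rcases le_total t (t + s) with hts | hts
          · rw [uIcc_of_le hts] at hx; exact ⟨by linarith [hx.1], by linarith [hx.2, hs.2]⟩
          · rw [uIcc_of_ge hts] at hx
            exact ⟨by linarith [hx.1, hs.1], by linarith [hx.2, hs.2]⟩))
        have h4 : l (Q s) - deriv (fun t => l (c t)) t =
            s⁻¹ * (l (c (t + s)) - l (c t) - s * deriv (fun t => l (c t)) t) := by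
          simp only [hQ, map_smul, map_sub, smul_eq_mul]
          field_simp
        rw [h4, abs_mul, abs_inv, inv_mul_le_iff₀ (abs_pos.2 hs0)]
        refine h3.trans (le_of_eq ?_)
        rw [← sq_abs]; ring
      refine ⟨C, fun ⟨⟨s, s'⟩, ⟨hs, hs0⟩, hs', hs0'⟩ => ?_⟩
      have hpos : 0 < |s| + |s'| := by positivity
      simp only [map_smul, map_sub, smul_eq_mul, abs_mul, abs_inv, abs_of_pos hpos]
      rw [inv_mul_le_iff₀ hpos]
      have a1 := key s hs hs0
      have a2 := key s' hs' hs0'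
      rw [abs_le] at a1 a2 ⊢
      constructor <;> nlinarith)
  have hcauchy : Cauchy (map Q (𝓝[≠] 0)) := by
    rw [Metric.cauchy_iff]
    refine ⟨inferInstance, fun ε hε => ?_⟩
    -- The maximum with $1$ makes the radius $\varepsilon/(2D)$ meaningful for every value of $C$.
    set D := max C 1 with hD
    have hD1 : 1 ≤ D := le_max_right _ _
    have hD0 : 0 < D := by linarith
    refine ⟨Q '' (Ioo (-(min 1 (ε / (2 * D)))) (min 1 (ε / (2 * D))) ∩ {0}ᶜ), ?_, ?_⟩
    · refine image_mem_map (inter_mem (mem_nhdsWithin_of_mem_nhds (Ioo_mem_nhds ?_ ?_))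
        self_mem_nhdsWithin)
      · have : 0 < min 1 (ε / (2 * D)) := by positivity
        linarith
      · positivity
    · rintro _ ⟨s, ⟨hs, hs0⟩, rfl⟩ _ ⟨s', ⟨hs', hs0'⟩, rfl⟩
      have hs0 : s ≠ 0 := hs0
      have hs0' : s' ≠ 0 := hs0'
      have b1 : |s| < min 1 (ε / (2 * D)) := abs_lt.2 hs
      have b2 : |s'| < min 1 (ε / (2 * D)) := abs_lt.2 hs'
      have c1 := b1.trans_le (min_le_left _ _)
      have c2 := b2.trans_le (min_le_left _ _)
      have d1 := b1.trans_le (min_le_right _ _)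
      have d2 := b2.trans_le (min_le_right _ _)
      have h1 := hC ⟨(s, s'), ⟨⟨(abs_lt.1 c1).1.le, (abs_lt.1 c1).2.le⟩, hs0⟩,
        ⟨(abs_lt.1 c2).1.le, (abs_lt.1 c2).2.le⟩, hs0'⟩
      have hpos : 0 < |s| + |s'| := by positivity
      simp only [norm_smul, norm_inv, Real.norm_eq_abs, abs_of_pos hpos] at h1
      rw [inv_mul_le_iff₀ hpos] at h1
      rw [dist_eq_norm]
      refine h1.trans_lt ?_
      rw [lt_div_iff₀ (by positivity)] at d1 d2
      have : (|s| + |s'|) * C ≤ (|s| + |s'|) * D :=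
        mul_le_mul_of_nonneg_left (le_max_left _ _) hpos.le
      nlinarith
  obtain ⟨v, hv⟩ := CompleteSpace.complete hcauchy
  exact ⟨v, hasDerivAt_iff_tendsto_slope_zero.2 hv⟩

/-- The derivative of a scalarwise smooth curve is again scalarwise smooth, so the existence of one
derivative can be iterated. -/
instance ConvenientSpace.of_completeSpace : ConvenientSpace G where
  smoothCurve_of_scalarwise c h := by
    have key : ∀ c : ℝ → G, (∀ l : G →L[ℝ] ℝ, ContDiff ℝ ∞ (fun t => l (c t))) →
        Differentiable ℝ c ∧ ∀ l : G →L[ℝ] ℝ, ContDiff ℝ ∞ (fun t => l (deriv c t)) := by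
      intro c hc
      have hd : Differentiable ℝ c := fun t =>
        (exists_hasDerivAt_of_scalarwise hc t).choose_spec.differentiableAt
      refine ⟨hd, fun l => ?_⟩
      have : (fun t => l (deriv c t)) = deriv fun t => l (c t) := by
        funext t
        exact (l.hasFDerivAt.comp_hasDerivAt t (hd t).hasDerivAt).deriv.symm
      rw [this]
      exact (contDiff_infty_iff_deriv.1 (hc l)).2
    have h0 : ∀ l : G →L[ℝ] ℝ, ContDiff ℝ ∞ (fun t => l (c t)) := fun l => (h l).contDiff
    have h1 : ∀ n : ℕ, ∀ l : G →L[ℝ] ℝ, ContDiff ℝ ∞ (fun t => l (iteratedDeriv n c t)) := by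
      intro n
      induction n with
      | zero => simpa using h0
      | succ n ih =>
        rw [iteratedDeriv_succ]
        exact (key _ ih).2
    refine ⟨fun n => iteratedDeriv n c, iteratedDeriv_zero, fun n t => ?_⟩
    simp only [hasVelocity_iff_hasDerivAt, iteratedDeriv_succ, hasDerivAt_deriv_iff]
    exact (key _ (h1 n)).1 t

end Banach

/-! ### The special curve lemma -/

section SpecialCurve

/-- As soon as $n\ge k+1$, the exponent $n^2$ dominates $nk+n$. The weights $2^{-n^2}$ thus absorb
the factors $2^{nk}$ produced by differentiating $\varphi(2^n t)$ $k$ times. -/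
theorem summable_two_pow_mul_half_pow_sq (k : ℕ) :
    Summable fun n : ℕ => ((2 : ℝ) ^ n) ^ k * (1 / 2) ^ n ^ 2 := by
  refine summable_of_isBigO_nat (g := fun n : ℕ => (1 / 2 : ℝ) ^ n)
    (summable_geometric_of_lt_one (by norm_num) (by norm_num)) ?_
  refine Asymptotics.IsBigO.of_bound 1 ?_
  filter_upwards [eventually_ge_atTop (k + 1)] with n hn
  rw [one_mul, Real.norm_of_nonneg (by positivity), Real.norm_of_nonneg (by positivity),
    ← pow_mul, one_div, inv_pow, inv_pow, ← div_eq_mul_inv, div_le_iff₀ (by positivity),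
    inv_mul_eq_div, le_div_iff₀ (by positivity), ← pow_add]
  refine pow_le_pow_right₀ (by norm_num) ?_
  nlinarith

theorem iteratedDeriv_bound_of_hasCompactSupport {φ : ℝ → ℝ} (hφ : ContDiff ℝ ∞ φ)
    (hc : HasCompactSupport φ) (k : ℕ) : ∃ C, ∀ t, |iteratedDeriv k φ t| ≤ C := by
  obtain ⟨C, hC⟩ := (hc.iteratedFDeriv (𝕜 := ℝ) k).exists_bound_of_continuous
    (hφ.continuous_iteratedFDeriv (m := k) (mod_cast le_top))
  exact ⟨C, fun t => by
    rw [← Real.norm_eq_abs, ← norm_iteratedFDeriv_eq_norm_iteratedDeriv]; exact hC t⟩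

/-- The bump function around `1` used to glue curves. -/
def gluingBump : ContDiffBump (1 : ℝ) := ⟨1 / 8, 1 / 4, by norm_num, by norm_num⟩

theorem gluingBump_eq_zero {t : ℝ} (ht : 1 / 4 ≤ |t - 1|) : gluingBump t = 0 :=
  gluingBump.zero_of_le_dist ht

theorem gluingBump_eq_one {t : ℝ} (ht : |t - 1| ≤ 1 / 8) : gluingBump t = 1 :=
  gluingBump.one_of_mem_closedBall (show dist t 1 ≤ 1 / 8 from ht)

/-- The rescaled bumps live where $2^n t$ lies in $(3/4,5/4)$. These windows are disjoint for
different $n$, because $2\cdot 3/4>5/4$. -/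
theorem gluingBump_eq_zero_of_ne {m n : ℕ} (hmn : n ≠ m) {t : ℝ}
    (ht : |2 ^ m * t - 1| < 1 / 4) : gluingBump (2 ^ n * t) = 0 := by
  refine gluingBump_eq_zero ?_
  by_contra! h
  rw [abs_lt] at ht h
  rcases lt_or_gt_of_ne hmn with hlt | hlt
  · obtain ⟨d, rfl⟩ := Nat.exists_eq_add_of_lt hlt
    have h2 : (1 : ℝ) ≤ 2 ^ d := one_le_pow₀ (by norm_num)
    rw [show (2 : ℝ) ^ (n + d + 1) * t = 2 * 2 ^ d * (2 ^ n * t) by ring] at ht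
    nlinarith
  · obtain ⟨d, rfl⟩ := Nat.exists_eq_add_of_lt hlt
    have h2 : (1 : ℝ) ≤ 2 ^ d := one_le_pow₀ (by norm_num)
    rw [show (2 : ℝ) ^ (m + d + 1) * t = 2 * 2 ^ d * (2 ^ m * t) by ring] at h
    nlinarith

theorem gluing_support_finite (t : ℝ) :
    {n : ℕ | gluingBump (2 ^ n * t) ≠ 0}.Finite := by
  refine Set.Subsingleton.finite fun n hn m hm => ?_
  by_contra hnm
  exact hn (gluingBump_eq_zero_of_ne hnm (by
    by_contra! h; exact hm (gluingBump_eq_zero h)))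

/-- Smoothness of a series of rescaled bumps with rapidly decreasing coefficients. -/
theorem contDiff_tsum_rescaled {φ : ℝ → ℝ} (hφ : ContDiff ℝ ∞ φ) (hc : HasCompactSupport φ)
    {a : ℕ → ℝ} {C : ℝ} (ha : ∀ n, |a n| ≤ C) :
    ContDiff ℝ ∞ fun t => ∑' n : ℕ, (1 / 2) ^ n ^ 2 * a n * φ (2 ^ n * t) := by
  choose D hD using iteratedDeriv_bound_of_hasCompactSupport hφ hc
  refine contDiff_tsum (v := fun k n => ((2 : ℝ) ^ n) ^ k * (1 / 2) ^ n ^ 2 * (C * D k)) ?_ ?_ ?_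
  · intro n
    exact contDiff_const.mul (hφ.comp (contDiff_const.mul contDiff_id))
  · intro k _
    exact (summable_two_pow_mul_half_pow_sq k).mul_right _
  · intro k n t _
    have hsm : ContDiff ℝ k φ := hφ.of_le (mod_cast le_top)
    rw [norm_iteratedFDeriv_eq_norm_iteratedDeriv, iteratedDeriv_const_mul_field,
      iteratedDeriv_comp_const_mul hsm]
    simp only [norm_mul, norm_pow, Real.norm_eq_abs]
    rw [abs_of_pos (by norm_num : (0 : ℝ) < 1 / 2), abs_of_pos (by norm_num : (0 : ℝ) < 2)]
    have h1 : |a n| * |iteratedDeriv k φ (2 ^ n * t)| ≤ C * D k :=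
      mul_le_mul (ha n) (hD k _) (abs_nonneg _) ((abs_nonneg _).trans (ha n))
    calc _ = (2 ^ n) ^ k * (1 / 2) ^ n ^ 2 * (|a n| * |iteratedDeriv k φ (2 ^ n * t)|) := by ring
      _ ≤ _ := mul_le_mul_of_nonneg_left h1 (by positivity)

variable {E : Type*} [AddCommGroup E] [Module ℝ E] [TopologicalSpace E] [ConvenientSpace E]

/-- The special curve lemma: there is a smooth curve that runs near `2⁻ⁿ` through line segments
which converge rapidly to `x`. -/
theorem exists_smoothCurve_through (x : E) (a b : ℕ → E)
    (ha : ∀ l : E →L[ℝ] ℝ, ∃ C, ∀ n, |l (a n)| ≤ C)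
    (hb : ∀ l : E →L[ℝ] ℝ, ∃ C, ∀ n, |l (b n)| ≤ C) :
    ∃ c : ℝ → E, SmoothCurve c ∧ c 0 = x ∧ ∀ n : ℕ, ∀ᶠ r : ℝ in 𝓝 0,
      c ((1 / 2) ^ n + r) = x + (1 / 2 : ℝ) ^ n ^ 2 • (a n + r • b n) := by
  -- The $n$-th term is $2^{-n^2}\varphi(2^nt)\,(a_n+(t-2^{-n})b_n)$, with $t-2^{-n}$ written as
  -- $2^{-n}(2^nt-1)$ so that the $b_n$ part is also a rescaled compactly supported function.
  set f : ℝ → ℕ → E := fun t n => (1 / 2 : ℝ) ^ n ^ 2 • (gluingBump (2 ^ n * t) • a n +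
    ((1 / 2 : ℝ) ^ n * ((2 ^ n * t - 1) * gluingBump (2 ^ n * t))) • b n) with hf
  have hsupp : ∀ t, (Function.support (f t)) ⊆ {n : ℕ | gluingBump (2 ^ n * t) ≠ 0} := by
    intro t n hn h0
    exact hn (by simp [hf, h0])
  have hfin : ∀ t, (Function.support (f t)).Finite := fun t =>
    (gluing_support_finite t).subset (hsupp t)
  refine ⟨fun t => x + ∑ᶠ n, f t n, ?_, ?_, ?_⟩
  · refine (smoothCurve_const x).add (smoothCurve_iff_scalarwise.2 fun l => ?_)
    obtain ⟨A, hA⟩ := ha l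
    obtain ⟨B, hB⟩ := hb l
    have hB' : ∀ n : ℕ, |(1 / 2 : ℝ) ^ n * l (b n)| ≤ B := fun n => by
      rw [abs_mul, abs_of_pos (by positivity)]
      exact (mul_le_of_le_one_left (abs_nonneg _)
        (pow_le_one₀ (by norm_num) (by norm_num))).trans (hB n)
    have h1 := contDiff_tsum_rescaled gluingBump.contDiff gluingBump.hasCompactSupport hA
    have h2 := contDiff_tsum_rescaled (φ := fun r => (r - 1) * gluingBump r)
      ((contDiff_id.sub contDiff_const).mul gluingBump.contDiff)
      gluingBump.hasCompactSupport.mul_left hB'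
    convert h1.add h2 using 1
    funext t
    rw [show l (∑ᶠ n, f t n) = ∑ᶠ n, l (f t n) from
      (l : E →+ ℝ).map_finsum (hfin t)]
    have s1 : ∀ u : ℕ → ℝ, (Function.support fun n => u n * gluingBump (2 ^ n * t)).Finite :=
      fun u => (gluing_support_finite t).subset fun n hn h0 => hn (by simp [h0])
    have s2 : ∀ u : ℕ → ℝ, (Function.support fun n =>
        u n * ((2 ^ n * t - 1) * gluingBump (2 ^ n * t))).Finite :=
      fun u => (gluing_support_finite t).subset fun n hn h0 => hn (by simp [h0])
    rw [tsum_eq_finsum (s1 _), tsum_eq_finsum (s2 _), ← finsum_add_distrib (s1 _) (s2 _)]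
    refine finsum_congr fun n => ?_
    simp only [hf, map_smul, map_add, smul_eq_mul]
    ring
  · simp only [add_eq_left]
    refine finsum_eq_zero_of_forall_eq_zero fun n => ?_
    have : gluingBump (2 ^ n * (0 : ℝ)) = 0 := gluingBump_eq_zero (by norm_num)
    simp only [hf, this]
    simp
  · intro m
    have hev : ∀ᶠ r : ℝ in 𝓝 0, |2 ^ m * r| < 1 / 8 := by
      have : Tendsto (fun r : ℝ => |2 ^ m * r|) (𝓝 0) (𝓝 |2 ^ m * 0|) :=
        (by fun_prop : Continuous fun r : ℝ => |2 ^ m * r|).tendsto 0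
      exact this.eventually_lt_const (by norm_num)
    filter_upwards [hev] with r hr
    have e1 : (2 : ℝ) ^ m * ((1 / 2) ^ m + r) = 1 + 2 ^ m * r := by
      rw [mul_add, ← mul_pow]; norm_num
    have e2 : |(2 : ℝ) ^ m * ((1 / 2) ^ m + r) - 1| < 1 / 8 := by
      rw [e1]; simpa using hr
    rw [finsum_eq_single _ m fun n hn => by
      simp only [hf, gluingBump_eq_zero_of_ne hn (e2.trans (by norm_num))]
      simp]
    simp only [hf, gluingBump_eq_one e2.le, one_smul, mul_one]
    rw [e1, add_sub_cancel_left, ← mul_assoc, ← mul_pow]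
    norm_num

theorem half_pow_tendsto : Tendsto (fun n : ℕ => (1 / 2 : ℝ) ^ n) atTop (𝓝 0) :=
  tendsto_pow_atTop_nhds_zero_of_lt_one (by norm_num) (by norm_num)

/-- In a Banach space, `c^∞`-open sets are open. -/
theorem CInftyOpen.isOpen {G : Type*} [NormedAddCommGroup G] [NormedSpace ℝ G] [CompleteSpace G]
    {V : Set G} (hV : CInftyOpen V) : IsOpen V := by
  rw [Metric.isOpen_iff]
  intro x hx
  by_contra! h
  have h' : ∀ n : ℕ, ∃ y ∈ Metric.ball x ((1 / 2 : ℝ) ^ n ^ 2), y ∉ V := fun n =>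
    not_subset.1 (h _ (by positivity))
  choose y hy hyV using h'
  -- The points outside `V` lie within $2^{-n^2}$ of `x`, so rescaling leaves bounded vectors, and
  -- the curve meets $y_n$ exactly at time $2^{-n}$.
  obtain ⟨c, hc, hc0, hcn⟩ := exists_smoothCurve_through x
    (fun n => ((1 / 2 : ℝ) ^ n ^ 2)⁻¹ • (y n - x)) (fun _ => 0)
    (fun l => ⟨‖l‖ * 1, fun n => (l.le_opNorm _).trans (by
      refine mul_le_mul_of_nonneg_left ?_ (norm_nonneg _)
      rw [norm_smul, norm_inv, Real.norm_of_nonneg (by positivity), inv_mul_le_iff₀ (by positivity),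
        mul_one, ← dist_eq_norm]
      exact (hy n).le)⟩) (fun l => ⟨0, by simp⟩)
  have hopen := hV c hc
  have h0 : ∀ᶠ t in 𝓝 (0 : ℝ), c t ∈ V := hopen.mem_nhds (by simpa [hc0] using hx)
  obtain ⟨n, hn⟩ := (half_pow_tendsto.eventually h0).exists
  refine hyV n ?_
  have := (hcn n).self_of_nhds
  rw [smul_zero, add_zero, add_zero, smul_smul, mul_inv_cancel₀ (by positivity), one_smul,
    add_sub_cancel] at this
  rwa [this] at hn

end SpecialCurve

/-! ### Interpolation between decay of functions and growth of derivatives -/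

section Interpolation

/-- The `k`-th derivatives of the functions `u j n` are `O(2 ^ (a n))`, locally uniformly, and
uniformly in `j`. -/
def DerivGrowth {J : Type*} (u : J → ℕ → ℝ → ℝ) (k : ℕ) (a : ℝ) : Prop :=
  ∀ R : ℝ, ∃ C : ℝ, ∀ j n t, |t| ≤ R → |iteratedDeriv k (u j n) t| ≤ C * 2 ^ (a * n)

variable {J : Type*} {u : J → ℕ → ℝ → ℝ}

theorem DerivGrowth.mono {k : ℕ} {a b : ℝ} (h : DerivGrowth u k a) (hab : a ≤ b) :
    DerivGrowth u k b := by
  intro R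
  obtain ⟨C, hC⟩ := h R
  refine ⟨max C 0, fun j n t ht => (hC j n t ht).trans ?_⟩
  gcongr
  · exact le_max_left _ _
  · norm_num

/-- A Landau-type inequality: the middle derivative is a difference quotient of the lower one, up to
an error controlled by the upper one. -/
theorem DerivGrowth.interpolate (hu : ∀ j n, ContDiff ℝ ∞ (u j n)) {k : ℕ} {a b : ℝ}
    (ha : DerivGrowth u k a) (hb : DerivGrowth u (k + 2) b) (hab : a ≤ b) :
    DerivGrowth u (k + 1) ((a + b) / 2) := by
  intro R
  obtain ⟨A, hA⟩ := ha (R + 1)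
  obtain ⟨B, hB⟩ := hb (R + 1)
  refine ⟨2 * A + B, fun j n t ht => ?_⟩
  -- This step length balances $2^{an}/h$ against $2^{bn}h$: both equal $2^{(a+b)n/2}$. Since $a\le
  -- b$, it is at most $1$, so `t + h` stays within $R+1$.
  set h : ℝ := 2 ^ ((a - b) / 2 * n) with hh
  have h0 : 0 < h := by positivity
  have h1 : h ≤ 1 := Real.rpow_le_one_of_one_le_of_nonpos (by norm_num)
    (mul_nonpos_of_nonpos_of_nonneg (by linarith) (by positivity))
  have hd : ∀ m s, HasDerivAt (iteratedDeriv m (u j n)) (iteratedDeriv (m + 1) (u j n) s) s := by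
    intro m s
    rw [iteratedDeriv_succ, hasDerivAt_deriv_iff]
    exact (hu j n).differentiable_iteratedDeriv m (mod_cast ENat.natCast_lt_top m) s
  have ht' := abs_le.1 ht
  have key := abs_sub_sub_mul_le (hd k) (hd (k + 1)) (t := t) (h := h) (C := B * 2 ^ (b * n))
    (fun s hs => hB j n s (by
      rw [uIcc_of_le (by linarith)] at hs
      rw [abs_le]; constructor <;> linarith [hs.1, hs.2]))
  have a1 := hA j n t (by linarith)
  have a2 := hA j n (t + h) (by rw [abs_le]; constructor <;> linarith)
  have e1 : (2 : ℝ) ^ (a * n) = 2 ^ ((a + b) / 2 * n) * h := by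
    rw [hh, ← Real.rpow_add (by norm_num)]; ring_nf
  have e2 : (2 : ℝ) ^ (b * n) * h = 2 ^ ((a + b) / 2 * n) := by
    rw [hh, ← Real.rpow_add (by norm_num)]; ring_nf
  have e3 : B * 2 ^ (b * n) * h ^ 2 = B * 2 ^ ((a + b) / 2 * n) * h := by
    rw [← e2]; ring
  rw [e1] at a1 a2
  rw [e3] at key
  set X := (2 : ℝ) ^ ((a + b) / 2 * n)
  have : h * |iteratedDeriv (k + 1) (u j n) t| ≤ h * ((2 * A + B) * X) := by
    rw [← abs_of_pos h0, ← abs_mul, abs_of_pos h0]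
    rw [abs_le] at key a1 a2 ⊢
    constructor <;> nlinarith
  exact le_of_mul_le_mul_left this h0

/-- Rapid decay of the functions and moderate growth of all derivatives imply decay of all
derivatives. -/
theorem DerivGrowth.decay (hu : ∀ j n, ContDiff ℝ ∞ (u j n)) (h0 : DerivGrowth u 0 (-1))
    (h1 : ∀ k, DerivGrowth u k 1) (k : ℕ) : DerivGrowth u k (-1 / 2) := by
  -- The exponents admissible for the $k$-th derivatives. The cut-off at $-1$ keeps the infimum
  -- finite.
  set S : ℕ → Set ℝ := fun k => {a | -1 ≤ a ∧ DerivGrowth u k a} with hS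
  have hbdd : ∀ k, BddBelow (S k) := fun k => ⟨-1, fun a ha => ha.1⟩
  have hmem1 : ∀ k, (1 : ℝ) ∈ S k := fun k => ⟨by norm_num, h1 k⟩
  set α : ℕ → ℝ := fun k => sInf (S k) with hα
  have hle1 : ∀ k, α k ≤ 1 := fun k => csInf_le (hbdd k) (hmem1 k)
  have hnear : ∀ k, ∀ ε > 0, ∃ a ∈ S k, a < α k + ε := fun k ε hε =>
    Real.lt_sInf_add_pos ⟨1, hmem1 k⟩ hε
  have hstep : ∀ k, α (k + 1) ≤ (α k + max (α k) (α (k + 2))) / 2 := by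
    intro k
    refine le_of_forall_pos_le_add fun ε hε => ?_
    obtain ⟨a, ⟨ha1, ha⟩, haε⟩ := hnear k ε hε
    obtain ⟨b, ⟨hb1, hb⟩, hbε⟩ := hnear (k + 2) ε hε
    have hm := DerivGrowth.interpolate hu ha (hb.mono (le_max_right a b)) (le_max_left a b)
    have h2 : α (k + 1) ≤ (a + max a b) / 2 :=
      csInf_le (hbdd _) ⟨by linarith [le_max_left a b], hm⟩
    have h3 : max a b ≤ max (α k) (α (k + 2)) + ε :=
      max_le (by linarith [le_max_left (α k) (α (k + 2))])
        (by linarith [le_max_right (α k) (α (k + 2))])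
    linarith
  -- The optimal exponents satisfy a convexity inequality. One strict increase would force all later
  -- increments to be at least as large, hence linear growth, contradicting the bound by $1$. So
  -- every exponent is at most the zeroth one.
  have hanti : ∀ k, α (k + 1) ≤ α k := by
    intro k
    by_contra! hlt
    have hinc : ∀ m : ℕ, α (k + 1) - α k ≤ α (k + m + 1) - α (k + m) := by
      intro m
      induction m with
      | zero => simp
      | succ m ih =>
        have h2 := hstep (k + m)
        rcases max_cases (α (k + m)) (α (k + m + 2)) with ⟨h3, _⟩ | ⟨h3, _⟩
        · rw [h3] at h2; linarith
        · rw [h3] at h2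
          rw [show k + (m + 1) = k + m + 1 by ring]
          linarith
    have hlin : ∀ m : ℕ, α k + m * (α (k + 1) - α k) ≤ α (k + m) := by
      intro m
      induction m with
      | zero => simp
      | succ m ih =>
        have := hinc m
        rw [show k + (m + 1) = k + m + 1 by ring]
        push_cast
        linarith
    obtain ⟨m, hm⟩ := exists_nat_gt ((1 - α k) / (α (k + 1) - α k))
    rw [div_lt_iff₀ (by linarith)] at hm
    linarith [hlin m, hle1 (k + m)]
  have hle : ∀ k, α k ≤ -1 := by
    intro k
    induction k with
    | zero => exact csInf_le (hbdd 0) ⟨le_refl _, h0⟩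
    | succ k ih => exact (hanti k).trans ih
  obtain ⟨a, ha, hlt⟩ := hnear k (1 / 2) (by norm_num)
  exact ha.2.mono (by linarith [hle k])

theorem summable_two_rpow_neg_half : Summable fun n : ℕ => (2 : ℝ) ^ (-1 / 2 * (n : ℝ)) := by
  have : (fun n : ℕ => (2 : ℝ) ^ (-1 / 2 * (n : ℝ))) = fun n : ℕ => ((2 : ℝ) ^ (-1 / 2 : ℝ)) ^ n := by
    funext n
    rw [Real.rpow_mul (by norm_num), Real.rpow_natCast]
  rw [this]
  exact summable_geometric_of_lt_one (by positivity)
    (Real.rpow_lt_one_of_one_lt_of_neg (by norm_num) (by norm_num))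

/-- If the differences of consecutive members of a sequence of smooth functions decay with all
derivatives, then the pointwise limit is smooth. -/
theorem contDiff_of_tendsto_of_decay {q : J → ℕ → ℝ → ℝ} {r : J → ℝ → ℝ}
    (hq : ∀ j n, ContDiff ℝ ∞ (q j n))
    (hu : ∀ k, DerivGrowth (fun j n t => q j (n + 1) t - q j n t) k (-1 / 2))
    (hr : ∀ j t, Tendsto (fun n => q j n t) atTop (𝓝 (r j t))) :
    (∀ j, ContDiff ℝ ∞ (r j)) ∧ ∀ k R, ∃ C, ∀ j t, |t| ≤ R →
      |iteratedDeriv k (r j) t - iteratedDeriv k (q j 0) t| ≤ C := by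
  set u : J → ℕ → ℝ → ℝ := fun j n t => q j (n + 1) t - q j n t with hudef
  have husm : ∀ j n, ContDiff ℝ ∞ (u j n) := fun j n => (hq j (n + 1)).sub (hq j n)
  set T : J → ℕ → ℝ → ℝ := fun j k t => ∑' n, iteratedDeriv k (u j n) t with hT
  have hsum : ∀ j k t, Summable fun n => iteratedDeriv k (u j n) t := by
    intro j k t
    obtain ⟨C, hC⟩ := hu k |t|
    exact Summable.of_norm_bounded (summable_two_rpow_neg_half.mul_left C)
      fun n => hC j n t le_rfl
  have hd : ∀ j k t, HasDerivAt (T j k) (T j (k + 1) t) t := by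
    intro j k t
    obtain ⟨C, hC⟩ := hu (k + 1) (|t| + 1)
    have hball : ∀ y ∈ Metric.ball t 1, |y| ≤ |t| + 1 := by
      intro y hy
      rw [Metric.mem_ball, Real.dist_eq] at hy
      have := abs_sub_abs_le_abs_sub y t
      linarith
    refine hasDerivAt_tsum_of_isPreconnected (summable_two_rpow_neg_half.mul_left C)
      (t := Metric.ball t 1) Metric.isOpen_ball (convex_ball t 1).isPreconnected
      (fun n y _ => ?_) (fun n y hy => hC j n y (hball y hy)) (Metric.mem_ball_self one_pos)
      (hsum j k t) (Metric.mem_ball_self one_pos)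
    rw [iteratedDeriv_succ, hasDerivAt_deriv_iff]
    exact (husm j n).differentiable_iteratedDeriv k (mod_cast ENat.natCast_lt_top k) y
  have hrT : ∀ j, r j = fun t => q j 0 t + T j 0 t := by
    intro j
    funext t
    refine tendsto_nhds_unique (hr j t) ?_
    -- The limit is $q_0$ plus a telescoping series, which may be differentiated term by term.
    have h1 : Tendsto (fun N => q j 0 t + ∑ n ∈ Finset.range N, iteratedDeriv 0 (u j n) t) atTop
        (𝓝 (q j 0 t + T j 0 t)) := (hsum j 0 t).hasSum.tendsto_sum_nat.const_add _
    refine h1.congr fun N => ?_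
    simp only [iteratedDeriv_zero, hudef]
    rw [Finset.sum_range_sub (fun n => q j n t)]
    ring
  have hTsm : ∀ j, ContDiff ℝ ∞ (T j 0) := fun j => smoothCurve_iff_contDiff.1
    ⟨T j, rfl, fun k t => hasVelocity_iff_hasDerivAt.2 (hd j k t)⟩
  have hTk : ∀ j k, iteratedDeriv k (T j 0) = T j k := by
    intro j k
    induction k with
    | zero => exact iteratedDeriv_zero
    | succ k ih => rw [iteratedDeriv_succ, ih]; exact funext fun t => (hd j k t).deriv
  refine ⟨fun j => by rw [hrT j]; exact (hq j 0).add (hTsm j), fun k R => ?_⟩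
  obtain ⟨C, hC⟩ := hu k R
  refine ⟨∑' n : ℕ, C * 2 ^ (-1 / 2 * (n : ℝ)), fun j t ht => ?_⟩
  rw [hrT j, iteratedDeriv_fun_add ((hq j 0).contDiffAt.of_le (mod_cast le_top))
    ((hTsm j).contDiffAt.of_le (mod_cast le_top)), add_sub_cancel_left, hTk]
  exact tsum_of_norm_bounded (f := fun n => iteratedDeriv k (u j n) t)
    (summable_two_rpow_neg_half.mul_left C).hasSum fun n => hC j n t ht

end Interpolation

/-! ### Boman's theorem in the plane -/

section Boman

/-- Functions on the plane that are smooth in each variable, with locally bounded unmixed partial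
derivatives. -/
structure SeparatelySmooth (f : ℝ → ℝ → ℝ) : Prop where
  fst : ∀ s, ContDiff ℝ ∞ fun t => f t s
  snd : ∀ t, ContDiff ℝ ∞ (f t)
  bdd_fst : ∀ (k : ℕ) (R : ℝ), ∃ C : ℝ, ∀ t s, |t| ≤ R → |s| ≤ R →
    |iteratedDeriv k (fun t => f t s) t| ≤ C
  bdd_snd : ∀ (k : ℕ) (R : ℝ), ∃ C : ℝ, ∀ t s, |t| ≤ R → |s| ≤ R → |iteratedDeriv k (f t) s| ≤ C

namespace SeparatelySmooth

variable {f : ℝ → ℝ → ℝ}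

theorem swap (hf : SeparatelySmooth f) : SeparatelySmooth (fun t s => f s t) where
  fst := hf.snd
  snd := hf.fst
  bdd_fst k R := by
    obtain ⟨C, hC⟩ := hf.bdd_snd k R
    exact ⟨C, fun t s ht hs => hC s t hs ht⟩
  bdd_snd k R := by
    obtain ⟨C, hC⟩ := hf.bdd_fst k R
    exact ⟨C, fun t s ht hs => hC s t hs ht⟩

/-- The dyadic difference quotients in the second variable. -/
def quotient (f : ℝ → ℝ → ℝ) (s : ℝ) (n : ℕ) (t : ℝ) : ℝ :=
  2 ^ n * (f t (s + (1 / 2) ^ n) - f t s)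

theorem contDiff_quotient (hf : SeparatelySmooth f) (s : ℝ) (n : ℕ) :
    ContDiff ℝ ∞ (quotient f s n) :=
  contDiff_const.mul ((hf.fst _).sub (hf.fst _))

theorem hasDerivAt_iterate_snd (hf : SeparatelySmooth f) (t : ℝ) (k : ℕ) (s : ℝ) :
    HasDerivAt (iteratedDeriv k (f t)) (iteratedDeriv (k + 1) (f t) s) s := by
  rw [iteratedDeriv_succ, hasDerivAt_deriv_iff]
  exact (hf.snd t).differentiable_iteratedDeriv k (mod_cast ENat.natCast_lt_top k) s

theorem hasDerivAt_snd (hf : SeparatelySmooth f) (t s : ℝ) :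
    HasDerivAt (f t) (deriv (f t) s) s := by
  simpa using hf.hasDerivAt_iterate_snd t 0 s

theorem tendsto_quotient (hf : SeparatelySmooth f) (s t : ℝ) :
    Tendsto (fun n => quotient f s n t) atTop (𝓝 (deriv (f t) s)) := by
  have h1 := hasDerivAt_iff_tendsto_slope_zero.1 (hf.hasDerivAt_snd t s)
  have h2 : Tendsto (fun n : ℕ => (1 / 2 : ℝ) ^ n) atTop (𝓝[≠] 0) :=
    tendsto_nhdsWithin_iff.2 ⟨half_pow_tendsto, .of_forall fun n => by
      simp only [mem_compl_iff, mem_singleton_iff]; positivity⟩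
  refine (h1.comp h2).congr fun n => ?_
  simp [quotient]

theorem iteratedDeriv_quotient (hf : SeparatelySmooth f) (s : ℝ) (n k : ℕ) (t : ℝ) :
    iteratedDeriv k (quotient f s n) t =
      2 ^ n * (iteratedDeriv k (fun t => f t (s + (1 / 2) ^ n)) t -
        iteratedDeriv k (fun t => f t s) t) := by
  unfold quotient
  rw [iteratedDeriv_const_mul_field]
  congr 1
  exact iteratedDeriv_sub ((hf.fst _).contDiffAt.of_le (mod_cast le_top))
    ((hf.fst _).contDiffAt.of_le (mod_cast le_top))

theorem abs_half_pow_le_one (n : ℕ) : |(1 / 2 : ℝ) ^ n| ≤ 1 := by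
  rw [abs_of_pos (by positivity)]
  exact pow_le_one₀ (by norm_num) (by norm_num)

/-- The crude bound: a dyadic quotient is $2^n$ times a difference of two bounded terms. Restricting
to $|s|\le R_0$ makes the constants uniform in the base point. -/
theorem derivGrowth_one (hf : SeparatelySmooth f) (R₀ : ℝ) (k : ℕ) :
    DerivGrowth (fun (j : {s : ℝ // |s| ≤ R₀}) n t =>
      quotient f j (n + 1) t - quotient f j n t) k 1 := by
  intro R
  obtain ⟨C, hC⟩ := hf.bdd_fst k (max R (R₀ + 1))
  -- The two quotients contribute $2C\cdot2^{n+1}$ and $2C\cdot2^n$.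
  refine ⟨6 * C, fun ⟨s, hs⟩ n t ht => ?_⟩
  have b : ∀ m : ℕ, |iteratedDeriv k (quotient f s m) t| ≤ 2 ^ m * (2 * C) := by
    intro m
    rw [hf.iteratedDeriv_quotient, abs_mul, abs_of_pos (by positivity : (0 : ℝ) < 2 ^ m)]
    refine mul_le_mul_of_nonneg_left ?_ (by positivity)
    have b1 := hC t (s + (1 / 2) ^ m) (ht.trans (le_max_left _ _))
      ((abs_add_le _ _).trans ((add_le_add hs (abs_half_pow_le_one m)).trans (le_max_right _ _)))
    have b2 := hC t s (ht.trans (le_max_left _ _)) (hs.trans ((by linarith : R₀ ≤ R₀ + 1).trans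
      (le_max_right _ _)))
    refine (abs_sub _ _).trans ?_
    linarith
  have e : iteratedDeriv k (fun t => quotient f s (n + 1) t - quotient f s n t) t =
      iteratedDeriv k (quotient f s (n + 1)) t - iteratedDeriv k (quotient f s n) t :=
    iteratedDeriv_sub ((hf.contDiff_quotient _ _).contDiffAt.of_le (mod_cast le_top))
      ((hf.contDiff_quotient _ _).contDiffAt.of_le (mod_cast le_top))
  dsimp only
  rw [e, one_mul, Real.rpow_natCast]
  refine (abs_sub _ _).trans ?_
  have b1 := b (n + 1)
  have b2 := b n
  rw [pow_succ] at b1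
  linarith

/-- By Taylor's estimate in the second variable, each quotient is within $O(2^{-n})$ of the partial
derivative. -/
theorem derivGrowth_zero (hf : SeparatelySmooth f) (R₀ : ℝ) :
    DerivGrowth (fun (j : {s : ℝ // |s| ≤ R₀}) n t =>
      quotient f j (n + 1) t - quotient f j n t) 0 (-1) := by
  intro R
  obtain ⟨C, hC⟩ := hf.bdd_snd 2 (max R (R₀ + 1))
  -- After multiplication by $h=2^{-n}$ the errors are $2C(h/2)^2$ and $Ch^2$, together at most
  -- $2Ch^2$.
  refine ⟨2 * C, fun ⟨s, hs⟩ n t ht => ?_⟩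
  have b : ∀ m : ℕ, |f t (s + (1 / 2) ^ m) - f t s - (1 / 2) ^ m * deriv (f t) s| ≤
      C * ((1 / 2) ^ m) ^ 2 := by
    intro m
    have h0 : (0 : ℝ) < (1 / 2) ^ m := by positivity
    have h1 := (le_abs_self _).trans (abs_half_pow_le_one m)
    refine abs_sub_sub_mul_le (hf.hasDerivAt_snd t)
      (q'' := iteratedDeriv 2 (f t)) (fun x => ?_) (fun x hx => hC t x (ht.trans (le_max_left _ _)) ?_)
    · have := hf.hasDerivAt_iterate_snd t 1 x
      rwa [iteratedDeriv_one] at this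
    · rw [uIcc_of_le (by linarith)] at hx
      refine le_trans ?_ (le_max_right _ _)
      rw [abs_le] at hs ⊢
      constructor <;> linarith [hx.1, hx.2]
  have b1 := b (n + 1)
  have b2 := b n
  have hC0 : 0 ≤ C := (abs_nonneg _).trans (hC t s (ht.trans (le_max_left _ _))
    (hs.trans ((by linarith : R₀ ≤ R₀ + 1).trans (le_max_right _ _))))
  simp only [iteratedDeriv_zero, quotient]
  have e : (2 : ℝ) ^ (-1 * (n : ℝ)) = (1 / 2) ^ n := by
    rw [neg_one_mul, Real.rpow_neg (by norm_num), Real.rpow_natCast, one_div, inv_pow]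
  rw [e]
  have hp : (1 / 2 : ℝ) ^ n * 2 ^ n = 1 := by rw [← mul_pow]; norm_num
  set h := (1 / 2 : ℝ) ^ n with hh
  have hh0 : 0 < h := by positivity
  have h2 : (2 : ℝ) ^ n = h⁻¹ := by field_simp; linarith
  rw [pow_succ (1 / 2 : ℝ), ← hh] at *
  rw [pow_succ, h2]
  have : h * |h⁻¹ * 2 * (f t (s + h * (1 / 2)) - f t s) - h⁻¹ * (f t (s + h) - f t s)| ≤
      h * (2 * C * h) := by
    rw [← abs_of_pos hh0, ← abs_mul, abs_of_pos hh0]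
    have e3 : h * (h⁻¹ * 2 * (f t (s + h * (1 / 2)) - f t s) - h⁻¹ * (f t (s + h) - f t s)) =
        2 * (f t (s + h * (1 / 2)) - f t s) - (f t (s + h) - f t s) := by field_simp
    rw [e3]
    rw [abs_le] at b1 b2 ⊢
    constructor <;> nlinarith [mul_nonneg hC0 (sq_nonneg h)]
  exact le_of_mul_le_mul_left this hh0

/-- The heart of Boman's theorem. Differences of successive dyadic quotients decay like $2^{-n}$,
while their derivatives in the other variable grow at most like $2^n$. By interpolation all those
derivatives decay, so the partial derivative is smooth in that variable with locally bounded
derivatives. -/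
theorem deriv_snd (hf : SeparatelySmooth f) : SeparatelySmooth fun t s => deriv (f t) s := by
  have key : ∀ R₀ : ℝ, _ := fun R₀ => contDiff_of_tendsto_of_decay
    (q := fun (j : {s : ℝ // |s| ≤ R₀}) => quotient f j) (r := fun j t => deriv (f t) j)
    (fun j n => hf.contDiff_quotient j n)
    (DerivGrowth.decay (fun j n => (hf.contDiff_quotient j (n + 1)).sub (hf.contDiff_quotient j n))
      (hf.derivGrowth_zero R₀) (hf.derivGrowth_one R₀))
    (fun j t => hf.tendsto_quotient j t)
  refine ⟨fun s => (key |s|).1 ⟨s, le_rfl⟩, fun t => (contDiff_infty_iff_deriv.1 (hf.snd t)).2,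
    fun k R => ?_, fun k R => ?_⟩
  · obtain ⟨C, hC⟩ := (key R).2 k R
    obtain ⟨D, hD⟩ := hf.bdd_fst k (R + 1)
    refine ⟨C + 2 * D, fun t s ht hs => ?_⟩
    have h1 := hC ⟨s, hs⟩ t ht
    have h2 : |iteratedDeriv k (quotient f s 0) t| ≤ 2 * D := by
      rw [hf.iteratedDeriv_quotient, pow_zero, one_mul]
      refine (abs_sub _ _).trans ?_
      have b1 := hD t (s + (1 / 2) ^ 0) (ht.trans (by linarith))
        ((abs_add_le _ _).trans (add_le_add hs (abs_half_pow_le_one 0)))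
      have b2 := hD t s (ht.trans (by linarith)) (hs.trans (by linarith))
      linarith
    have h3 := abs_sub_abs_le_abs_sub (iteratedDeriv k (fun t => deriv (f t) s) t)
      (iteratedDeriv k (quotient f s 0) t)
    linarith
  · obtain ⟨C, hC⟩ := hf.bdd_snd (k + 1) R
    refine ⟨C, fun t s ht hs => ?_⟩
    have := hC t s ht hs
    rwa [iteratedDeriv_succ'] at this

theorem deriv_fst (hf : SeparatelySmooth f) :
    SeparatelySmooth fun t s => deriv (fun t => f t s) t :=
  hf.swap.deriv_snd.swap

/-- Local Lipschitz continuity in the first variable, uniform in the second, combined with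
continuity in the second. -/
theorem continuous (hf : SeparatelySmooth f) : Continuous fun p : ℝ × ℝ => f p.1 p.2 := by
  rw [continuous_iff_continuousAt]
  rintro ⟨t₀, s₀⟩
  set R := max |t₀| |s₀| + 1 with hR
  obtain ⟨C, hC⟩ := hf.bdd_fst 1 R
  have hball : ∀ x ∈ Metric.closedBall (0 : ℝ) R, |x| ≤ R := fun x hx => by simpa using hx
  have hb : ∀ t s, |t| ≤ R → |s| ≤ R → |f t s - f t₀ s| ≤ C * |t - t₀| := by
    intro t s ht hs
    refine (convex_closedBall (0 : ℝ) R).norm_image_sub_le_of_norm_hasDerivWithin_le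
      (f := fun t => f t s) (f' := fun t => deriv (fun t => f t s) t)
      (fun x _ => (hf.swap.hasDerivAt_snd s x).hasDerivWithinAt) (fun x hx => ?_) ?_ ?_
    · have := hC x s (hball x hx) hs
      rwa [iteratedDeriv_one] at this
    · simp only [mem_closedBall_zero_iff, Real.norm_eq_abs]
      linarith [le_max_left |t₀| |s₀|]
    · simpa using ht
  have h1 : Tendsto (fun p : ℝ × ℝ => C * |p.1 - t₀| + |f t₀ p.2 - f t₀ s₀|) (𝓝 (t₀, s₀)) (𝓝 0) := by
    have hc : Continuous fun p : ℝ × ℝ => C * |p.1 - t₀| + |f t₀ p.2 - f t₀ s₀| := by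
      have := (hf.snd t₀).continuous
      fun_prop
    simpa using hc.tendsto (t₀, s₀)
  rw [ContinuousAt, tendsto_iff_dist_tendsto_zero]
  refine squeeze_zero' (.of_forall fun _ => dist_nonneg) ?_ h1
  have hev : ∀ᶠ p : ℝ × ℝ in 𝓝 (t₀, s₀), |p.1| < R ∧ |p.2| < R := by
    refine (((continuous_abs.comp continuous_fst).tendsto _).eventually_lt_const ?_).and
      (((continuous_abs.comp continuous_snd).tendsto _).eventually_lt_const ?_)
    · exact (le_max_left _ _).trans_lt (lt_add_one _)
    · exact (le_max_right _ _).trans_lt (lt_add_one _)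
  filter_upwards [hev] with p hp
  rw [Real.dist_eq]
  calc |f p.1 p.2 - f t₀ s₀| = |(f p.1 p.2 - f t₀ p.2) + (f t₀ p.2 - f t₀ s₀)| := by ring_nf
    _ ≤ _ := (abs_add_le _ _).trans (add_le_add_left (hb _ _ hp.1.le hp.2.le) _)

theorem hasFDerivAt (hf : SeparatelySmooth f) (p : ℝ × ℝ) :
    HasFDerivAt (fun p : ℝ × ℝ => f p.1 p.2)
      ((ContinuousLinearMap.toSpanSingleton ℝ (deriv (fun t => f t p.2) p.1)).coprod
        (ContinuousLinearMap.toSpanSingleton ℝ (deriv (f p.1) p.2))) p := by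
  refine (hasStrictFDerivAt_uncurry_coprod (f := f)
    (f₁ := fun t s => ContinuousLinearMap.toSpanSingleton ℝ (deriv (fun t => f t s) t))
    (f₂ := fun t s => ContinuousLinearMap.toSpanSingleton ℝ (deriv (f t) s))
    (.of_forall fun v => (hf.swap.hasDerivAt_snd v.2 v.1).hasFDerivAt)
    (.of_forall fun v => (hf.hasDerivAt_snd v.1 v.2).hasFDerivAt) ?_ ?_).hasFDerivAt
  · exact ((ContinuousLinearMap.toSpanSingletonCLE (𝕜 := ℝ) (E := ℝ)).continuous.comp
      hf.deriv_fst.continuous).continuousAt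
  · exact ((ContinuousLinearMap.toSpanSingletonCLE (𝕜 := ℝ) (E := ℝ)).continuous.comp
      hf.deriv_snd.continuous).continuousAt

/-- The class is closed under both partial derivatives and consists of continuous functions.
Continuous partial derivatives give the Fréchet derivative, and induction on the order applies to
its components. -/
theorem contDiff (hf : SeparatelySmooth f) : ContDiff ℝ ∞ fun p : ℝ × ℝ => f p.1 p.2 := by
  rw [contDiff_infty]
  intro n
  induction n generalizing f with
  | zero => exact contDiff_zero.2 hf.continuous
  | succ n ih =>
    push_cast
    rw [contDiff_succ_iff_fderiv]
    refine ⟨fun p => (hf.hasFDerivAt p).differentiableAt, by simp, ?_⟩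
    rw [funext fun p => (hf.hasFDerivAt p).fderiv]
    refine contDiff_clm_apply_iff.2 fun v => ?_
    simp only [ContinuousLinearMap.coprod_apply, ContinuousLinearMap.toSpanSingleton_apply,
      smul_eq_mul]
    exact (contDiff_const.mul (ih hf.deriv_fst)).add (contDiff_const.mul (ih hf.deriv_snd))

/-- A function which is smooth along smooth curves has locally bounded iterated partial
derivatives. -/
theorem exists_bound_of_smooth_along_curves {g : ℝ × ℝ → ℝ}
    (hg : ∀ c : ℝ → ℝ × ℝ, SmoothCurve c → ContDiff ℝ ∞ fun t => g (c t)) (v : ℝ × ℝ) (k : ℕ)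
    (R : ℝ) : ∃ C : ℝ, ∀ p : ℝ × ℝ, |p.1| ≤ R → |p.2| ≤ R →
      |iteratedDeriv k (fun r : ℝ => g (p + r • v)) 0| ≤ C := by
  set D : ℝ × ℝ → ℝ := fun p => iteratedDeriv k (fun r : ℝ => g (p + r • v)) 0 with hD
  have hloc : ∀ p : ℝ × ℝ, ∃ δ > 0, ∃ C, ∀ q, dist q p < δ → |D q| ≤ C := by
    intro p
    by_contra! h
    -- The special curve runs through $q_n$ with direction $\varepsilon v$, where
    -- $\varepsilon=2^{-n^2}$. Its $k$-th derivative there is $\varepsilon^kD(q_n)$, so the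
    -- threshold $n/\varepsilon^k$ makes these derivatives unbounded on $[0,1]$.
    have h' : ∀ n : ℕ, ∃ q, dist q p < (1 / 2) ^ n ^ 2 ∧ n / ((1 / 2) ^ n ^ 2) ^ k < |D q| :=
      fun n => h _ (by positivity) _
    choose q hq hDq using h'
    obtain ⟨c, hc, -, hcn⟩ := exists_smoothCurve_through p
      (fun n => ((1 / 2 : ℝ) ^ n ^ 2)⁻¹ • (q n - p)) (fun _ => v)
      (fun l => ⟨‖l‖ * 1, fun n => (l.le_opNorm _).trans (by
        refine mul_le_mul_of_nonneg_left ?_ (norm_nonneg _)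
        rw [norm_smul, norm_inv, Real.norm_of_nonneg (by positivity),
          inv_mul_le_iff₀ (by positivity), mul_one, ← dist_eq_norm]
        exact (hq n).le)⟩) (fun l => ⟨|l v|, fun _ => le_rfl⟩)
    obtain ⟨C, hC⟩ := (isCompact_Icc (a := (0 : ℝ)) (b := 1)).exists_bound_of_continuousOn
      ((hg c hc).continuous_iteratedDeriv k (mod_cast le_top)).continuousOn
    obtain ⟨n, hn⟩ := exists_nat_gt C
    have h1 := hC ((1 / 2) ^ n) ⟨by positivity, pow_le_one₀ (by norm_num) (by norm_num)⟩
    set ε := (1 / 2 : ℝ) ^ n ^ 2 with hε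
    have hε0 : 0 < ε := by positivity
    have e1 : iteratedDeriv k (fun t => g (c t)) ((1 / 2) ^ n) = ε ^ k * D (q n) := by
      have e2 := congrFun (iteratedDeriv_comp_const_add k (fun t => g (c t)) ((1 / 2 : ℝ) ^ n)) 0
      rw [add_zero] at e2
      rw [← e2]
      have e3 : (fun r => g (c ((1 / 2) ^ n + r))) =ᶠ[𝓝 0] fun r => g (q n + (ε * r) • v) := by
        filter_upwards [hcn n] with r hr
        rw [hr, smul_add, smul_smul, mul_inv_cancel₀ hε0.ne', one_smul, smul_smul, ← add_assoc,
          add_sub_cancel]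
      rw [e3.iteratedDeriv_eq]
      have e4 := iteratedDeriv_comp_const_mul (n := k) (f := fun r : ℝ => g (q n + r • v))
        ((hg _ (smoothCurve_line (q n) v)).of_le (mod_cast le_top)) ε
      rw [e4]
      simp [hD]
    rw [e1, norm_mul, Real.norm_of_nonneg (by positivity), Real.norm_eq_abs] at h1
    have h2 := hDq n
    rw [div_lt_iff₀ (by positivity), mul_comm] at h2
    linarith
  have hK : IsCompact (Icc (-R) R ×ˢ Icc (-R) R) := isCompact_Icc.prod isCompact_Icc
  obtain ⟨C, hC⟩ : ∃ C, ∀ q ∈ Icc (-R) R ×ˢ Icc (-R) R, |D q| ≤ C := by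
    refine hK.induction_on (p := fun s => ∃ C, ∀ q ∈ s, |D q| ≤ C) ⟨0, by simp⟩
      (fun s t hst ⟨C, hC⟩ => ⟨C, fun q hq => hC q (hst hq)⟩) ?_ ?_
    · rintro s t ⟨C, hC⟩ ⟨C', hC'⟩
      exact ⟨max C C', fun q hq => hq.elim (fun h => (hC q h).trans (le_max_left _ _))
        fun h => (hC' q h).trans (le_max_right _ _)⟩
    · intro p _
      obtain ⟨δ, hδ, C, hC⟩ := hloc p
      exact ⟨_, mem_nhdsWithin_of_mem_nhds (Metric.ball_mem_nhds p hδ), C, fun q hq => hC q hq⟩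
  exact ⟨C, fun p h1 h2 => hC p ⟨abs_le.1 h1, abs_le.1 h2⟩⟩

/-- **Boman's theorem** in the plane: a function which is smooth along smooth curves is smooth. -/
theorem _root_.contDiff_of_smooth_along_curves {g : ℝ × ℝ → ℝ}
    (hg : ∀ c : ℝ → ℝ × ℝ, SmoothCurve c → ContDiff ℝ ∞ fun t => g (c t)) : ContDiff ℝ ∞ g := by
  have h1 : ∀ (k : ℕ) (t s : ℝ), iteratedDeriv k (fun t => g (t, s)) t =
      iteratedDeriv k (fun r : ℝ => g ((t, s) + r • ((1 : ℝ), (0 : ℝ)))) 0 := by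
    intro k t s
    have e := congrFun (iteratedDeriv_comp_const_add k (fun t => g (t, s)) t) 0
    rw [add_zero] at e
    simpa using e.symm
  have h2 : ∀ (k : ℕ) (t s : ℝ), iteratedDeriv k (fun s => g (t, s)) s =
      iteratedDeriv k (fun r : ℝ => g ((t, s) + r • ((0 : ℝ), (1 : ℝ)))) 0 := by
    intro k t s
    have e := congrFun (iteratedDeriv_comp_const_add k (fun s => g (t, s)) s) 0
    rw [add_zero] at e
    simpa using e.symm
  have : SeparatelySmooth fun t s => g (t, s) := by
    refine ⟨fun s => hg _ (smoothCurve_id.prodMk (smoothCurve_const s)),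
      fun t => hg _ ((smoothCurve_const t).prodMk smoothCurve_id), fun k R => ?_, fun k R => ?_⟩
    · obtain ⟨C, hC⟩ := exists_bound_of_smooth_along_curves hg (1, 0) k R
      exact ⟨C, fun t s ht hs => by rw [h1]; exact hC (t, s) ht hs⟩
    · obtain ⟨C, hC⟩ := exists_bound_of_smooth_along_curves hg (0, 1) k R
      exact ⟨C, fun t s ht hs => by rw [h2]; exact hC (t, s) ht hs⟩
  exact this.contDiff

end SeparatelySmooth

end Boman

/-! ### Hadamard's lemma for curves -/

section Hadamard

open MeasureTheory in
theorem contDiff_integral_pow_mul {g : ℝ → ℝ} (hg : ContDiff ℝ ∞ g) (t₀ : ℝ) :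
    ContDiff ℝ ∞ fun s : ℝ => ∫ τ in (0 : ℝ)..1, g (t₀ + τ * s) := by
  -- Differentiating under the integral brings out one factor $\tau$ each time, so these are the
  -- successive derivatives.
  set I : ℕ → ℝ → ℝ := fun k s => ∫ τ in (0 : ℝ)..1, τ ^ k * iteratedDeriv k g (t₀ + τ * s) with hI
  have hcont : ∀ k, Continuous (iteratedDeriv k g) := fun k =>
    hg.continuous_iteratedDeriv k (mod_cast le_top)
  have hd : ∀ k s, HasDerivAt (I k) (I (k + 1) s) s := by
    intro k s
    obtain ⟨C, hC⟩ := (isCompact_Icc (a := t₀ - (|s| + 1)) (b := t₀ + (|s| + 1))).exists_bound_of_continuousOn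
      (hcont (k + 1)).continuousOn
    have hc : ∀ m x, Continuous fun τ : ℝ => τ ^ m * iteratedDeriv m g (t₀ + τ * x) := by
      intro m x
      have := hcont m
      fun_prop
    refine (intervalIntegral.hasDerivAt_integral_of_dominated_loc_of_deriv_le
      (F := fun x τ => τ ^ k * iteratedDeriv k g (t₀ + τ * x))
      (F' := fun x τ => τ ^ (k + 1) * iteratedDeriv (k + 1) g (t₀ + τ * x))
      (bound := fun _ => C) (Metric.ball_mem_nhds s one_pos)
      (.of_forall fun x => (hc k x).aestronglyMeasurable)
      ((hc k s).intervalIntegrable _ _) (hc (k + 1) s).aestronglyMeasurable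
      (.of_forall fun τ hτ x hx => ?_) intervalIntegrable_const
      (.of_forall fun τ hτ x hx => ?_)).2
    · rw [uIoc_of_le zero_le_one] at hτ
      rw [norm_mul, norm_pow, Real.norm_of_nonneg hτ.1.le]
      have hx' : |x| ≤ |s| + 1 := by
        rw [Metric.mem_ball, Real.dist_eq] at hx
        linarith [abs_sub_abs_le_abs_sub x s]
      have h1 : |τ * x| ≤ |s| + 1 := by
        rw [abs_mul, abs_of_pos hτ.1]
        exact (mul_le_of_le_one_left (abs_nonneg _) hτ.2).trans hx'
      rw [abs_le] at h1
      exact (mul_le_of_le_one_left (norm_nonneg _) (pow_le_one₀ hτ.1.le hτ.2)).trans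
        (hC _ ⟨by linarith [h1.1], by linarith [h1.2]⟩)
    · have h1 : HasDerivAt (iteratedDeriv k g) (iteratedDeriv (k + 1) g (t₀ + τ * x))
          (t₀ + τ * x) := by
        rw [iteratedDeriv_succ, hasDerivAt_deriv_iff]
        exact hg.differentiable_iteratedDeriv k (mod_cast ENat.natCast_lt_top k) _
      have h2 : HasDerivAt (fun x : ℝ => t₀ + τ * x) τ x := by
        simpa using ((hasDerivAt_id x).const_mul τ).const_add t₀
      exact ((h1.comp x h2).const_mul (τ ^ k)).congr_deriv (by ring)
  have h0 : (fun s : ℝ => ∫ τ in (0 : ℝ)..1, g (t₀ + τ * s)) = I 0 := by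
    funext s; simp [hI]
  rw [h0]
  exact smoothCurve_iff_contDiff.1
    ⟨I, rfl, fun k t => hasVelocity_iff_hasDerivAt.2 (hd k t)⟩

/-- The quotient, with its removable value filled in, is $\int_0^1 g'(t_0+\tau s)\,d\tau$. -/
theorem contDiff_differenceQuotient {g : ℝ → ℝ} (hg : ContDiff ℝ ∞ g) (t₀ : ℝ) :
    ContDiff ℝ ∞ fun s : ℝ => if s = 0 then deriv g t₀ else s⁻¹ * (g (t₀ + s) - g t₀) := by
  have hg' := (contDiff_infty_iff_deriv.1 hg).2
  convert contDiff_integral_pow_mul hg' t₀ using 1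
  funext s
  split_ifs with hs
  · simp [hs]
  · have h1 : ∫ τ in (0 : ℝ)..1, s * deriv g (t₀ + τ * s) = g (t₀ + s) - g t₀ := by
      have := intervalIntegral.integral_eq_sub_of_hasDerivAt (a := (0 : ℝ)) (b := 1)
        (f := fun τ => g (t₀ + τ * s)) (f' := fun τ => s * deriv g (t₀ + τ * s)) (fun τ _ => ?_) ?_
      · simpa using this
      · have h2 : HasDerivAt (fun τ : ℝ => t₀ + τ * s) s τ := by
          simpa using ((hasDerivAt_id τ).mul_const s).const_add t₀
        have h3 := ((hg.differentiable (by simp) (t₀ + τ * s)).hasDerivAt).comp τ h2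
        rwa [mul_comm] at h3
      · have := hg'.continuous
        exact (by fun_prop : Continuous fun τ => s * deriv g (t₀ + τ * s)).intervalIntegrable _ _
    rw [intervalIntegral.integral_const_mul] at h1
    rw [← h1, ← mul_assoc, inv_mul_cancel₀ hs, one_mul]

variable {E : Type*} [AddCommGroup E] [Module ℝ E] [TopologicalSpace E] [ConvenientSpace E]

/-- Hadamard's lemma for smooth curves. -/
theorem SmoothCurve.exists_hadamard {c : ℝ → E} (hc : SmoothCurve c) (t₀ : ℝ) :
    ∃ d : ℝ → E, SmoothCurve d ∧ d 0 = _root_.velocity c t₀ ∧ ∀ s, c (t₀ + s) = c t₀ + s • d s := by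
  refine ⟨fun s => if s = 0 then _root_.velocity c t₀ else s⁻¹ • (c (t₀ + s) - c t₀),
    smoothCurve_iff_scalarwise.2 fun l => ?_, by simp, fun s => ?_⟩
  · convert contDiff_differenceQuotient (hc.contDiff_map l) t₀ using 1
    funext s
    split_ifs with hs
    · exact (hasVelocity_iff_hasDerivAt.1 ((hc.hasVelocity t₀).map l)).deriv.symm
    · simp
  · dsimp only
    split_ifs with hs
    · simp [hs]
    · rw [smul_smul, mul_inv_cancel₀ hs, one_smul, add_sub_cancel]

end Hadamard

/-! ### Differential calculus on $c^\infty$-open sets -/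

section Calculus

variable {E : Type*} [AddCommGroup E] [Module ℝ E] [TopologicalSpace E] [ConvenientSpace E]
  {F : Type*} [AddCommGroup F] [Module ℝ F] [TopologicalSpace F] [ConvenientSpace F]
  {F' : Type*} [AddCommGroup F'] [Module ℝ F'] [TopologicalSpace F'] [ConvenientSpace F']

/-- A reparametrization that is the identity near $t_0$ and never leaves a small neighbourhood. It
replaces a curve only locally inside an open set by one that stays there for all time, as
`CSmoothOn` requires. -/
theorem exists_truncation (t₀ : ℝ) {ε : ℝ} (hε : 0 < ε) :
    ∃ h : ℝ → ℝ, SmoothCurve h ∧ (∀ t, |h t - t₀| < ε) ∧ ∀ᶠ t in 𝓝 t₀, h t = t := by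
  let φ : ContDiffBump t₀ := ⟨ε / 4, ε / 2, by positivity, by linarith⟩
  refine ⟨fun t => t₀ + (t - t₀) * φ t, smoothCurve_iff_contDiff.2 ?_, fun t => ?_, ?_⟩
  · exact contDiff_const.add ((contDiff_id.sub contDiff_const).mul φ.contDiff)
  · rw [add_sub_cancel_left, abs_mul, abs_of_nonneg φ.nonneg]
    rcases lt_or_ge |t - t₀| (ε / 2) with h | h
    · exact (mul_le_of_le_one_right (abs_nonneg _) φ.le_one).trans_lt (by linarith)
    · rw [φ.zero_of_le_dist h]; simpa using hε
  · filter_upwards [φ.eventuallyEq_one] with t ht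
    rw [ht]; simp

theorem CInftyOpen.prod_univ {U : Set E} (hU : CInftyOpen U) :
    CInftyOpen (U ×ˢ (univ : Set F)) := fun c hc => by
  have := hU _ hc.fst
  convert this using 1
  ext t; simp

theorem CInftyOpen.eventually_mem {U : Set E} (hU : CInftyOpen U) {c : ℝ → E} (hc : SmoothCurve c)
    {t : ℝ} (ht : c t ∈ U) : ∀ᶠ s in 𝓝 t, c s ∈ U :=
  (hU c hc).mem_nhds ht

theorem CInftyOpen.eventually_mem_line {U : Set E} (hU : CInftyOpen U) {x : E} (hx : x ∈ U)
    (v : E) : ∀ᶠ s : ℝ in 𝓝 0, x + s • v ∈ U :=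
  hU.eventually_mem (smoothCurve_line x v) (by simpa using hx)

theorem CSmoothOn.congr {f g : E → F} {U : Set E} (hf : CSmoothOn f U) (h : EqOn g f U) :
    CSmoothOn g U := fun c hc hcU => by
  have := hf c hc hcU
  rwa [← funext fun t => h (hcU t)] at this

theorem CSmoothOn.prodMk {f : E → F} {g : E → F'} {U : Set E} (hf : CSmoothOn f U)
    (hg : CSmoothOn g U) : CSmoothOn (fun x => (f x, g x)) U :=
  fun c hc hcU => (hf c hc hcU).prodMk (hg c hc hcU)

theorem CSmoothOn.add {f g : E → F} {U : Set E} (hf : CSmoothOn f U) (hg : CSmoothOn g U) :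
    CSmoothOn (fun x => f x + g x) U := fun c hc hcU => (hf c hc hcU).add (hg c hc hcU)

theorem CSmoothOn.sub {f g : E → F} {U : Set E} (hf : CSmoothOn f U) (hg : CSmoothOn g U) :
    CSmoothOn (fun x => f x - g x) U := fun c hc hcU => (hf c hc hcU).sub (hg c hc hcU)

theorem CSmoothOn.smul {a : E → ℝ} {f : E → F} {U : Set E} (ha : CSmoothOn a U)
    (hf : CSmoothOn f U) : CSmoothOn (fun x => a x • f x) U :=
  fun c hc hcU => (ha c hc hcU).smul (hf c hc hcU)

theorem CSmoothOn.mul {a b : E → ℝ} {U : Set E} (ha : CSmoothOn a U) (hb : CSmoothOn b U) :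
    CSmoothOn (fun x => a x * b x) U := ha.smul hb

theorem cSmoothOn_const (y : F) (U : Set E) : CSmoothOn (fun _ : E => y) U :=
  fun _ _ _ => smoothCurve_const y

theorem cSmoothOn_id (U : Set E) : CSmoothOn (fun x : E => x) U := fun _ hc _ => hc

theorem CSmoothOn.exists_smoothCurve {U : Set E} (hU : CInftyOpen U) {f : E → F}
    (hf : CSmoothOn f U) {c : ℝ → E} (hc : SmoothCurve c) {t : ℝ} (ht : c t ∈ U) :
    ∃ d : ℝ → F, SmoothCurve d ∧ (fun s => f (c s)) =ᶠ[𝓝 t] d := by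
  obtain ⟨ε, hε, hball⟩ := Metric.isOpen_iff.1 (hU c hc) t ht
  obtain ⟨h, hh, hhε, hht⟩ := exists_truncation t hε
  refine ⟨fun s => f (c (h s)), hf _ (hc.comp hh) fun s => hball (hhε s), ?_⟩
  filter_upwards [hht] with s hs
  rw [hs]

/-- The bridge to ordinary calculus: truncating both coordinates makes the composite globally
defined and smooth along curves, and Boman's theorem applies. -/
theorem CSmoothOn.contDiffAt_plane {U : Set E} (hU : CInftyOpen U) {f : E → F}
    (hf : CSmoothOn f U) {γ : ℝ × ℝ → E} (hγ : CSmoothOn γ univ) {p : ℝ × ℝ} (hp : γ p ∈ U)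
    (l : F →L[ℝ] ℝ) : ContDiffAt ℝ ∞ (fun q => l (f (γ q))) p := by
  have hV : IsOpen (γ ⁻¹' U) := CInftyOpen.isOpen fun c hc =>
    hU _ (hγ c hc fun _ => mem_univ _)
  obtain ⟨ε, hε, hball⟩ := Metric.isOpen_iff.1 hV p hp
  obtain ⟨h₁, hh₁, hε₁, ht₁⟩ := exists_truncation p.1 hε
  obtain ⟨h₂, hh₂, hε₂, ht₂⟩ := exists_truncation p.2 hε
  have hg : ContDiff ℝ ∞ fun q : ℝ × ℝ => l (f (γ (h₁ q.1, h₂ q.2))) := by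
    refine contDiff_of_smooth_along_curves fun c hc => ?_
    have h1 : SmoothCurve fun t => (h₁ (c t).1, h₂ (c t).2) :=
      (hh₁.comp hc.fst).prodMk (hh₂.comp hc.snd)
    refine SmoothCurve.contDiff_map (hf _ (hγ _ h1 fun _ => mem_univ _) fun t => ?_) l
    exact hball (max_lt (hε₁ _) (hε₂ _))
  refine hg.contDiffAt.congr_of_eventuallyEq ?_
  have h1 : ∀ᶠ q : ℝ × ℝ in 𝓝 p, h₁ q.1 = q.1 := (continuous_fst.tendsto p).eventually ht₁
  have h2 : ∀ᶠ q : ℝ × ℝ in 𝓝 p, h₂ q.2 = q.2 := (continuous_snd.tendsto p).eventually ht₂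
  filter_upwards [h1, h2] with q hq1 hq2
  rw [hq1, hq2]

theorem CSmoothOn.hasVelocity_line {U : Set E} (hU : CInftyOpen U) {f : E → F}
    (hf : CSmoothOn f U) {x : E} (hx : x ∈ U) (v : E) :
    HasVelocity (fun t : ℝ => f (x + t • v)) (dirDeriv f x v) 0 := by
  obtain ⟨d, hd, he⟩ := hf.exists_smoothCurve hU (smoothCurve_line x v) (t := 0) (by simpa using hx)
  have := (hd.hasVelocity 0).congr_of_eventuallyEq he
  rwa [← velocity_congr he] at this

theorem hasVelocity_shift {c : ℝ → F} {v : F} {t : ℝ} :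
    HasVelocity (fun s => c (t + s)) v 0 ↔ HasVelocity c v t := by
  simp [HasVelocity]

theorem hasDerivAt_of_plane {G : ℝ × ℝ → ℝ} {p : ℝ × ℝ} (hG : DifferentiableAt ℝ G p) (v : ℝ × ℝ) :
    HasDerivAt (fun t : ℝ => G (p + t • v)) (fderiv ℝ G p v) 0 := by
  have h1 : HasDerivAt (fun t : ℝ => p + t • v) v 0 := by
    simpa using ((hasDerivAt_id (0 : ℝ)).smul_const v).const_add p
  have h2 : HasFDerivAt G (fderiv ℝ G p) (p + (0 : ℝ) • v) := by simpa using hG.hasFDerivAt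
  exact h2.comp_hasDerivAt 0 h1

/-- The chain rule along smooth curves. -/
theorem CSmoothOn.hasVelocity_comp {U : Set E} (hU : CInftyOpen U) {f : E → F}
    (hf : CSmoothOn f U) {c : ℝ → E} (hc : SmoothCurve c) {t : ℝ} (ht : c t ∈ U) :
    HasVelocity (fun s => f (c s)) (dirDeriv f (c t) (velocity c t)) t := by
  obtain ⟨d, hd, he⟩ := hf.exists_smoothCurve hU hc ht
  have h1 := (hd.hasVelocity t).congr_of_eventuallyEq he
  suffices h : velocity d t = dirDeriv f (c t) (velocity c t) by rwa [h] at h1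
  refine eq_of_forall_dual_eq fun l => ?_
  obtain ⟨e, he, he0, hce⟩ := hc.exists_hadamard t
  -- By Hadamard's lemma the given curve is the diagonal of this plane map. The derivative along
  -- $(1,1)$ is the sum of those along $(1,0)$, the directional derivative sought, and $(0,1)$,
  -- where the map is constant.
  set G : ℝ × ℝ → ℝ := fun q => l (f (c t + q.1 • e q.2)) with hG
  have hGd : DifferentiableAt ℝ G 0 := by
    refine ContDiffAt.differentiableAt (n := ∞) (hf.contDiffAt_plane hU
      (γ := fun q : ℝ × ℝ => c t + q.1 • e q.2) (fun a ha _ => ?_) (by simpa using ht) l) (by simp)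
    exact (smoothCurve_const _).add (ha.fst.smul (he.comp ha.snd))
  have a1 := hasDerivAt_of_plane hGd (1, 1)
  have a2 := hasDerivAt_of_plane hGd (1, 0)
  have a3 := hasDerivAt_of_plane hGd (0, 1)
  simp only [hG, zero_add, Prod.smul_mk, smul_eq_mul, mul_one, mul_zero, ← hce, he0, zero_smul,
    add_zero] at a1 a2 a3
  have b1 := hasVelocity_iff_hasDerivAt.1 ((hasVelocity_shift.2 h1).map l)
  have b2 := hasVelocity_iff_hasDerivAt.1 ((hf.hasVelocity_line hU ht (velocity c t)).map l)
  rw [b1.unique a1, b2.unique a2]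
  rw [show ((1 : ℝ), (1 : ℝ)) = (1, 0) + (0, 1) by simp, map_add,
    a3.unique (hasDerivAt_const _ _), add_zero]

theorem CSmoothOn.dirDeriv_comp_eq {U : Set E} (hU : CInftyOpen U) {f : E → F}
    (hf : CSmoothOn f U) {V : Set F} (hV : CInftyOpen V) {g : F → F'} (hg : CSmoothOn g V)
    {x : E} (hx : x ∈ U) (hfx : f x ∈ V) (v : E) :
    dirDeriv (fun y => g (f y)) x v = dirDeriv g (f x) (dirDeriv f x v) := by
  obtain ⟨d, hd, he⟩ := hf.exists_smoothCurve hU (smoothCurve_line x v) (t := 0) (by simpa using hx)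
  have h0 : d 0 = f x := by simpa using he.self_of_nhds.symm
  have h1 := hg.hasVelocity_comp hV hd (t := 0) (by rwa [h0])
  have h2 : velocity d 0 = dirDeriv f x v := (velocity_congr he).symm
  rw [h0, h2] at h1
  refine HasVelocity.velocity_eq (h1.congr_of_eventuallyEq ?_)
  filter_upwards [he] with s hs
  rw [hs]

theorem dirDeriv_congr {U : Set E} (hU : CInftyOpen U) {f g : E → F} (h : EqOn f g U) {x : E}
    (hx : x ∈ U) (v : E) : dirDeriv f x v = dirDeriv g x v := by
  refine velocity_congr ?_
  filter_upwards [hU.eventually_mem_line hx v] with s hs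
  exact h hs

theorem dirDeriv_const (y : F) (x v : E) : dirDeriv (fun _ : E => y) x v = 0 :=
  HasVelocity.velocity_eq (by simp [HasVelocity])

theorem dirDeriv_id (x v : E) : dirDeriv (fun y : E => y) x v = v :=
  (_root_.hasVelocity_line x v 0).velocity_eq

section Linear

variable {U : Set E} (hU : CInftyOpen U) {f g : E → F} (hf : CSmoothOn f U) (hg : CSmoothOn g U)
  {x : E} (hx : x ∈ U)

include hU hf hx

/-- Additivity is that of the Fréchet derivative of $(a,b)\mapsto l(f(x+av+bw))$ at the origin. -/
theorem CSmoothOn.dirDeriv_add (v w : E) :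
    dirDeriv f x (v + w) = dirDeriv f x v + dirDeriv f x w := by
  refine eq_of_forall_dual_eq fun l => ?_
  set G : ℝ × ℝ → ℝ := fun q => l (f (x + (q.1 • v + q.2 • w))) with hG
  have hGd : DifferentiableAt ℝ G 0 := by
    refine ContDiffAt.differentiableAt (n := ∞) (hf.contDiffAt_plane hU
      (γ := fun q : ℝ × ℝ => x + (q.1 • v + q.2 • w)) (fun a ha _ => ?_) (by simpa using hx) l)
      (by simp)
    exact (smoothCurve_const _).add ((ha.fst.smul (smoothCurve_const v)).add
      (ha.snd.smul (smoothCurve_const w)))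
  have a1 := hasDerivAt_of_plane hGd (1, 1)
  have a2 := hasDerivAt_of_plane hGd (1, 0)
  have a3 := hasDerivAt_of_plane hGd (0, 1)
  simp only [hG, zero_add, Prod.smul_mk, smul_eq_mul, mul_one, mul_zero, ← smul_add, zero_smul,
    add_zero] at a1 a2 a3
  have b : ∀ u, _ := fun u => hasVelocity_iff_hasDerivAt.1 ((hf.hasVelocity_line hU hx u).map l)
  rw [map_add, (b _).unique a1, (b _).unique a2, (b _).unique a3, ← map_add]
  simp

theorem CSmoothOn.dirDeriv_smul (a : ℝ) (v : E) : dirDeriv f x (a • v) = a • dirDeriv f x v := by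
  refine eq_of_forall_dual_eq fun l => ?_
  have b : ∀ u, _ := fun u => hasVelocity_iff_hasDerivAt.1 ((hf.hasVelocity_line hU hx u).map l)
  have h1 : HasDerivAt (fun t : ℝ => t * a) a 0 := by simpa using (hasDerivAt_id (0 : ℝ)).mul_const a
  have h2 := HasDerivAt.comp (h₂ := fun t : ℝ => l (f (x + t • v))) (0 : ℝ)
    (by rw [zero_mul]; exact b v) h1
  have h3 := b (a • v)
  simp only [smul_smul] at h3
  rw [h3.unique h2, map_smul, smul_eq_mul, mul_comm]

/-- The derivative of a smooth map as a linear map. -/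
theorem CSmoothOn.isLinearMap_dirDeriv : IsLinearMap ℝ (dirDeriv f x) :=
  ⟨hf.dirDeriv_add hU hx, hf.dirDeriv_smul hU hx⟩

include hg in
theorem dirDeriv_fun_add (v : E) :
    dirDeriv (fun y => f y + g y) x v = dirDeriv f x v + dirDeriv g x v :=
  ((hf.hasVelocity_line hU hx v).add (hg.hasVelocity_line hU hx v)).velocity_eq

theorem dirDeriv_fun_const_smul (a : ℝ) (v : E) :
    dirDeriv (fun y => a • f y) x v = a • dirDeriv f x v :=
  ((hf.hasVelocity_line hU hx v).const_smul a).velocity_eq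

omit hf in
theorem dirDeriv_fun_mul {a b : E → ℝ} (ha : CSmoothOn a U) (hb : CSmoothOn b U) (v : E) :
    dirDeriv (fun y => a y * b y) x v = dirDeriv a x v * b x + a x * dirDeriv b x v := by
  have := (hasVelocity_iff_hasDerivAt.1 (ha.hasVelocity_line hU hx v)).fun_mul
    (hasVelocity_iff_hasDerivAt.1 (hb.hasVelocity_line hU hx v))
  refine HasVelocity.velocity_eq (hasVelocity_iff_hasDerivAt.2 ?_)
  simpa using this

end Linear

theorem dirDeriv_map (l : F →L[ℝ] F') {U : Set E} (hU : CInftyOpen U) {f : E → F}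
    (hf : CSmoothOn f U) {x : E} (hx : x ∈ U) (v : E) :
    dirDeriv (fun y => l (f y)) x v = l (dirDeriv f x v) :=
  ((hf.hasVelocity_line hU hx v).map l).velocity_eq

theorem map_dirDeriv_eq_fderiv {U : Set E} (hU : CInftyOpen U) {f : E → F} (hf : CSmoothOn f U)
    {γ : ℝ × ℝ → E} {p b : ℝ × ℝ} {x v : E} (hγ : ∀ s : ℝ, γ (p + s • b) = x + s • v) (hx : x ∈ U)
    (l : F →L[ℝ] ℝ) (hG : DifferentiableAt ℝ (fun q => l (f (γ q))) p) :
    l (dirDeriv f x v) = fderiv ℝ (fun q => l (f (γ q))) p b := by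
  have a := hasDerivAt_of_plane hG b
  simp only [hγ] at a
  exact (hasVelocity_iff_hasDerivAt.1 ((hf.hasVelocity_line hU hx v).map l)).unique a

/-- The derivative of a smooth map is smooth. -/
theorem CSmoothOn.dirDeriv {U : Set E} (hU : CInftyOpen U) {f : E → F} (hf : CSmoothOn f U) :
    CSmoothOn (fun z : E × E => dirDeriv f z.1 z.2) (U ×ˢ univ) := by
  intro c hc hcU
  refine smoothCurve_iff_scalarwise.2 fun l => ?_
  -- The derivative along the curve becomes a partial derivative, at second coordinate $0$, of a
  -- smooth function on the plane.
  set γ : ℝ × ℝ → E := fun q => (c q.1).1 + q.2 • (c q.1).2 with hγ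
  have hγs : CSmoothOn γ univ := fun a ha _ =>
    (hc.comp ha.fst).fst.add (ha.snd.smul (hc.comp ha.fst).snd)
  have hG : ∀ t, ContDiffAt ℝ ∞ (fun q => l (f (γ q))) (t, 0) := fun t =>
    hf.contDiffAt_plane hU hγs (by simpa [hγ] using (hcU t).1) l
  have h1 : (fun t => l (_root_.dirDeriv f (c t).1 (c t).2)) =
      fun t => fderiv ℝ (fun q => l (f (γ q))) (t, 0) (0, 1) := funext fun t =>
    map_dirDeriv_eq_fderiv hU hf (fun s => by simp [hγ]) (hcU t).1 l
      ((hG t).differentiableAt (by simp))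
  rw [h1, contDiff_iff_contDiffAt]
  intro t
  have h2 : ContDiffAt ℝ ∞ (fun q : ℝ × ℝ => fderiv ℝ (fun q => l (f (γ q))) q (0, 1)) (t, 0) :=
    ((hG t).fderiv_right (m := ∞) le_rfl).clm_apply contDiffAt_const
  exact h2.comp t (f := fun t : ℝ => (t, (0 : ℝ))) (contDiffAt_id.prodMk contDiffAt_const)

theorem CSmoothOn.dirDeriv_apply {U : Set E} (hU : CInftyOpen U) {f : E → F} (hf : CSmoothOn f U)
    {X : E → E} (hX : CSmoothOn X U) : CSmoothOn (fun x => _root_.dirDeriv f x (X x)) U :=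
  fun c hc hcU => hf.dirDeriv hU (fun t => (c t, X (c t))) (hc.prodMk (hX c hc hcU))
    fun t => ⟨hcU t, mem_univ _⟩

theorem hasDerivAt_fderiv_of_plane {G : ℝ × ℝ → ℝ} (hG : ContDiffAt ℝ ∞ G 0) (a b : ℝ × ℝ) :
    HasDerivAt (fun t : ℝ => fderiv ℝ G (t • a) b) (fderiv ℝ (fderiv ℝ G) 0 a b) 0 := by
  have h3 : DifferentiableAt ℝ (fderiv ℝ G) 0 :=
    (hG.fderiv_right (m := ∞) le_rfl).differentiableAt (by simp)
  have h4 : HasDerivAt (fun t : ℝ => t • a) a 0 := by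
    simpa using (hasDerivAt_id (0 : ℝ)).smul_const a
  have h5 : HasFDerivAt (fderiv ℝ G) (fderiv ℝ (fderiv ℝ G) 0) ((0 : ℝ) • a) := by
    simpa using h3.hasFDerivAt
  have h6 : HasDerivAt (fun t : ℝ => fderiv ℝ G (t • a)) (fderiv ℝ (fderiv ℝ G) 0 a) 0 :=
    h5.comp_hasDerivAt 0 h4
  exact (ContinuousLinearMap.apply ℝ ℝ b).hasFDerivAt.comp_hasDerivAt 0 h6

/-- Iterated directional derivatives are mixed second derivatives of a plane function, so their
symmetry is the classical one. -/
theorem second_dirDeriv_eq {U : Set E} (hU : CInftyOpen U) {f : E → F} (hf : CSmoothOn f U) {x : E}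
    (hx : x ∈ U) {γ : ℝ × ℝ → E} (hγ : CSmoothOn γ univ) {a b : ℝ × ℝ} {v w : E}
    (hγ' : ∀ t s : ℝ, γ (t • a + s • b) = x + t • v + s • w) (l : F →L[ℝ] ℝ) :
    l (dirDeriv (fun y => dirDeriv f y w) x v) =
      fderiv ℝ (fderiv ℝ (fun q => l (f (γ q)))) 0 a b := by
  have hG : ∀ t : ℝ, x + t • v ∈ U → ContDiffAt ℝ ∞ (fun q => l (f (γ q))) (t • a) := fun t ht =>
    hf.contDiffAt_plane hU hγ (by have := hγ' t 0; simp only [zero_smul, add_zero] at this; rwa [this]) l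
  have hfw : CSmoothOn (fun y => dirDeriv f y w) U := hf.dirDeriv_apply hU (cSmoothOn_const w U)
  have h1 := hasVelocity_iff_hasDerivAt.1 ((hfw.hasVelocity_line hU hx v).map l)
  have h0 : ContDiffAt ℝ ∞ (fun q => l (f (γ q))) 0 := by simpa using hG 0 (by simpa using hx)
  refine h1.unique ((hasDerivAt_fderiv_of_plane h0 a b).congr_of_eventuallyEq ?_)
  filter_upwards [hU.eventually_mem_line hx v] with t ht
  exact map_dirDeriv_eq_fderiv hU hf (hγ' t) ht l ((hG t ht).differentiableAt (by simp))

/-- Second derivatives are symmetric. -/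
theorem CSmoothOn.dirDeriv_dirDeriv_comm {U : Set E} (hU : CInftyOpen U) {f : E → F}
    (hf : CSmoothOn f U) {x : E} (hx : x ∈ U) (v w : E) :
    _root_.dirDeriv (fun y => _root_.dirDeriv f y w) x v =
      _root_.dirDeriv (fun y => _root_.dirDeriv f y v) x w := by
  refine eq_of_forall_dual_eq fun l => ?_
  have hγ : CSmoothOn (fun q : ℝ × ℝ => x + q.1 • v + q.2 • w) univ := fun a ha _ =>
    ((smoothCurve_const x).add (ha.fst.smul (smoothCurve_const v))).add
      (ha.snd.smul (smoothCurve_const w))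
  have h0 : ContDiffAt ℝ ∞ (fun q : ℝ × ℝ => l (f (x + q.1 • v + q.2 • w))) 0 :=
    hf.contDiffAt_plane hU hγ (by simpa using hx) l
  rw [second_dirDeriv_eq hU hf hx hγ (a := (1, 0)) (b := (0, 1)) (fun t s => by simp) l,
    second_dirDeriv_eq hU hf hx hγ (a := (0, 1)) (b := (1, 0))
      (fun t s => by simp [add_right_comm]) l]
  exact (h0.isSymmSndFDerivAt (by simpa using WithTop.coe_le_coe.2 (le_top (a := (2 : ℕ∞))))).eq _ _

/-- The product rule for a smooth family of bilinear maps. -/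
theorem dirDeriv_bilinear {U : Set E} (hU : CInftyOpen U) {P : E → F → F' → ℝ}
    (hP : CSmoothOn (fun z : E × F × F' => P z.1 z.2.1 z.2.2) (U ×ˢ univ))
    (hP₁ : ∀ x ∈ U, ∀ b, IsLinearMap ℝ fun a => P x a b)
    (hP₂ : ∀ x ∈ U, ∀ a, IsLinearMap ℝ (P x a))
    {X : E → F} (hX : CSmoothOn X U) {Y : E → F'} (hY : CSmoothOn Y U) {x : E} (hx : x ∈ U) (v : E) :
    dirDeriv (fun y => P y (X y) (Y y)) x v = dirDeriv (fun y => P y (X x) (Y x)) x v +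
      P x (dirDeriv X x v) (Y x) + P x (X x) (dirDeriv Y x v) := by
  have hUp : CInftyOpen (U ×ˢ (univ : Set (F × F'))) := hU.prod_univ
  have hz : (x, X x, Y x) ∈ U ×ˢ (univ : Set (F × F')) := ⟨hx, mem_univ _⟩
  have h1 := CSmoothOn.dirDeriv_comp_eq hU ((cSmoothOn_id U).prodMk (hX.prodMk hY)) hUp hP hx hz v
  have h2 : dirDeriv (fun y => (y, X y, Y y)) x v = (v, dirDeriv X x v, dirDeriv Y x v) :=
    ((_root_.hasVelocity_line x v 0).prodMk
      ((hX.hasVelocity_line hU hx v).prodMk (hY.hasVelocity_line hU hx v))).velocity_eq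
  rw [h2] at h1
  refine h1.trans ?_
  -- The velocity of $y\mapsto(y,X(y),Y(y))$ is split along the three factors. On the last two the
  -- form is affine along the line, so the derivative is the form itself.
  rw [show (v, dirDeriv X x v, dirDeriv Y x v) = (v, (0 : F), (0 : F')) +
    (0, dirDeriv X x v, 0) + (0, 0, dirDeriv Y x v) by simp,
    hP.dirDeriv_add hUp hz, hP.dirDeriv_add hUp hz]
  congr 1
  · congr 1
    · unfold dirDeriv; simp
    · refine HasVelocity.velocity_eq ?_
      have := _root_.hasVelocity_line (P x (X x) (Y x)) (P x (dirDeriv X x v) (Y x)) 0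
      refine this.congr_of_eventuallyEq (.of_forall fun t => ?_)
      simp [(hP₁ x hx (Y x)).map_add, (hP₁ x hx (Y x)).map_smul]
  · refine HasVelocity.velocity_eq ?_
    have := _root_.hasVelocity_line (P x (X x) (Y x)) (P x (X x) (dirDeriv Y x v)) 0
    refine this.congr_of_eventuallyEq (.of_forall fun t => ?_)
    simp [(hP₂ x hx (X x)).map_add, (hP₂ x hx (X x)).map_smul]

end Calculus

/-! ### Bounded sets of smooth maps -/

section BoundedSets

variable {E : Type*} [AddCommGroup E] [Module ℝ E] [TopologicalSpace E] [ConvenientSpace E]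
  {F : Type*} [AddCommGroup F] [Module ℝ F] [TopologicalSpace F] [ConvenientSpace F]
  {G : Type*} [NormedAddCommGroup G] [NormedSpace ℝ G] [CompleteSpace G]

theorem cInftyOpen_univ : CInftyOpen (univ : Set E) := fun _ _ => isOpen_univ

theorem SmoothCurve.iterate_velocity_add {c c' : ℝ → E} (hc : SmoothCurve c) (hc' : SmoothCurve c')
    (n : ℕ) : _root_.velocity^[n] (fun t => c t + c' t) =
      fun t => _root_.velocity^[n] c t + _root_.velocity^[n] c' t :=
  SmoothCurve.iterate_velocity_eq
    (d := fun n t => _root_.velocity^[n] c t + _root_.velocity^[n] c' t)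
    (fun n t => (hc.hasVelocity_iterate n t).add (hc'.hasVelocity_iterate n t)) n

theorem SmoothCurve.iterate_velocity_sub {c c' : ℝ → E} (hc : SmoothCurve c) (hc' : SmoothCurve c')
    (n : ℕ) : _root_.velocity^[n] (fun t => c t - c' t) =
      fun t => _root_.velocity^[n] c t - _root_.velocity^[n] c' t :=
  SmoothCurve.iterate_velocity_eq
    (d := fun n t => _root_.velocity^[n] c t - _root_.velocity^[n] c' t)
    (fun n t => (hc.hasVelocity_iterate n t).sub (hc'.hasVelocity_iterate n t)) n

theorem iterate_velocity_eq_iteratedDeriv {q : ℝ → G} (hq : ContDiff ℝ ∞ q) (n : ℕ) :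
    velocity^[n] q = iteratedDeriv n q :=
  SmoothCurve.iterate_velocity_eq (d := fun n => iteratedDeriv n q) (fun n t => by
    rw [hasVelocity_iff_hasDerivAt, iteratedDeriv_succ, hasDerivAt_deriv_iff]
    exact hq.differentiable_iteratedDeriv n (mod_cast ENat.natCast_lt_top n) t) n

theorem isVonNBounded_iff_forall_seminorm {s : Set F} : Bornology.IsVonNBounded ℝ s ↔
    ∀ p : Seminorm ℝ F, Continuous p → ∃ C, ∀ y ∈ s, p y ≤ C := by
  rw [(PolynormableSpace.withSeminorms ℝ F).isVonNBounded_iff_seminorm_bddAbove]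
  constructor
  · intro h p hp
    obtain ⟨C, hC⟩ := h ⟨p, hp⟩
    exact ⟨C, fun y hy => hC ⟨y, hy, rfl⟩⟩
  · rintro h ⟨p, hp⟩
    obtain ⟨C, hC⟩ := h p hp
    exact ⟨C, by rintro _ ⟨y, hy, rfl⟩; exact hC y hy⟩

theorem exists_bound_dual {s : Set F} (hs : Bornology.IsVonNBounded ℝ s) (l : F →L[ℝ] ℝ) :
    ∃ C, ∀ y ∈ s, |l y| ≤ C :=
  isVonNBounded_iff_forall_seminorm.1 hs l.toSeminorm l.continuous.norm

/-- A norming functional from Hahn–Banach: a continuous seminorm is a supremum over the functionals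
it dominates, which allows vector estimates to be made in $\ell^\infty$. -/
theorem exists_dual_eq_seminorm (p : Seminorm ℝ F) (hp : Continuous p) (y : F) :
    ∃ l : F →L[ℝ] ℝ, l y = p y ∧ ∀ z, |l z| ≤ p z := by
  by_cases hy : y = 0
  · exact ⟨0, by simp [hy], fun z => by simp⟩
  · let f := LinearPMap.mkSpanSingleton (σ := RingHom.id ℝ) y (p y) hy
    obtain ⟨g, hg, hle⟩ := Module.Dual.exists_continuous_extension_of_le_seminorm_real
      f.domain f.toFun hp (fun x => by
        obtain ⟨x, hx⟩ := x
        obtain ⟨a, rfl⟩ := Submodule.mem_span_singleton.1 hx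
        have : f ⟨a • y, hx⟩ = a • p y := LinearPMap.mkSpanSingleton'_apply ..
        change f ⟨a • y, hx⟩ ≤ p (a • y)
        rw [this, map_smul_eq_mul, smul_eq_mul]
        exact mul_le_mul_of_nonneg_right (le_abs_self a) (apply_nonneg p y))
    refine ⟨g, ?_, hle⟩
    have h1 := hg ⟨y, Submodule.mem_span_singleton_self y⟩
    have h2 : f ⟨y, Submodule.mem_span_singleton_self y⟩ = p y :=
      LinearPMap.mkSpanSingleton'_apply_self ..
    exact h1.trans h2

/-- A smooth map which is linear in the second variable is bounded on products of compact
intervals of parameters and bounded sets. -/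
theorem exists_bound_of_smooth_of_linear {Ψ : ℝ × E → G} (hΨ : CSmoothOn Ψ univ)
    (hlin : ∀ t, IsLinearMap ℝ fun v => Ψ (t, v)) {K : Set ℝ} (hK : IsCompact K) {V : Set E}
    (hV : ∀ l : E →L[ℝ] ℝ, ∃ C, ∀ v ∈ V, |l v| ≤ C) : ∃ C, ∀ t ∈ K, ∀ v ∈ V, ‖Ψ (t, v)‖ ≤ C := by
  have hloc : ∀ t₀ : ℝ, ∃ δ > 0, ∃ C, ∀ t, dist t t₀ < δ → ∀ v ∈ V, ‖Ψ (t, v)‖ ≤ C := by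
    intro t₀
    by_contra! h
    have h' : ∀ n : ℕ, ∃ t, dist t t₀ < (1 / 2) ^ n ^ 2 ∧ ∃ v ∈ V,
        n / (1 / 2) ^ n ^ 2 < ‖Ψ (t, v)‖ := fun n => h _ (by positivity) _
    choose t ht v hv htv using h'
    -- With $\varepsilon=2^{-n^2}$ the curve hits $(t_n,\varepsilon v_n)$. By linearity the value
    -- there is $\varepsilon\Psi(t_n,v_n)$, of norm above $n$, which is impossible on a compact
    -- interval.
    obtain ⟨c, hc, -, hcn⟩ := exists_smoothCurve_through (t₀, (0 : E))
      (fun n => (((1 / 2 : ℝ) ^ n ^ 2)⁻¹ * (t n - t₀), v n)) (fun _ => 0) (fun l => by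
        obtain ⟨C, hC⟩ := hV (l.comp (ContinuousLinearMap.inr ℝ ℝ E))
        refine ⟨|l (1, 0)| + C, fun n => ?_⟩
        have e : l (((1 / 2 : ℝ) ^ n ^ 2)⁻¹ * (t n - t₀), v n) =
            (((1 / 2 : ℝ) ^ n ^ 2)⁻¹ * (t n - t₀)) * l (1, 0) + l (0, v n) := by
          rw [← smul_eq_mul (b := l (1, 0)), ← map_smul, ← map_add]; simp
        rw [e]
        refine (abs_add_le _ _).trans (add_le_add ?_ (hC _ (hv n)))
        rw [abs_mul]
        refine mul_le_of_le_one_left (abs_nonneg _) ?_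
        rw [abs_mul, abs_inv, abs_of_pos (by positivity : (0 : ℝ) < (1 / 2) ^ n ^ 2),
          inv_mul_le_iff₀ (by positivity), mul_one]
        exact (ht n).le) (fun l => ⟨0, by simp⟩)
    obtain ⟨C, hC⟩ := (isCompact_Icc (a := (0 : ℝ)) (b := 1)).exists_bound_of_continuousOn
      (hΨ c hc fun _ => mem_univ _).contDiff.continuous.continuousOn
    obtain ⟨n, hn⟩ := exists_nat_gt C
    have h1 := hC ((1 / 2) ^ n) ⟨by positivity, pow_le_one₀ (by norm_num) (by norm_num)⟩
    have h2 := (hcn n).self_of_nhds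
    have hε : (0 : ℝ) < (1 / 2) ^ n ^ 2 := by positivity
    rw [smul_zero, add_zero, add_zero, Prod.smul_mk, Prod.mk_add_mk, smul_eq_mul, ← mul_assoc,
      mul_inv_cancel₀ hε.ne', one_mul, add_sub_cancel, zero_add] at h2
    rw [h2, (hlin (t n)).map_smul, norm_smul, Real.norm_of_nonneg hε.le] at h1
    have h3 := htv n
    rw [div_lt_iff₀ hε, mul_comm] at h3
    linarith
  refine hK.induction_on (p := fun s => ∃ C, ∀ t ∈ s, ∀ v ∈ V, ‖Ψ (t, v)‖ ≤ C) ⟨0, by simp⟩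
    (fun s t hst ⟨C, hC⟩ => ⟨C, fun q hq => hC q (hst hq)⟩) ?_ ?_
  · rintro s t ⟨C, hC⟩ ⟨C', hC'⟩
    exact ⟨max C C', fun q hq v hv => hq.elim (fun h => (hC q h v hv).trans (le_max_left _ _))
      fun h => (hC' q h v hv).trans (le_max_right _ _)⟩
  · intro t₀ _
    obtain ⟨δ, hδ, C, hC⟩ := hloc t₀
    exact ⟨_, mem_nhdsWithin_of_mem_nhds (Metric.ball_mem_nhds t₀ hδ), C, fun q hq => hC q hq⟩

/-- The composition of a smooth family of linear maps with a bounded set of curves is bounded. -/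
theorem exists_bound_iterate_velocity {Ψ : ℝ × E → G} (hΨ : CSmoothOn Ψ univ)
    (hlin : ∀ t, IsLinearMap ℝ fun v => Ψ (t, v)) {𝒳 : Set (ℝ → E)}
    (hsm : ∀ ξ ∈ 𝒳, SmoothCurve ξ)
    (hbd : ∀ (k : ℕ) (K : Set ℝ), IsCompact K → ∀ l : E →L[ℝ] ℝ, ∃ C, ∀ ξ ∈ 𝒳, ∀ t ∈ K,
      |l (velocity^[k] ξ t)| ≤ C) (n : ℕ) {K : Set ℝ} (hK : IsCompact K) :
    ∃ C, ∀ ξ ∈ 𝒳, ∀ t ∈ K, ‖velocity^[n] (fun s => Ψ (s, ξ s)) t‖ ≤ C := by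
  induction n generalizing Ψ 𝒳 with
  | zero =>
    obtain ⟨C, hC⟩ := exists_bound_of_smooth_of_linear hΨ hlin hK
      (V := {v | ∃ ξ ∈ 𝒳, ∃ t ∈ K, v = ξ t}) (fun l => by
        obtain ⟨C, hC⟩ := hbd 0 K hK l
        exact ⟨C, by rintro _ ⟨ξ, hξ, t, ht, rfl⟩; exact hC ξ hξ t ht⟩)
    exact ⟨C, fun ξ hξ t ht => hC t ht _ ⟨ξ, hξ, t, ht, rfl⟩⟩
  | succ n ih =>
    have hΨ' : CSmoothOn (fun z : ℝ × E => dirDeriv Ψ z (1, 0)) univ :=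
      hΨ.dirDeriv_apply cInftyOpen_univ (cSmoothOn_const _ _)
    have hd : ∀ t v, HasVelocity (fun s : ℝ => Ψ (t + s, v)) (dirDeriv Ψ (t, v) (1, 0)) 0 := by
      intro t v
      have := hΨ.hasVelocity_line cInftyOpen_univ (mem_univ (t, v)) (1, 0)
      simpa using this
    obtain ⟨C, hC⟩ := ih hΨ' (fun t => ⟨fun v w => by
      refine (hd t (v + w)).unique (((hd t v).add (hd t w)).congr_of_eventuallyEq
        (.of_forall fun s => (hlin _).map_add _ _)), fun a v => by
      refine (hd t (a • v)).unique (((hd t v).const_smul a).congr_of_eventuallyEq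
        (.of_forall fun s => (hlin _).map_smul _ _))⟩) hsm hbd
    obtain ⟨D, hD⟩ := ih hΨ hlin (𝒳 := velocity '' 𝒳)
      (by rintro _ ⟨ξ, hξ, rfl⟩; exact (hsm ξ hξ).velocity)
      (fun k K hK l => by
        obtain ⟨C, hC⟩ := hbd (k + 1) K hK l
        exact ⟨C, by rintro _ ⟨ξ, hξ, rfl⟩ t ht; exact hC ξ hξ t ht⟩)
    refine ⟨C + D, fun ξ hξ t ht => ?_⟩
    have hξs := hsm ξ hξ
    -- The product rule gives two terms of the original kind: the time derivative of the family
    -- applied to $\xi$, and the family itself applied to $\xi'$. Induction applies to both.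
    have e : velocity (fun s => Ψ (s, ξ s)) =
        fun s => dirDeriv Ψ (s, ξ s) (1, 0) + Ψ (s, velocity ξ s) := by
      funext s
      have h1 := hΨ.hasVelocity_comp cInftyOpen_univ (smoothCurve_id.prodMk hξs) (mem_univ (s, ξ s))
      have h2 : velocity (fun t => (t, ξ t)) s = ((1 : ℝ), (0 : E)) + (0, velocity ξ s) := by
        rw [Prod.mk_add_mk, add_zero, zero_add]
        exact ((hasVelocity_iff_hasDerivAt.2 (hasDerivAt_id s)).prodMk
          (hξs.hasVelocity s)).velocity_eq
      rw [h1.velocity_eq, h2, hΨ.dirDeriv_add cInftyOpen_univ (mem_univ _)]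
      congr 1
      refine HasVelocity.velocity_eq
        ((_root_.hasVelocity_line (Ψ (s, ξ s)) (Ψ (s, velocity ξ s)) 0).congr_of_eventuallyEq
        (.of_forall fun r => ?_))
      simp [(hlin s).map_add, (hlin s).map_smul]
    rw [Function.iterate_succ_apply, e, SmoothCurve.iterate_velocity_add
      (hΨ' _ (smoothCurve_id.prodMk hξs) fun _ => mem_univ _)
      (hΨ _ (smoothCurve_id.prodMk hξs.velocity) fun _ => mem_univ _)]
    exact (norm_add_le _ _).trans (add_le_add (hC ξ hξ t ht) (hD _ ⟨ξ, hξ, rfl⟩ t ht))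

/-- Families of smooth functions with locally uniformly bounded derivatives are smooth curves of
bounded families. -/
theorem smoothCurve_lp {I : Type*} {u : I → ℝ → ℝ} (hu : ∀ i, ContDiff ℝ ∞ (u i))
    (hb : ∀ (k : ℕ) (K : Set ℝ), IsCompact K → ∃ C, ∀ i, ∀ t ∈ K, |iteratedDeriv k (u i) t| ≤ C) :
    ∃ c : ℝ → lp (fun _ : I => ℝ) ⊤, SmoothCurve c ∧ ∀ t i, c t i = u i t := by
  have hmem : ∀ k t, Memℓp (fun i => iteratedDeriv k (u i) t) ⊤ := by
    intro k t
    obtain ⟨C, hC⟩ := hb k {t} isCompact_singleton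
    exact memℓp_infty ⟨C, by rintro _ ⟨i, rfl⟩; exact hC i t rfl⟩
  refine ⟨fun t => ⟨_, hmem 0 t⟩, ⟨fun k t => ⟨_, hmem k t⟩, rfl, fun k t => ?_⟩, fun t i => ?_⟩
  · rw [hasVelocity_iff_hasDerivAt, hasDerivAt_iff_isLittleO_nhds_zero]
    -- A bound on the derivative two orders up makes the Taylor remainder $O(h^2)$ uniformly in the
    -- index, hence in the supremum norm.
    obtain ⟨C, hC⟩ := hb (k + 2) (Icc (t - 1) (t + 1)) isCompact_Icc
    refine Asymptotics.IsBigO.trans_isLittleO (g := fun h : ℝ => h ^ 2)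
      (Asymptotics.IsBigO.of_bound (max C 0) ?_) ?_
    · filter_upwards [Metric.ball_mem_nhds (0 : ℝ) one_pos] with h hh
      rw [Metric.mem_ball, dist_zero_right, Real.norm_eq_abs, abs_lt] at hh
      refine lp.norm_le_of_forall_le (by positivity) fun i => ?_
      have hd : ∀ m s, HasDerivAt (iteratedDeriv m (u i)) (iteratedDeriv (m + 1) (u i) s) s := by
        intro m s
        rw [iteratedDeriv_succ, hasDerivAt_deriv_iff]
        exact (hu i).differentiable_iteratedDeriv m (mod_cast ENat.natCast_lt_top m) s
      have key := abs_sub_sub_mul_le (hd k) (hd (k + 1)) (t := t) (h := h) (C := C)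
        (fun s hs => hC i s (by
          rcases le_total t (t + h) with hts | hts
          · rw [uIcc_of_le hts] at hs; exact ⟨by linarith [hs.1], by linarith [hs.2]⟩
          · rw [uIcc_of_ge hts] at hs; exact ⟨by linarith [hs.1], by linarith [hs.2]⟩))
      rw [Real.norm_of_nonneg (sq_nonneg h)]
      exact key.trans (mul_le_mul_of_nonneg_right (le_max_left _ _) (sq_nonneg h))
    · simpa using Asymptotics.isLittleO_pow_id (𝕜 := ℝ) (n := 2) (by norm_num)
  · simp

/-- A bounded family of smooth maps is a smooth map into a space of bounded families. -/
theorem SmoothBounded.exists_smooth_lp {U : Set E} {B : Set (E → F)} (hB : SmoothBounded U B)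
    (hsm : ∀ f ∈ B, CSmoothOn f U) {p : Seminorm ℝ F} (hp : Continuous p) {I : Type*}
    (f : I → E → F) (hf : ∀ i, f i ∈ B) (l : I → F →L[ℝ] ℝ) (hl : ∀ i y, |l i y| ≤ p y) :
    ∃ ev : E → lp (fun _ : I => ℝ) ⊤, CSmoothOn ev U ∧ ∀ x ∈ U, ∀ i, ev x i = l i (f i x) := by
  have hcurve : ∀ c : ℝ → E, SmoothCurve c → (∀ t, c t ∈ U) →
      ∃ d : ℝ → lp (fun _ : I => ℝ) ⊤, SmoothCurve d ∧ ∀ t i, d t i = l i (f i (c t)) := by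
    intro c hc hcU
    have hfc := fun i => hsm _ (hf i) c hc hcU
    refine smoothCurve_lp (fun i => (hfc i).contDiff_map (l i)) fun k K hK => ?_
    obtain ⟨C, hC⟩ := isVonNBounded_iff_forall_seminorm.1 (hB c hc hcU k K hK) p hp
    refine ⟨C, fun i t ht => ?_⟩
    rw [← iterate_velocity_eq_iteratedDeriv ((hfc i).contDiff_map (l i)),
      (hfc i).iterate_velocity_map]
    exact (hl i _).trans (hC _ ⟨f i, hf i, t, ht, rfl⟩)
  have hpt : ∀ x, ∃ y : lp (fun _ : I => ℝ) ⊤, x ∈ U → ∀ i, y i = l i (f i x) := by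
    intro x
    by_cases hx : x ∈ U
    · obtain ⟨d, -, hd⟩ := hcurve (fun _ => x) (smoothCurve_const x) fun _ => hx
      exact ⟨d 0, fun _ => hd 0⟩
    · exact ⟨0, fun h => absurd h hx⟩
  choose ev hev using hpt
  refine ⟨ev, fun c hc hcU => ?_, hev⟩
  obtain ⟨d, hd, hdi⟩ := hcurve c hc hcU
  have : (fun t => ev (c t)) = d := by
    funext t
    ext i
    rw [hev _ (hcU t), hdi]
  rwa [this]

theorem exists_bound_iterate_velocity_dirDeriv {U : Set E} (hU : CInftyOpen U) {f : E → G}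
    (hf : CSmoothOn f U) {B : Set (E → E)} (hB : SmoothBounded U B) (hsm : ∀ X ∈ B, CSmoothOn X U)
    {c : ℝ → E} (hc : SmoothCurve c) (hcU : ∀ t, c t ∈ U) (n : ℕ) {K : Set ℝ} (hK : IsCompact K) :
    ∃ C, ∀ X ∈ B, ∀ t ∈ K, ‖velocity^[n] (fun s => dirDeriv f (c s) (X (c s))) t‖ ≤ C := by
  have hΨ : CSmoothOn (fun z : ℝ × E => dirDeriv f (c z.1) z.2) univ := by
    intro a ha _
    exact hf.dirDeriv hU (fun t => (c (a t).1, (a t).2)) ((hc.comp ha.fst).prodMk ha.snd)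
      fun t => ⟨hcU _, mem_univ _⟩
  have hlin : ∀ t : ℝ, IsLinearMap ℝ fun v => dirDeriv f (c t) v :=
    fun t => hf.isLinearMap_dirDeriv hU (hcU t)
  have hsm' : ∀ ξ ∈ {ξ : ℝ → E | ∃ X ∈ B, ξ = fun t => X (c t)}, SmoothCurve ξ := by
    rintro _ ⟨X, hX, rfl⟩
    exact hsm X hX c hc hcU
  have hbd : ∀ (k : ℕ) (K : Set ℝ), IsCompact K → ∀ l : E →L[ℝ] ℝ, ∃ C,
      ∀ ξ ∈ {ξ : ℝ → E | ∃ X ∈ B, ξ = fun t => X (c t)}, ∀ t ∈ K, |l (velocity^[k] ξ t)| ≤ C := by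
    intro k K hK l
    obtain ⟨C, hC⟩ := exists_bound_dual (hB c hc hcU k K hK) l
    exact ⟨C, by rintro _ ⟨X, hX, rfl⟩ t ht; exact hC _ ⟨X, hX, t, ht, rfl⟩⟩
  obtain ⟨C, hC⟩ := exists_bound_iterate_velocity hΨ hlin hsm' hbd n hK
  exact ⟨C, fun X hX t ht => hC _ ⟨X, hX, rfl⟩ t ht⟩

/-- Continuous linear maps commute with all the derivatives involved. This transfers an estimate for
the $\ell^\infty$-valued map back to each member of the family. -/
theorem map_iterate_velocity_dirDeriv_eq {U : Set E} (hU : CInftyOpen U) {f : E → F}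
    (hf : CSmoothOn f U) {g : E → G} (hg : CSmoothOn g U) {X : E → E} (hX : CSmoothOn X U)
    (l : F →L[ℝ] ℝ) (e : G →L[ℝ] ℝ) (h : ∀ x ∈ U, e (g x) = l (f x)) {c : ℝ → E}
    (hc : SmoothCurve c) (hcU : ∀ t, c t ∈ U) (n : ℕ) (t : ℝ) :
    e (velocity^[n] (fun s => dirDeriv g (c s) (X (c s))) t) =
      l (velocity^[n] (fun s => dirDeriv f (c s) (X (c s))) t) := by
  have h1 := congrFun ((hf.dirDeriv_apply hU hX c hc hcU).iterate_velocity_map l n) t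
  have h2 := congrFun ((hg.dirDeriv_apply hU hX c hc hcU).iterate_velocity_map e n) t
  have h3 : (fun s => e (dirDeriv g (c s) (X (c s)))) =
      fun s => l (dirDeriv f (c s) (X (c s))) := by
    funext s
    rw [← dirDeriv_map l hU hf (hcU s), ← dirDeriv_map e hU hg (hcU s)]
    exact dirDeriv_congr hU h (hcU s) _
  rw [← h1, ← h2, h3]

/-- Differentiation in the direction of vector fields is bounded. -/
theorem SmoothBounded.dirDeriv {U : Set E} (hU : CInftyOpen U) {B : Set (E → F)} {B' : Set (E → E)}
    (hB : SmoothBounded U B) (hB' : SmoothBounded U B') (hsm : ∀ f ∈ B, CSmoothOn f U)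
    (hsm' : ∀ X ∈ B', CSmoothOn X U) :
    SmoothBounded U {h | ∃ f ∈ B, ∃ X ∈ B', h = fun x => dirDeriv f x (X x)} := by
  intro c hc hcU n K hK
  refine isVonNBounded_iff_forall_seminorm.2 fun p hp => ?_
  -- Indexing by a map together with a functional dominated by `p` lets a single smooth map control
  -- `p` of every member. The norming functional below selects the relevant coordinate.
  obtain ⟨ev, hev, hevi⟩ := hB.exists_smooth_lp hsm hp
    (I := B × {l : F →L[ℝ] ℝ // ∀ y, |l y| ≤ p y}) (fun i => i.1.1) (fun i => i.1.2)
    (fun i => i.2.1) (fun i => i.2.2)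
  obtain ⟨C, hC⟩ := exists_bound_iterate_velocity_dirDeriv hU hev hB' hsm' hc hcU n hK
  refine ⟨C, ?_⟩
  rintro _ ⟨_, ⟨f, hf, X, hX, rfl⟩, t, ht, rfl⟩
  obtain ⟨l, hl, hlp⟩ := exists_dual_eq_seminorm p hp
    (velocity^[n] (fun s => _root_.dirDeriv f (c s) (X (c s))) t)
  let i : B × {l : F →L[ℝ] ℝ // ∀ y, |l y| ≤ p y} := (⟨f, hf⟩, ⟨l, hlp⟩)
  rw [← hl, ← map_iterate_velocity_dirDeriv_eq hU (hsm f hf) hev (hsm' X hX) l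
    (lp.evalCLM ℝ (fun _ => ℝ) ⊤ i) (fun x hx => hevi x hx i) hc hcU n t]
  exact (le_abs_self _).trans ((lp.norm_apply_le_norm (by simp) _ _).trans (hC X hX t ht))

theorem SmoothBounded.sub {U : Set E} {B B' : Set (E → F)}
    (hB : SmoothBounded U B) (hB' : SmoothBounded U B') (hsm : ∀ f ∈ B, CSmoothOn f U)
    (hsm' : ∀ f ∈ B', CSmoothOn f U) :
    SmoothBounded U {h | ∃ f ∈ B, ∃ g ∈ B', h = fun x => f x - g x} := by
  intro c hc hcU n K hK
  refine isVonNBounded_iff_forall_seminorm.2 fun p hp => ?_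
  obtain ⟨C, hC⟩ := isVonNBounded_iff_forall_seminorm.1 (hB c hc hcU n K hK) p hp
  obtain ⟨D, hD⟩ := isVonNBounded_iff_forall_seminorm.1 (hB' c hc hcU n K hK) p hp
  refine ⟨C + D, ?_⟩
  rintro _ ⟨_, ⟨f, hf, g, hg, rfl⟩, t, ht, rfl⟩
  rw [(hsm f hf c hc hcU).iterate_velocity_sub (hsm' g hg c hc hcU)]
  exact (map_sub_le_add p _ _).trans
    (add_le_add (hC _ ⟨f, hf, t, ht, rfl⟩) (hD _ ⟨g, hg, t, ht, rfl⟩))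

theorem SmoothBounded.of_eqOn {U : Set E} {B B' : Set (E → F)} (hB : SmoothBounded U B)
    (h : ∀ f ∈ B', ∃ g ∈ B, EqOn f g U) : SmoothBounded U B' := by
  intro c hc hcU n K hK
  refine (hB c hc hcU n K hK).subset ?_
  rintro _ ⟨f, hf, t, ht, rfl⟩
  obtain ⟨g, hg, hfg⟩ := h f hf
  exact ⟨g, hg, t, ht, by rw [show (fun s => f (c s)) = fun s => g (c s) from
    funext fun s => hfg (hcU s)]⟩

end BoundedSets

end ConvenientCalculus

/-! ### Closed two-forms and invariant fields in a chart -/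

section LocalForms

variable {E : Type*} [AddCommGroup E] [Module ℝ E] [TopologicalSpace E] [ConvenientSpace E]

/-- A smooth closed alternating form of degree two on an open set. -/
structure IsClosedFormOn (P : E → E → E → ℝ) (U : Set E) : Prop where
  smooth : CSmoothOn (fun z : E × E × E => P z.1 z.2.1 z.2.2) (U ×ˢ univ)
  linear_left : ∀ x ∈ U, ∀ w, IsLinearMap ℝ fun v => P x v w
  linear_right : ∀ x ∈ U, ∀ v, IsLinearMap ℝ (P x v)
  antisymm : ∀ x ∈ U, ∀ v w, P x v w = -P x w v
  closed : ∀ x ∈ U, ∀ u v w, dirDeriv (fun y => P y v w) x u - dirDeriv (fun y => P y u w) x v +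
    dirDeriv (fun y => P y u v) x w = 0

namespace IsClosedFormOn

variable {P : E → E → E → ℝ} {U : Set E}

theorem cSmoothOn_apply (hP : IsClosedFormOn P U) {X Y : E → E} (hX : CSmoothOn X U)
    (hY : CSmoothOn Y U) : CSmoothOn (fun y => P y (X y) (Y y)) U :=
  fun c hc hcU => hP.smooth (fun t => (c t, X (c t), Y (c t)))
    (hc.prodMk ((hX c hc hcU).prodMk (hY c hc hcU))) fun t => ⟨hcU t, mem_univ _⟩

theorem dirDeriv_antisymm (hP : IsClosedFormOn P U) (hU : CInftyOpen U) {x : E} (hx : x ∈ U)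
    (u v w : E) : dirDeriv (fun y => P y v w) x u = -dirDeriv (fun y => P y w v) x u := by
  have hs : CSmoothOn (fun y => P y w v) U :=
    hP.cSmoothOn_apply (cSmoothOn_const w U) (cSmoothOn_const v U)
  rw [dirDeriv_congr hU (g := fun y => (-1 : ℝ) • P y w v)
    (fun y hy => by simpa using hP.antisymm y hy v w) hx u,
    dirDeriv_fun_const_smul hU hs hx]
  simp

theorem dirDeriv_apply (hP : IsClosedFormOn P U) (hU : CInftyOpen U) {X Y : E → E}
    (hX : CSmoothOn X U) (hY : CSmoothOn Y U) {x : E} (hx : x ∈ U) (v : E) :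
    dirDeriv (fun y => P y (X y) (Y y)) x v = dirDeriv (fun y => P y (X x) (Y x)) x v +
      P x (dirDeriv X x v) (Y x) + P x (X x) (dirDeriv Y x v) :=
  dirDeriv_bilinear hU hP.smooth (fun x hx b => hP.linear_left x hx b)
    (fun x hx a => hP.linear_right x hx a) hX hY hx v

theorem dirDeriv_contract (hP : IsClosedFormOn P U) (hU : CInftyOpen U) {X : E → E}
    (hX : CSmoothOn X U) {x : E} (hx : x ∈ U) (v w : E) :
    dirDeriv (fun y => P y (X y) w) x v = dirDeriv (fun y => P y (X x) w) x v +
      P x (dirDeriv X x v) w := by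
  rw [hP.dirDeriv_apply hU hX (cSmoothOn_const w U) hx, dirDeriv_const,
    (hP.linear_right x hx _).map_zero, add_zero]

/-- Cartan's formula for closed forms. -/
theorem exterior_contract_eq (hP : IsClosedFormOn P U) (hU : CInftyOpen U) {X : E → E}
    (hX : CSmoothOn X U) {x : E} (hx : x ∈ U) (v w : E) :
    dirDeriv (fun y => P y (X y) w) x v - dirDeriv (fun y => P y (X y) v) x w =
      dirDeriv (fun y => P y v w) x (X x) + P x (dirDeriv X x v) w + P x v (dirDeriv X x w) := by
  rw [hP.dirDeriv_contract hU hX hx, hP.dirDeriv_contract hU hX hx,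
    hP.antisymm x hx v (dirDeriv X x w)]
  linarith [hP.closed x hx (X x) v w]

variable {X Y Z : E → E}

/-- The product rule gives $dP(w)(Y,X)+P(dY.w,X)+P(Y,dX.w)$. Closedness trades the first term for
derivatives along $X$ and $Y$, and the two invariance equations convert these into the bracket; the
terms with $dX.w$ and $dY.w$ cancel. -/
theorem dirDeriv_apply_of_invariant (hP : IsClosedFormOn P U) (hU : CInftyOpen U)
    (hX : CSmoothOn X U) (hY : CSmoothOn Y U) {x : E} (hx : x ∈ U)
    (hXP : ∀ v w, dirDeriv (fun y => P y v w) x (X x) + P x (dirDeriv X x v) w +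
      P x v (dirDeriv X x w) = 0)
    (hYP : ∀ v w, dirDeriv (fun y => P y v w) x (Y x) + P x (dirDeriv Y x v) w +
      P x v (dirDeriv Y x w) = 0) (w : E) :
    dirDeriv (fun y => P y (Y y) (X y)) x w =
      P x (dirDeriv Y x (X x) - dirDeriv X x (Y x)) w := by
  rw [hP.dirDeriv_apply hU hY hX hx, (hP.linear_left x hx w).map_sub]
  have h1 := hXP (Y x) w
  have h2 := hYP (X x) w
  have h3 := hP.closed x hx (X x) (Y x) w
  have h4 := hP.dirDeriv_antisymm hU hx w (Y x) (X x)
  have h5 := hP.antisymm x hx (dirDeriv Y x w) (X x)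
  linarith

/-- In the sum of the three invariance equations, taken cyclically, the derivatives of $P$ cancel by
closedness and the remaining six terms pair up into brackets. -/
theorem cyclic_sum_eq_zero (hP : IsClosedFormOn P U) (hU : CInftyOpen U) {x : E} (hx : x ∈ U)
    (hXP : ∀ v w, dirDeriv (fun y => P y v w) x (X x) + P x (dirDeriv X x v) w +
      P x v (dirDeriv X x w) = 0)
    (hYP : ∀ v w, dirDeriv (fun y => P y v w) x (Y x) + P x (dirDeriv Y x v) w +
      P x v (dirDeriv Y x w) = 0)
    (hZP : ∀ v w, dirDeriv (fun y => P y v w) x (Z x) + P x (dirDeriv Z x v) w +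
      P x v (dirDeriv Z x w) = 0) :
    P x (dirDeriv Z x (Y x) - dirDeriv Y x (Z x)) (X x) +
      P x (dirDeriv X x (Z x) - dirDeriv Z x (X x)) (Y x) +
      P x (dirDeriv Y x (X x) - dirDeriv X x (Y x)) (Z x) = 0 := by
  simp only [(hP.linear_left x hx _).map_sub]
  have h1 := hXP (Y x) (Z x)
  have h2 := hYP (Z x) (X x)
  have h3 := hZP (X x) (Y x)
  have h4 := hP.closed x hx (X x) (Y x) (Z x)
  have h5 := hP.dirDeriv_antisymm hU hx (Y x) (X x) (Z x)
  have a1 := hP.antisymm x hx (Y x) (dirDeriv X x (Z x))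
  have a2 := hP.antisymm x hx (Z x) (dirDeriv Y x (X x))
  have a3 := hP.antisymm x hx (X x) (dirDeriv Z x (Y x))
  linarith

end IsClosedFormOn

end LocalForms

/-! ### Coordinates, functions and symplectic fields on the manifold -/

namespace ConvenientManifold

variable {ι : Type*} {E : ι → Type*} [∀ i, AddCommGroup (E i)]
  [∀ i, Module ℝ (E i)] [∀ i, TopologicalSpace (E i)] [∀ i, ConvenientSpace (E i)]
  {M : Type*} (A : ConvenientManifold E M)

/-- The domain of the chart change from `i` to `j`. -/
abbrev overlap (i j : ι) : Set (E i) :=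
  (A.chart i).target ∩ (A.chart i).symm ⁻¹' (A.chart j).source

/-- The chart change from `i` to `j`. -/
abbrev change (i j : ι) (x : E i) : E j := A.chart j ((A.chart i).symm x)

theorem mem_source_index (p : M) : p ∈ (A.chart (A.index p)).source :=
  (A.exists_mem_source p).choose_spec

variable {A}

theorem chart_mem_overlap {i j : ι} {p : M} (hi : p ∈ (A.chart i).source)
    (hj : p ∈ (A.chart j).source) : A.chart i p ∈ A.overlap i j :=
  ⟨(A.chart i).map_source hi, by rwa [mem_preimage, (A.chart i).left_inv hi]⟩

/-- The chain rule for the composite of a chart change and its inverse, which is the identity on the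
overlap. It makes `toCoord` and `ofCoord` mutually inverse. -/
theorem dirDeriv_change_change {i j : ι} {p : M} (hi : p ∈ (A.chart i).source)
    (hj : p ∈ (A.chart j).source) (v : E i) :
    dirDeriv (A.change j i) (A.chart j p) (dirDeriv (A.change i j) (A.chart i p) v) = v := by
  have hx := chart_mem_overlap hi hj
  have h := (A.smooth_change i j).dirDeriv_comp_eq (A.isOpen_overlap i j) (A.isOpen_overlap j i)
    (A.smooth_change j i) hx
    (by simpa only [(A.chart i).left_inv hi] using chart_mem_overlap hj hi) v
  simp only [(A.chart i).left_inv hi] at h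
  rw [← h, dirDeriv_congr (A.isOpen_overlap i j) (g := fun x => x) (fun x hx => ?_) hx, dirDeriv_id]
  dsimp only
  rw [(A.chart j).left_inv hx.2, (A.chart i).right_inv hx.1]

section ChartCoordinates

variable {i : ι} {p : M} (hp : p ∈ (A.chart i).source)
include hp

theorem isLinearMap_toCoord : IsLinearMap ℝ (A.toCoord (A.chart i) p) :=
  (A.smooth_change (A.index p) i).isLinearMap_dirDeriv (A.isOpen_overlap _ _)
    (chart_mem_overlap (A.mem_source_index p) hp)

theorem isLinearMap_ofCoord : IsLinearMap ℝ (A.ofCoord (A.chart i) p) :=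
  (A.smooth_change i (A.index p)).isLinearMap_dirDeriv (A.isOpen_overlap _ _)
    (chart_mem_overlap hp (A.mem_source_index p))

theorem ofCoord_toCoord (v : A.TangentSpace p) :
    A.ofCoord (A.chart i) p (A.toCoord (A.chart i) p v) = v :=
  dirDeriv_change_change (A.mem_source_index p) hp v

theorem toCoord_ofCoord (v : E i) : A.toCoord (A.chart i) p (A.ofCoord (A.chart i) p v) = v :=
  dirDeriv_change_change hp (A.mem_source_index p) v

theorem rep_chart (X : A.Section) :
    A.rep (A.chart i) X (A.chart i p) = A.toCoord (A.chart i) p (X p) := by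
  unfold rep
  rw [(A.chart i).left_inv hp]

/-- The differential in a chart. -/
theorem differential_eq {f : M → ℝ} (hf : A.SmoothFunction f) (v : A.TangentSpace p) :
    A.differential f p v = dirDeriv (fun x => f ((A.chart i).symm x)) (A.chart i p)
      (A.toCoord (A.chart i) p v) := by
  have hq := A.mem_source_index p
  have hx := chart_mem_overlap hq hp
  have h := (A.smooth_change (A.index p) i).dirDeriv_comp_eq (A.isOpen_overlap _ _)
    (A.isOpen_target i) (hf i) hx ((A.chart i).map_source hx.2) v
  simp only [(A.chart (A.index p)).left_inv hq] at h
  refine Eq.trans ?_ h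
  refine dirDeriv_congr (A.isOpen_overlap _ _) (fun x hx => ?_) hx v
  simp only [(A.chart i).left_inv hx.2]
  rfl

end ChartCoordinates

theorem toCoord_chartAt (p : M) (v : A.TangentSpace p) : A.toCoord (A.chartAt p) p v = v := by
  have hq := A.mem_source_index p
  refine (dirDeriv_congr (A.isOpen_target (A.index p)) (g := fun x => x) (fun x hx => ?_)
    ((A.chart (A.index p)).map_source hq) v).trans (dirDeriv_id _ _)
  exact (A.chart (A.index p)).right_inv hx

theorem ofCoord_chartAt (p : M) (v : A.TangentSpace p) : A.ofCoord (A.chartAt p) p v = v :=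
  toCoord_chartAt p v

theorem rep_chartAt (X : A.Section) (p : M) : A.rep (A.chartAt p) X (A.chartAt p p) = X p :=
  (rep_chart (A.mem_source_index p) X).trans (toCoord_chartAt p _)

theorem ofCoord_rep {i : ι} {x : E i} (hx : x ∈ (A.chart i).target) (X : A.Section) :
    A.ofCoord (A.chart i) ((A.chart i).symm x) (A.rep (A.chart i) X x) =
      X ((A.chart i).symm x) :=
  ofCoord_toCoord ((A.chart i).map_target hx) _

theorem rep₁_differential {f : M → ℝ} (hf : A.SmoothFunction f) {i : ι} {x : E i}
    (hx : x ∈ (A.chart i).target) (v : E i) :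
    A.rep₁ (A.chart i) (A.differential f) x v = dirDeriv (fun x => f ((A.chart i).symm x)) x v := by
  have hp := (A.chart i).map_target hx
  rw [rep₁, differential_eq hp hf, toCoord_ofCoord hp, (A.chart i).right_inv hx]

/-! ### Vector fields -/

theorem rep_add {i : ι} {x : E i} (hx : x ∈ (A.chart i).target) (X Y : A.Section) :
    A.rep (A.chart i) (X + Y) x = A.rep (A.chart i) X x + A.rep (A.chart i) Y x :=
  (isLinearMap_toCoord ((A.chart i).map_target hx)).map_add _ _

theorem rep_smul {i : ι} {x : E i} (hx : x ∈ (A.chart i).target) (f : M → ℝ) (X : A.Section) :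
    A.rep (A.chart i) (fun p => f p • X p) x =
      f ((A.chart i).symm x) • A.rep (A.chart i) X x :=
  (isLinearMap_toCoord ((A.chart i).map_target hx)).map_smul _ _

theorem SmoothField.add {X Y : A.Section} (hX : A.SmoothField X) (hY : A.SmoothField Y) :
    A.SmoothField (X + Y) := fun i => ((hX i).add (hY i)).congr fun _ hx => rep_add hx X Y

theorem SmoothField.smul {f : M → ℝ} {X : A.Section} (hf : A.SmoothFunction f)
    (hX : A.SmoothField X) : A.SmoothField fun p => f p • X p :=
  fun i => ((hf i).smul (hX i)).congr fun _ hx => rep_smul hx f X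

theorem smoothFunction_const (a : ℝ) : A.SmoothFunction fun _ => a :=
  fun _ => cSmoothOn_const a _

theorem SmoothField.const_smul (a : ℝ) {X : A.Section} (hX : A.SmoothField X) :
    A.SmoothField (a • X) := SmoothField.smul (smoothFunction_const a) hX

theorem smoothField_zero : A.SmoothField 0 := fun i =>
  (cSmoothOn_const 0 _).congr fun _ hx =>
    (isLinearMap_toCoord ((A.chart i).map_target hx)).map_zero

/-! ### Functions -/

theorem SmoothFunction.add {f g : M → ℝ} (hf : A.SmoothFunction f) (hg : A.SmoothFunction g) :
    A.SmoothFunction (f + g) := fun i => (hf i).add (hg i)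

theorem SmoothFunction.mul {f g : M → ℝ} (hf : A.SmoothFunction f) (hg : A.SmoothFunction g) :
    A.SmoothFunction (f * g) := fun i => (hf i).mul (hg i)

theorem SmoothFunction.const_smul (a : ℝ) {f : M → ℝ} (hf : A.SmoothFunction f) :
    A.SmoothFunction (a • f) := (smoothFunction_const a).mul hf

theorem chart_index_mem (p : M) :
    A.chart (A.index p) p ∈ (A.chart (A.index p)).target :=
  (A.chart (A.index p)).map_source (A.mem_source_index p)

theorem differential_add {f g : M → ℝ} (hf : A.SmoothFunction f) (hg : A.SmoothFunction g) :
    A.differential (f + g) = A.differential f + A.differential g :=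
  funext fun p => funext fun v => dirDeriv_fun_add (A.isOpen_target (A.index p))
    (hf (A.index p)) (hg (A.index p)) (chart_index_mem p) v

theorem differential_const_smul (a : ℝ) {f : M → ℝ} (hf : A.SmoothFunction f) :
    A.differential (a • f) = a • A.differential f :=
  funext fun p => funext fun v => dirDeriv_fun_const_smul (A.isOpen_target (A.index p))
    (hf (A.index p)) (chart_index_mem p) a v

theorem differential_mul {f g : M → ℝ} (hf : A.SmoothFunction f) (hg : A.SmoothFunction g)
    (p : M) (v : A.TangentSpace p) : A.differential (f * g) p v =
      A.differential f p v * g p + f p * A.differential g p v := by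
  have h := dirDeriv_fun_mul (A.isOpen_target (A.index p)) (chart_index_mem p)
    (hf (A.index p)) (hg (A.index p)) v
  simp only [(A.chart (A.index p)).left_inv (A.mem_source_index p)] at h
  exact h

theorem differential_const (a : ℝ) : A.differential (fun _ => a) = 0 :=
  funext fun _ => funext fun _ => dirDeriv_const _ _ _

theorem isLinearMap_differential {f : M → ℝ} (hf : A.SmoothFunction f) (p : M) :
    IsLinearMap ℝ (A.differential f p) :=
  (hf (A.index p)).isLinearMap_dirDeriv (A.isOpen_target _) (chart_index_mem p)

/-- Exact forms are closed. -/
theorem closedOneForm_differential {f : M → ℝ} (hf : A.SmoothFunction f) :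
    A.ClosedOneForm (A.differential f) := by
  refine ⟨⟨isLinearMap_differential hf, fun i => ?_⟩, fun i x hx v w => ?_⟩
  · exact ((hf i).dirDeriv (A.isOpen_target i)).congr fun z hz => rep₁_differential hf hz.1 z.2
  · rw [dirDeriv_congr (A.isOpen_target i) (fun y hy => rep₁_differential hf hy w) hx,
      dirDeriv_congr (A.isOpen_target i) (fun y hy => rep₁_differential hf hy v) hx,
      (hf i).dirDeriv_dirDeriv_comm (A.isOpen_target i) hx, sub_self]

/-! ### Locally constant functions -/

/-- Connectedness of the line: a locally constant function along a curve is constant. -/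
theorem eq_of_isOpen_preimage {q : ℝ → ℝ} (h : ∀ s : Set ℝ, IsOpen (q ⁻¹' s)) (t t' : ℝ) :
    q t = q t' :=
  IsLocallyConstant.apply_eq_of_isPreconnected (f := q) h isPreconnected_univ (mem_univ t)
    (mem_univ t')

theorem isOpen_preimage_of_mem_H0 {f : M → ℝ} (hf : f ∈ A.H0) {i : ι} {c : ℝ → E i}
    (hc : SmoothCurve c) (hcU : ∀ t, c t ∈ (A.chart i).target) (s : Set ℝ) :
    IsOpen ((fun t => f ((A.chart i).symm (c t))) ⁻¹' s) := by
  have h := hf s i c hc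
  convert h using 1
  ext t
  simp [hcU t]

theorem smoothFunction_of_mem_H0 {f : M → ℝ} (hf : f ∈ A.H0) : A.SmoothFunction f := by
  intro i c hc hcU
  have : (fun t => f ((A.chart i).symm (c t))) = fun _ => f ((A.chart i).symm (c 0)) :=
    funext fun t => eq_of_isOpen_preimage (isOpen_preimage_of_mem_H0 hf hc hcU) t 0
  rw [this]
  exact smoothCurve_const _

theorem differential_of_mem_H0 {f : M → ℝ} (hf : f ∈ A.H0) : A.differential f = 0 := by
  funext p v
  have hx : A.chart (A.index p) p ∈ (A.chart (A.index p)).target ∩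
      (A.chart (A.index p)).symm ⁻¹' (f ⁻¹' {f p}) :=
    ⟨chart_index_mem p, by simp [(A.chart (A.index p)).left_inv (A.mem_source_index p)]⟩
  exact (dirDeriv_congr (hf {f p} (A.index p)) (g := fun _ => f p) (fun y hy => hy.2) hx v).trans
    (dirDeriv_const _ _ _)

/-- The natural topology is tested along smooth curves in charts. There the derivative of $f$
vanishes by the chain rule, so $f$ is constant on intervals. -/
theorem mem_H0_of_differential {f : M → ℝ} (hf : A.SmoothFunction f)
    (hd : A.differential f = 0) : f ∈ A.H0 := by
  intro s i c hc
  have hU := A.isOpen_target i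
  rw [isOpen_iff_mem_nhds]
  rintro t ⟨ht, hts⟩
  obtain ⟨ε, hε, hball⟩ := Metric.isOpen_iff.1 (hU c hc) t ht
  have hconst : ∀ r ∈ Metric.ball t ε,
      f ((A.chart i).symm (c r)) = f ((A.chart i).symm (c t)) := by
    intro r hr
    have hder : ∀ u ∈ Metric.ball t ε, HasDerivAt (fun t => f ((A.chart i).symm (c t))) 0 u := by
      intro u hu
      have h1 := hasVelocity_iff_hasDerivAt.1 ((hf i).hasVelocity_comp hU hc (hball hu))
      rwa [← rep₁_differential hf (hball hu), rep₁, hd] at h1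
    have h2 := (convex_ball t ε).norm_image_sub_le_of_norm_hasDerivWithin_le (C := 0)
      (fun u hu => (hder u hu).hasDerivWithinAt) (fun u _ => by simp) (Metric.mem_ball_self hε) hr
    simpa [sub_eq_zero] using h2
  filter_upwards [Metric.ball_mem_nhds t hε] with r hr
  refine ⟨hball hr, ?_⟩
  rw [mem_preimage, mem_preimage, hconst r hr]
  exact hts

/-! ### Symplectic vector fields -/

namespace BilinSection

variable {ω : A.BilinSection}

theorem rep₂_rep {i : ι} {x : E i} (hx : x ∈ (A.chart i).target) (X Y : A.Section) :
    ω.rep₂ (A.chart i) x (A.rep (A.chart i) X x) (A.rep (A.chart i) Y x) =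
      ω ((A.chart i).symm x) (X ((A.chart i).symm x)) (Y ((A.chart i).symm x)) := by
  rw [rep₂, ofCoord_rep hx, ofCoord_rep hx]

theorem rep₁_contract {i : ι} {x : E i} (hx : x ∈ (A.chart i).target) (X : A.Section) (w : E i) :
    A.rep₁ (A.chart i) (ω.contract X) x w =
      ω.rep₂ (A.chart i) x (A.rep (A.chart i) X x) w := by
  rw [rep₁, contract, rep₂, ofCoord_rep hx]

theorem contract_add (X Y : A.Section) : ω.contract (X + Y) = ω.contract X + ω.contract Y :=
  funext fun p => funext fun v => by simp [contract]

theorem contract_const_smul (a : ℝ) (X : A.Section) : ω.contract (a • X) = a • ω.contract X :=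
  funext fun p => funext fun v => by simp [contract]

theorem contract_zero : ω.contract 0 = 0 :=
  funext fun p => funext fun v => by simp [contract]

namespace IsWeakSymplectic

variable (hω : ω.IsWeakSymplectic)
include hω

theorem contract_injective : Function.Injective ω.contract := fun _ _ h => funext fun p =>
  hω.injective p (LinearMap.ext fun v => congrFun (congrFun h p) v)

theorem isClosedFormOn (i : ι) : IsClosedFormOn (ω.rep₂ (A.chart i)) (A.chart i).target where
  smooth := hω.smooth.2 i
  linear_left _ hx _ := by
    have h := isLinearMap_ofCoord ((A.chart i).map_target hx)
    exact ⟨fun v v' => by simp [rep₂, h.map_add], fun a v => by simp [rep₂, h.map_smul]⟩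
  linear_right _ hx _ := by
    have h := isLinearMap_ofCoord ((A.chart i).map_target hx)
    exact ⟨fun v v' => by simp [rep₂, h.map_add], fun a v => by simp [rep₂, h.map_smul]⟩
  antisymm x hx v w := by rw [rep₂, rep₂, (hω.smooth.1 _).neg]
  closed := hω.closed i

/-- A smooth vector field is symplectic if and only if its contraction with the symplectic form is
closed. -/
theorem closedOneForm_contract_iff {X : A.Section} (hX : A.SmoothField X) :
    A.ClosedOneForm (ω.contract X) ↔ ω.SymplecticField X := by
  have hsm : A.SmoothOneForm (ω.contract X) := by
    refine ⟨fun p => (ω p (X p)).isLinear, fun i => ?_⟩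
    refine CSmoothOn.congr (f := fun z => ω.rep₂ (A.chart i) z.1 (A.rep (A.chart i) X z.1) z.2)
      (fun c hc hcU => ?_) fun z hz => rep₁_contract hz.1 X z.2
    exact (hω.isClosedFormOn i).smooth
      (fun t => ((c t).1, A.rep (A.chart i) X (c t).1, (c t).2))
      (hc.fst.prodMk ((hX i _ hc.fst fun t => (hcU t).1).prodMk hc.snd))
      fun t => ⟨(hcU t).1, mem_univ _⟩
  have key : ∀ i, ∀ x ∈ (A.chart i).target, ∀ v w : E i, _ := fun i x hx v w =>
    (hω.isClosedFormOn i).exterior_contract_eq (A.isOpen_target i) (hX i) hx v w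
  have hrep : ∀ i, ∀ x ∈ (A.chart i).target, ∀ v w : E i,
      dirDeriv (fun y => A.rep₁ (A.chart i) (ω.contract X) y w) x v =
        dirDeriv (fun y => ω.rep₂ (A.chart i) y (A.rep (A.chart i) X y) w) x v :=
    fun i x hx v w => dirDeriv_congr (A.isOpen_target i) (fun y hy => rep₁_contract hy X w) hx v
  constructor
  · rintro ⟨-, h⟩
    refine ⟨hX, fun i x hx v w => ?_⟩
    rw [← key i x hx v w, ← hrep i x hx v w, ← hrep i x hx w v]
    exact h i x hx v w
  · rintro ⟨-, h⟩
    refine ⟨hsm, fun i x hx v w => ?_⟩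
    rw [hrep i x hx v w, hrep i x hx w v, key i x hx v w]
    exact h i x hx v w

/-- The contraction is $df$, and $d(df)=0$ by symmetry of second derivatives; Cartan's formula does
the rest. -/
theorem symplecticField_of_isGradient {f : M → ℝ} {X : A.Section} (hf : A.SmoothFunction f)
    (h : ω.IsGradient f X) : ω.SymplecticField X := by
  rw [← hω.closedOneForm_contract_iff h.1, ← h.2]
  exact closedOneForm_differential hf

theorem smoothFunction_apply {X Y : A.Section} (hX : A.SmoothField X) (hY : A.SmoothField Y) :
    A.SmoothFunction fun p => ω p (X p) (Y p) := fun i =>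
  ((hω.isClosedFormOn i).cSmoothOn_apply (hX i) (hY i)).congr fun _ hx => (rep₂_rep hx X Y).symm

section Bracket

variable {X Y Z : A.Section} (hX : ω.SymplecticField X) (hY : ω.SymplecticField Y)
include hX hY

/-- The left side does not mention the chart, so this formula in an arbitrary chart serves to
compare brackets computed in different charts. -/
theorem differential_apply_eq {i : ι} {p : M} (hp : p ∈ (A.chart i).source)
    (v : A.TangentSpace p) : A.differential (fun p => ω p (Y p) (X p)) p v =
      ω p (A.ofCoord (A.chart i) p
        (dirDeriv (A.rep (A.chart i) Y) (A.chart i p) (A.rep (A.chart i) X (A.chart i p)) -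
          dirDeriv (A.rep (A.chart i) X) (A.chart i p) (A.rep (A.chart i) Y (A.chart i p)))) v := by
  have hx := (A.chart i).map_source hp
  rw [differential_eq hp (hω.smoothFunction_apply hY.1 hX.1),
    dirDeriv_congr (A.isOpen_target i) (fun y hy => (rep₂_rep hy Y X).symm) hx,
    (hω.isClosedFormOn i).dirDeriv_apply_of_invariant (A.isOpen_target i) (hX.1 i) (hY.1 i) hx
      (hX.2 i _ hx) (hY.2 i _ hx), rep₂, (A.chart i).left_inv hp, ofCoord_toCoord hp]

theorem differential_apply :
    A.differential (fun p => ω p (Y p) (X p)) = ω.contract (A.lieBracket X Y) := by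
  funext p v
  rw [hω.differential_apply_eq hX hY (A.mem_source_index p) v]
  have e := ofCoord_chartAt (A := A) p (dirDeriv (A.rep (A.chartAt p) Y) (A.chartAt p p)
    (A.rep (A.chartAt p) X (A.chartAt p p)) - dirDeriv (A.rep (A.chartAt p) X) (A.chartAt p p)
    (A.rep (A.chartAt p) Y (A.chartAt p p)))
  rw [rep_chartAt, rep_chartAt] at e
  have e1 := rep_chartAt X p
  have e2 := rep_chartAt Y p
  unfold chartAt at e e1 e2
  rw [e1, e2, e]
  rfl

/-- The Lie bracket of symplectic vector fields in a chart. -/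
theorem rep_lieBracket {i : ι} {x : E i} (hx : x ∈ (A.chart i).target) :
    A.rep (A.chart i) (A.lieBracket X Y) x =
      dirDeriv (A.rep (A.chart i) Y) x (A.rep (A.chart i) X x) -
        dirDeriv (A.rep (A.chart i) X) x (A.rep (A.chart i) Y x) := by
  have hp := (A.chart i).map_target hx
  -- Both the bracket from the chosen chart and the one from chart `i` represent the same
  -- differential under $\omega$, so injectivity identifies them; no second derivative of a chart
  -- change has to be computed.
  have h : A.lieBracket X Y ((A.chart i).symm x) = _ := hω.injective _ (LinearMap.ext fun v =>
    (congrFun (congrFun (hω.differential_apply hX hY) _) v).symm.trans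
      (hω.differential_apply_eq hX hY hp v))
  rw [rep, h, toCoord_ofCoord hp, (A.chart i).right_inv hx]

theorem smoothField_lieBracket : A.SmoothField (A.lieBracket X Y) := fun i =>
  (((hY.1 i).dirDeriv_apply (A.isOpen_target i) (hX.1 i)).sub
    ((hX.1 i).dirDeriv_apply (A.isOpen_target i) (hY.1 i))).congr
    fun _ hx => hω.rep_lieBracket hX hY hx

theorem isGradient_lieBracket : ω.IsGradient (fun p => ω p (Y p) (X p)) (A.lieBracket X Y) :=
  ⟨hω.smoothField_lieBracket hX hY, hω.differential_apply hX hY⟩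

theorem omegaSmooth_apply : ω.OmegaSmooth fun p => ω p (Y p) (X p) :=
  ⟨hω.smoothFunction_apply hY.1 hX.1, _, hω.isGradient_lieBracket hX hY⟩

theorem symplecticField_lieBracket : ω.SymplecticField (A.lieBracket X Y) :=
  hω.symplecticField_of_isGradient (hω.smoothFunction_apply hY.1 hX.1)
    (hω.isGradient_lieBracket hX hY)

theorem cyclic_sum_eq_zero (hZ : ω.SymplecticField Z) (p : M) :
    ω p (A.lieBracket Y Z p) (X p) + ω p (A.lieBracket Z X p) (Y p) +
      ω p (A.lieBracket X Y p) (Z p) = 0 := by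
  have hx := chart_index_mem (A := A) p
  have h := (hω.isClosedFormOn (A.index p)).cyclic_sum_eq_zero (A.isOpen_target _) hx
    (hX.2 _ _ hx) (hY.2 _ _ hx) (hZ.2 _ _ hx)
  rw [← hω.rep_lieBracket hX hY hx, ← hω.rep_lieBracket hY hZ hx, ← hω.rep_lieBracket hZ hX hx,
    rep₂_rep hx, rep₂_rep hx, rep₂_rep hx,
    (A.chart (A.index p)).left_inv (A.mem_source_index p)] at h
  exact h

end Bracket

end IsWeakSymplectic

end BilinSection

end ConvenientManifold

/-! ### The Lie algebras, the exact sequence and boundedness -/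

namespace ConvenientManifold

variable {ι : Type*} {E : ι → Type*} [∀ i, AddCommGroup (E i)]
  [∀ i, Module ℝ (E i)] [∀ i, TopologicalSpace (E i)] [∀ i, ConvenientSpace (E i)]
  {M : Type*} {A : ConvenientManifold E M}

/-! ### Closed and exact forms -/

theorem SmoothOneForm.cSmoothOn_apply {φ : A.Cochain} (hφ : A.SmoothOneForm φ) (i : ι) (v : E i) :
    CSmoothOn (fun x => A.rep₁ (A.chart i) φ x v) (A.chart i).target := fun c hc hcU =>
  hφ.2 i (fun t => (c t, v)) (hc.prodMk (smoothCurve_const v)) fun t => ⟨hcU t, mem_univ _⟩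

theorem ClosedOneForm.add {φ ψ : A.Cochain} (hφ : A.ClosedOneForm φ) (hψ : A.ClosedOneForm ψ) :
    A.ClosedOneForm (φ + ψ) := by
  refine ⟨⟨fun p => ((hφ.1.1 p).mk' _ + (hψ.1.1 p).mk' _).isLinear,
    fun i => (hφ.1.2 i).add (hψ.1.2 i)⟩, fun i x hx v w => ?_⟩
  have h : ∀ v w, dirDeriv (fun y => A.rep₁ (A.chart i) (φ + ψ) y w) x v = _ := fun v w =>
    dirDeriv_fun_add (A.isOpen_target i) (hφ.1.cSmoothOn_apply i w) (hψ.1.cSmoothOn_apply i w) hx v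
  rw [h, h]
  linarith [hφ.2 i x hx v w, hψ.2 i x hx v w]

theorem ClosedOneForm.const_smul (a : ℝ) {φ : A.Cochain} (hφ : A.ClosedOneForm φ) :
    A.ClosedOneForm (a • φ) := by
  refine ⟨⟨fun p => (a • (hφ.1.1 p).mk' _).isLinear,
    fun i => (cSmoothOn_const a _).smul (hφ.1.2 i)⟩, fun i x hx v w => ?_⟩
  have h : ∀ v w, dirDeriv (fun y => A.rep₁ (A.chart i) (a • φ) y w) x v = _ := fun v w =>
    dirDeriv_fun_const_smul (A.isOpen_target i) (hφ.1.cSmoothOn_apply i w) hx a v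
  rw [h, h, ← smul_sub, hφ.2 i x hx v w, smul_zero]

theorem closedOneForm_zero : A.ClosedOneForm 0 := by
  rw [← differential_const 0]
  exact closedOneForm_differential (smoothFunction_const 0)

variable (A)

/-- The closed `1`-forms. -/
def closedForms : Submodule ℝ A.Cochain where
  carrier := {φ | A.ClosedOneForm φ}
  zero_mem' := closedOneForm_zero
  add_mem' := ClosedOneForm.add
  smul_mem' a _ := ClosedOneForm.const_smul a

/-- The exact `1`-forms. -/
def exactForms : Submodule ℝ A.Cochain where
  carrier := {φ | ∃ f, A.SmoothFunction f ∧ φ = A.differential f}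
  zero_mem' := ⟨fun _ => 0, smoothFunction_const 0, (differential_const 0).symm⟩
  add_mem' := by
    rintro _ _ ⟨f, hf, rfl⟩ ⟨g, hg, rfl⟩
    exact ⟨f + g, hf.add hg, (differential_add hf hg).symm⟩
  smul_mem' := by
    rintro a _ ⟨f, hf, rfl⟩
    exact ⟨a • f, hf.const_smul a, (differential_const_smul a hf).symm⟩

variable {A}

theorem exactForms_le_closedForms : A.exactForms ≤ A.closedForms := by
  rintro _ ⟨f, hf, rfl⟩
  exact closedOneForm_differential hf

theorem lieBracket_swap (X Y : A.Section) : A.lieBracket Y X = -A.lieBracket X Y :=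
  funext fun _ => (neg_sub _ _).symm

namespace BilinSection

variable {ω : A.BilinSection}

theorem IsGradient.add {f g : M → ℝ} {X Y : A.Section} (hf : A.SmoothFunction f)
    (hg : A.SmoothFunction g) (hX : ω.IsGradient f X) (hY : ω.IsGradient g Y) :
    ω.IsGradient (f + g) (X + Y) :=
  ⟨hX.1.add hY.1, by rw [differential_add hf hg, contract_add, hX.2, hY.2]⟩

theorem IsGradient.const_smul (a : ℝ) {f : M → ℝ} {X : A.Section} (hf : A.SmoothFunction f)
    (hX : ω.IsGradient f X) : ω.IsGradient (a • f) (a • X) :=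
  ⟨hX.1.const_smul a, by rw [differential_const_smul a hf, contract_const_smul, hX.2]⟩

theorem IsGradient.mul {f g : M → ℝ} {X Y : A.Section} (hf : A.SmoothFunction f)
    (hg : A.SmoothFunction g) (hX : ω.IsGradient f X) (hY : ω.IsGradient g Y) :
    ω.IsGradient (f * g) fun p => g p • X p + f p • Y p := by
  refine ⟨(SmoothField.smul hg hX.1).add (SmoothField.smul hf hY.1),
    funext fun p => funext fun v => ?_⟩
  rw [differential_mul hf hg, hX.2, hY.2]
  simp [contract, mul_comm]

theorem isGradient_const (a : ℝ) : ω.IsGradient (fun _ => a) 0 :=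
  ⟨smoothField_zero, by rw [differential_const, contract_zero]⟩

variable (ω) in
/-- The algebra `C^∞_ω(M, ℝ)`. -/
def omegaFunctions : Subalgebra ℝ (M → ℝ) where
  carrier := {f | ω.OmegaSmooth f}
  add_mem' := fun ⟨hf, _, hX⟩ ⟨hg, _, hY⟩ => ⟨hf.add hg, _, hX.add hf hg hY⟩
  mul_mem' := fun ⟨hf, _, hX⟩ ⟨hg, _, hY⟩ => ⟨hf.mul hg, _, hX.mul hf hg hY⟩
  algebraMap_mem' a := ⟨smoothFunction_const a, 0, isGradient_const a⟩

variable (ω) in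
/-- The closed `ω`-smooth `1`-forms. -/
def closedOmegaForms : Submodule ℝ A.Cochain where
  carrier := {φ | ω.ClosedOmegaForm φ}
  zero_mem' := ⟨closedOneForm_zero, 0, smoothField_zero, contract_zero.symm⟩
  add_mem' := by
    rintro _ _ ⟨h, X, hX, rfl⟩ ⟨h', Y, hY, rfl⟩
    exact ⟨h.add h', X + Y, hX.add hY, (contract_add X Y).symm⟩
  smul_mem' := by
    rintro a _ ⟨h, X, hX, rfl⟩
    exact ⟨h.const_smul a, a • X, hX.const_smul a, (contract_const_smul a X).symm⟩

variable (ω) in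
/-- The differentials of the functions in `C^∞_ω(M, ℝ)`. -/
def exactOmegaForms : Submodule ℝ A.Cochain where
  carrier := {φ | ∃ f, ω.OmegaSmooth f ∧ φ = A.differential f}
  zero_mem' := ⟨0, ω.omegaFunctions.zero_mem, (differential_const 0).symm⟩
  add_mem' := by
    rintro _ _ ⟨f, hf, rfl⟩ ⟨g, hg, rfl⟩
    exact ⟨f + g, ω.omegaFunctions.add_mem hf hg, (differential_add hf.1 hg.1).symm⟩
  smul_mem' := by
    rintro a _ ⟨f, hf, rfl⟩
    exact ⟨a • f, ω.omegaFunctions.smul_mem hf a, (differential_const_smul a hf.1).symm⟩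

theorem exactOmegaForms_le_closedOmegaForms : ω.exactOmegaForms ≤ ω.closedOmegaForms := by
  rintro _ ⟨f, ⟨hf, X, hX⟩, rfl⟩
  exact ⟨closedOneForm_differential hf, X, hX⟩

theorem closedOmegaForms_le_closedForms : ω.closedOmegaForms ≤ A.closedForms :=
  fun _ h => h.1

variable (ω) in
/-- The map `H^1_ω(M) → H^1(M)`. -/
def cohomologyMap : (ω.closedOmegaForms ⧸ ω.exactOmegaForms.submoduleOf ω.closedOmegaForms) →ₗ[ℝ]
    (A.closedForms ⧸ A.exactForms.submoduleOf A.closedForms) :=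
  Submodule.mapQ _ _ (Submodule.inclusion closedOmegaForms_le_closedForms)
    fun _ ⟨f, hf, h⟩ => ⟨f, hf.1, h⟩

/-- If $i_X\omega=df$ with $f$ merely smooth, then $X$ is a smooth gradient of $f$, so $f$ is
already in $C^\infty_\omega$. -/
theorem cohomologyMap_injective : Function.Injective ω.cohomologyMap := by
  rw [injective_iff_map_eq_zero]
  intro x hx
  obtain ⟨⟨φ, hφ, X, hX, hφX⟩, rfl⟩ := Submodule.Quotient.mk_surjective _ x
  obtain ⟨f, hf, h⟩ := (Submodule.Quotient.mk_eq_zero _).1 hx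
  refine (Submodule.Quotient.mk_eq_zero _).2 ⟨f, ⟨hf, X, hX, ?_⟩, h⟩
  exact h.symm.trans hφX

namespace IsWeakSymplectic

variable (hω : ω.IsWeakSymplectic)

/-- The space `𝔛(M, ω)` of symplectic vector fields. -/
def symplecticFields : Submodule ℝ A.Section where
  carrier := {X | ω.SymplecticField X}
  zero_mem' := (hω.closedOneForm_contract_iff smoothField_zero).1
    (by rw [contract_zero]; exact closedOneForm_zero)
  add_mem' := fun {X Y} hX hY => (hω.closedOneForm_contract_iff (hX.1.add hY.1)).1 <| by
    rw [contract_add]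
    exact ((hω.closedOneForm_contract_iff hX.1).2 hX).add
      ((hω.closedOneForm_contract_iff hY.1).2 hY)
  smul_mem' := fun a X hX => (hω.closedOneForm_contract_iff (hX.1.const_smul a)).1 <| by
    rw [contract_const_smul]
    exact ((hω.closedOneForm_contract_iff hX.1).2 hX).const_smul a

include hω in
theorem isGradient_unique {f : M → ℝ} {X Y : A.Section} (hX : ω.IsGradient f X)
    (hY : A.differential f = ω.contract Y) : Y = X :=
  hω.contract_injective (hY.symm.trans hX.2)

/-- The Hamiltonian mapping. -/
def grad : ω.omegaFunctions →ₗ[ℝ] hω.symplecticFields where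
  toFun f := ⟨f.2.2.choose, hω.symplecticField_of_isGradient f.2.1 f.2.2.choose_spec⟩
  -- Gradients are chosen independently for each function; linearity comes from their uniqueness.
  map_add' f g := Subtype.ext <| hω.isGradient_unique
    (f.2.2.choose_spec.add f.2.1 g.2.1 g.2.2.choose_spec) (f + g).2.2.choose_spec.2
  map_smul' a f := Subtype.ext <| hω.isGradient_unique
    (f.2.2.choose_spec.const_smul a f.2.1) (a • f).2.2.choose_spec.2

theorem isGradient_grad (f : ω.omegaFunctions) : ω.IsGradient f (hω.grad f : A.Section) :=
  f.2.2.choose_spec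

theorem grad_eq {f : ω.omegaFunctions} {X : A.Section} :
    A.differential f = ω.contract X ↔ X = hω.grad f :=
  ⟨hω.isGradient_unique (hω.isGradient_grad f), fun h => h ▸ (hω.isGradient_grad f).2⟩

/-- The Poisson bracket. -/
def poisson : ω.omegaFunctions →ₗ[ℝ] ω.omegaFunctions →ₗ[ℝ] ω.omegaFunctions :=
  LinearMap.mk₂ ℝ
    (fun f g => ⟨fun p => ω p ((hω.grad g : A.Section) p) ((hω.grad f : A.Section) p),
      hω.omegaSmooth_apply (hω.grad f).2 (hω.grad g).2⟩)
    (fun f f' g => Subtype.ext <| funext fun p => by simp)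
    (fun a f g => Subtype.ext <| funext fun p => by simp)
    (fun f g g' => Subtype.ext <| funext fun p => by simp)
    (fun a f g => Subtype.ext <| funext fun p => by simp)

theorem poisson_apply (f g : ω.omegaFunctions) (p : M) : (hω.poisson f g : M → ℝ) p =
    ω p ((hω.grad g : A.Section) p) ((hω.grad f : A.Section) p) := rfl

theorem poisson_eq_differential (f g : ω.omegaFunctions) (p : M) :
    (hω.poisson f g : M → ℝ) p = A.differential g p ((hω.grad f : A.Section) p) := by
  rw [(hω.isGradient_grad g).2]
  rfl

include hω in
-- Additivity is transported from the functions $\omega(Y,X)$ through their differentials and the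
-- injectivity of $\omega$.
theorem lieBracket_add_left {X X' Y : A.Section} (hX : ω.SymplecticField X)
    (hX' : ω.SymplecticField X') (hY : ω.SymplecticField Y) :
    A.lieBracket (X + X') Y = A.lieBracket X Y + A.lieBracket X' Y := by
  apply hω.contract_injective
  rw [contract_add, ← hω.differential_apply (hω.symplecticFields.add_mem hX hX') hY,
    ← hω.differential_apply hX hY, ← hω.differential_apply hX' hY,
    ← differential_add (hω.smoothFunction_apply hY.1 hX.1) (hω.smoothFunction_apply hY.1 hX'.1)]
  exact congrArg A.differential (funext fun p => (ω p (Y p)).map_add _ _)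

include hω in
theorem lieBracket_smul_left (a : ℝ) {X Y : A.Section} (hX : ω.SymplecticField X)
    (hY : ω.SymplecticField Y) : A.lieBracket (a • X) Y = a • A.lieBracket X Y := by
  apply hω.contract_injective
  rw [contract_const_smul, ← hω.differential_apply (hω.symplecticFields.smul_mem a hX) hY,
    ← hω.differential_apply hX hY,
    ← differential_const_smul a (hω.smoothFunction_apply hY.1 hX.1)]
  exact congrArg A.differential (funext fun p => (ω p (Y p)).map_smul _ _)

/-- The Lie bracket of symplectic vector fields. -/
def bracket : hω.symplecticFields →ₗ[ℝ] hω.symplecticFields →ₗ[ℝ] hω.symplecticFields :=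
  LinearMap.mk₂ ℝ
    (fun X Y => ⟨A.lieBracket X Y, hω.symplecticField_lieBracket X.2 Y.2⟩)
    (fun X X' Y => Subtype.ext <| hω.lieBracket_add_left X.2 X'.2 Y.2)
    (fun a X Y => Subtype.ext <| hω.lieBracket_smul_left a X.2 Y.2)
    (fun X Y Y' => Subtype.ext <| by
      change A.lieBracket X (Y + Y' : A.Section) = A.lieBracket X Y + A.lieBracket X Y'
      rw [lieBracket_swap, hω.lieBracket_add_left Y.2 Y'.2 X.2, lieBracket_swap _ (Y : A.Section),
        lieBracket_swap _ (Y' : A.Section), neg_add, neg_neg, neg_neg])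
    (fun a X Y => Subtype.ext <| by
      change A.lieBracket X (a • Y : A.Section) = a • A.lieBracket X Y
      rw [lieBracket_swap, hω.lieBracket_smul_left a Y.2 X.2, lieBracket_swap _ (Y : A.Section),
        smul_neg, neg_neg])

theorem grad_poisson (f g : ω.omegaFunctions) :
    hω.grad (hω.poisson f g) = hω.bracket (hω.grad f) (hω.grad g) :=
  Subtype.ext <| (hω.isGradient_unique (hω.isGradient_grad (hω.poisson f g))
    (Y := A.lieBracket (hω.grad f) (hω.grad g))
    (hω.differential_apply (hω.grad f).2 (hω.grad g).2)).symm

include hω in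
-- The cyclic identity arranged in Leibniz form, with antisymmetry used to match the orders of
-- arguments. For gradients it is the Jacobi identity of the Poisson bracket.
theorem apply_lieBracket_eq {X Y Z : A.Section} (hX : ω.SymplecticField X)
    (hY : ω.SymplecticField Y) (hZ : ω.SymplecticField Z) (p : M) :
    ω p (A.lieBracket Y Z p) (X p) =
      ω p (Z p) (A.lieBracket X Y p) + ω p (A.lieBracket X Z p) (Y p) := by
  have h := hω.cyclic_sum_eq_zero hX hY hZ p
  have h1 : A.lieBracket Z X p = -A.lieBracket X Z p := congrFun (lieBracket_swap X Z) p
  have h2 := (hω.smooth.1 p).neg (Z p) (A.lieBracket X Y p)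
  rw [h1, map_neg, LinearMap.neg_apply] at h
  linarith

theorem isLieBracket_poisson : IsLieBracket hω.poisson := by
  refine ⟨fun f => Subtype.ext <| funext fun p => hω.smooth.1 p _, fun f g h =>
    Subtype.ext <| funext fun p => ?_⟩
  change (hω.poisson f (hω.poisson g h) : M → ℝ) p =
    (hω.poisson (hω.poisson f g) h : M → ℝ) p + (hω.poisson g (hω.poisson f h) : M → ℝ) p
  simp only [poisson_apply, grad_poisson]
  exact hω.apply_lieBracket_eq (hω.grad f).2 (hω.grad g).2 (hω.grad h).2 p

/-- Each double bracket is the $\omega$-gradient of a function from `apply_lieBracket_eq`, so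
differentiating that identity and cancelling $\omega$ gives Jacobi. -/
theorem isLieBracket_bracket : IsLieBracket hω.bracket := by
  refine ⟨fun X => Subtype.ext <| funext fun p => sub_self _, fun X Y Z => Subtype.ext ?_⟩
  change A.lieBracket X (A.lieBracket Y Z) =
    A.lieBracket (A.lieBracket X Y) Z + A.lieBracket Y (A.lieBracket X Z)
  have hXY := hω.symplecticField_lieBracket X.2 Y.2
  have hXZ := hω.symplecticField_lieBracket X.2 Z.2
  have hYZ := hω.symplecticField_lieBracket Y.2 Z.2
  apply hω.contract_injective
  rw [contract_add, ← hω.differential_apply X.2 hYZ, ← hω.differential_apply hXY Z.2,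
    ← hω.differential_apply Y.2 hXZ, ← differential_add (hω.smoothFunction_apply Z.2.1 hXY.1)
      (hω.smoothFunction_apply hXZ.1 Y.2.1)]
  exact congrArg A.differential (funext fun p => hω.apply_lieBracket_eq X.2 Y.2 Z.2 p)

theorem poisson_mul (f g h : ω.omegaFunctions) :
    hω.poisson f (g * h) = hω.poisson f g * h + g * hω.poisson f h := by
  refine Subtype.ext <| funext fun p => ?_
  change (hω.poisson f (g * h) : M → ℝ) p = (hω.poisson f g : M → ℝ) p * (h : M → ℝ) p +
    (g : M → ℝ) p * (hω.poisson f h : M → ℝ) p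
  simp only [poisson_eq_differential]
  exact differential_mul g.2.1 h.2.1 p _

/-! ### The exact sequence -/

/-- The form `i_X ω`, as a closed `ω`-smooth form. -/
def contractHom : hω.symplecticFields →ₗ[ℝ] ω.closedOmegaForms where
  toFun X := ⟨ω.contract X, (hω.closedOneForm_contract_iff X.2.1).2 X.2, X, X.2.1, rfl⟩
  map_add' _ _ := Subtype.ext (contract_add _ _)
  map_smul' _ _ := Subtype.ext (contract_const_smul _ _)

/-- The map `X ↦ [i_X ω]`. -/
def classHom : hω.symplecticFields →ₗ[ℝ]
    (ω.closedOmegaForms ⧸ ω.exactOmegaForms.submoduleOf ω.closedOmegaForms) :=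
  (Submodule.mkQ _).comp hω.contractHom

theorem classHom_eq_zero_iff {X : hω.symplecticFields} :
    hω.classHom X = 0 ↔ X ∈ Set.range hω.grad := by
  have h : hω.classHom X = 0 ↔ ∃ f, ω.OmegaSmooth f ∧ ω.contract X = A.differential f :=
    Submodule.Quotient.mk_eq_zero _
  rw [h]
  constructor
  · rintro ⟨f, hf, h⟩
    exact ⟨⟨f, hf⟩, Subtype.ext (hω.grad_eq (f := ⟨f, hf⟩) |>.1 h.symm).symm⟩
  · rintro ⟨f, rfl⟩
    exact ⟨f, f.2, (hω.isGradient_grad f).2.symm⟩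

theorem classHom_surjective : Function.Surjective hω.classHom := by
  intro x
  obtain ⟨⟨φ, hφ, X, hX, rfl⟩, rfl⟩ := Submodule.Quotient.mk_surjective _ x
  exact ⟨⟨X, (hω.closedOneForm_contract_iff hX).1 hφ⟩, rfl⟩

/-- The form $i_{[X,Y]}\omega$ is the differential of $\omega(Y,X)$, a function in
$C^\infty_\omega$. -/
theorem classHom_bracket (X Y : hω.symplecticFields) : hω.classHom (hω.bracket X Y) = 0 :=
  (Submodule.Quotient.mk_eq_zero _).2
    ⟨_, hω.omegaSmooth_apply X.2 Y.2, (hω.differential_apply X.2 Y.2).symm⟩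

variable (ω) in
/-- The inclusion of the locally constant functions. -/
def _root_.ConvenientManifold.BilinSection.inclH0 : A.H0 →ₗ[ℝ] ω.omegaFunctions where
  toFun f := ⟨f, smoothFunction_of_mem_H0 f.2, 0, smoothField_zero, by
    rw [differential_of_mem_H0 f.2, contract_zero]⟩
  map_add' _ _ := rfl
  map_smul' _ _ := rfl

theorem grad_eq_zero_iff {f : ω.omegaFunctions} : hω.grad f = 0 ↔ f ∈ Set.range ω.inclH0 := by
  have h : hω.grad f = 0 ↔ A.differential f = 0 := by
    rw [← contract_zero (ω := ω), hω.grad_eq, Subtype.ext_iff, eq_comm]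
    rfl
  rw [h]
  constructor
  · exact fun h => ⟨⟨f, mem_H0_of_differential f.2.1 h⟩, rfl⟩
  · rintro ⟨g, rfl⟩
    exact differential_of_mem_H0 g.2

/-! ### Boundedness of the Poisson bracket -/

/-- The initial structure demands two bounds. The functions $dg(\operatorname{grad}f)$ are
derivatives of bounded functions along bounded fields. The gradients are brackets of gradients,
hence differences of derivatives of bounded fields along bounded fields. -/
theorem omegaBounded_poisson {S T : Set ω.omegaFunctions}
    (hS : ω.OmegaBounded ((fun f : ω.omegaFunctions => (f : M → ℝ)) '' S))
    (hT : ω.OmegaBounded ((fun f : ω.omegaFunctions => (f : M → ℝ)) '' T)) :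
    ω.OmegaBounded {h | ∃ f ∈ S, ∃ g ∈ T, h = (hω.poisson f g : M → ℝ)} := by
  have hfun : ∀ {T : Set ω.omegaFunctions} (i : ι), ∀ h ∈ (fun (f : M → ℝ) x =>
      f ((A.chart i).symm x)) '' ((fun f : ω.omegaFunctions => (f : M → ℝ)) '' T),
      CSmoothOn h (A.chart i).target := by
    rintro T i _ ⟨_, ⟨f, -, rfl⟩, rfl⟩
    exact f.2.1 i
  have hfield : ∀ {S : Set ω.omegaFunctions} (i : ι), ∀ h ∈ A.rep (A.chart i) ''
      {X | ∃ f ∈ (fun f : ω.omegaFunctions => (f : M → ℝ)) '' S, ω.IsGradient f X},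
      CSmoothOn h (A.chart i).target := by
    rintro S i _ ⟨X, ⟨_, -, hX⟩, rfl⟩
    exact hX.1 i
  have hmem : ∀ {S : Set ω.omegaFunctions} (i : ι), ∀ f ∈ S, A.rep (A.chart i) (hω.grad f) ∈
      A.rep (A.chart i) ''
        {X | ∃ f ∈ (fun f : ω.omegaFunctions => (f : M → ℝ)) '' S, ω.IsGradient f X} :=
    fun i f hf => ⟨_, ⟨f, ⟨f, hf, rfl⟩, hω.isGradient_grad f⟩, rfl⟩
  refine ⟨fun i => ?_, fun i => ?_⟩
  · have hU := A.isOpen_target i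
    refine ((hT.1 i).dirDeriv hU (hS.2 i) (hfun i) (hfield i)).of_eqOn ?_
    rintro _ ⟨_, ⟨f, hf, g, hg, rfl⟩, rfl⟩
    refine ⟨_, ⟨_, ⟨g, ⟨g, hg, rfl⟩, rfl⟩, _, hmem i f hf, rfl⟩, fun x hx => ?_⟩
    have hp := (A.chart i).map_target hx
    dsimp only
    rw [hω.poisson_eq_differential, differential_eq hp g.2.1, (A.chart i).right_inv hx]
    rfl
  · have hU := A.isOpen_target i
    refine (((hT.2 i).dirDeriv hU (hS.2 i) (hfield i) (hfield i)).sub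
      ((hS.2 i).dirDeriv hU (hT.2 i) (hfield i) (hfield i)) ?_ ?_).of_eqOn ?_
    · rintro _ ⟨X, hX, Y, hY, rfl⟩
      exact (hfield i X hX).dirDeriv_apply hU (hfield i Y hY)
    · rintro _ ⟨X, hX, Y, hY, rfl⟩
      exact (hfield i X hX).dirDeriv_apply hU (hfield i Y hY)
    · rintro _ ⟨X, ⟨_, ⟨f, hf, g, hg, rfl⟩, hX⟩, rfl⟩
      refine ⟨_, ⟨_, ⟨_, hmem i g hg, _, hmem i f hf, rfl⟩, _,
        ⟨_, hmem i f hf, _, hmem i g hg, rfl⟩, rfl⟩, fun x hx => ?_⟩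
      -- By uniqueness the given gradient of $\{f,g\}$ is the bracket of the gradients, whose chart
      -- formula is available since both are symplectic.
      rw [hω.grad_eq.1 hX.2, hω.grad_poisson]
      exact hω.rep_lieBracket (hω.grad f).2 (hω.grad g).2 hx

end IsWeakSymplectic

end BilinSection

end ConvenientManifold

end

theorem theoremA5 {ι : Type*} {E : ι → Type*} [∀ i, AddCommGroup (E i)] [∀ i, Module ℝ (E i)]
    [∀ i, TopologicalSpace (E i)] [∀ i, ConvenientSpace (E i)] {M : Type*}
    (A : ConvenientManifold E M) (ω : A.BilinSection) (hω : ω.IsWeakSymplectic) :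
    -- the spaces: `C^∞_ω(M)`, `𝔛(M, ω)`, closed and exact forms (ordinary and `ω`-smooth)
    ∃ (Cω : Subalgebra ℝ (M → ℝ)) (Xω : Submodule ℝ A.Section)
      (Z B Zω Bω : Submodule ℝ A.Cochain),
      (∀ f, f ∈ Cω ↔ ω.OmegaSmooth f) ∧
      (∀ X, X ∈ Xω ↔ ω.SymplecticField X) ∧
      (∀ φ, φ ∈ Z ↔ A.ClosedOneForm φ) ∧
      (∀ φ, φ ∈ B ↔ ∃ f, A.SmoothFunction f ∧ φ = A.differential f) ∧
      (∀ φ, φ ∈ Zω ↔ ω.ClosedOmegaForm φ) ∧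
      (∀ φ, φ ∈ Bω ↔ ∃ f, ω.OmegaSmooth f ∧ φ = A.differential f) ∧
      B ≤ Z ∧ Bω ≤ Zω ∧
      -- the maps: the inclusion of `H^0(M)`, the Hamiltonian map, the Poisson bracket,
      -- the bracket of vector fields, `γ`, and the map `H^1_ω(M) → H^1(M)`
      ∃ (incl : A.H0 →ₗ[ℝ] Cω) (grad : Cω →ₗ[ℝ] Xω) (pb : Cω →ₗ[ℝ] Cω →ₗ[ℝ] Cω)
        (lb : Xω →ₗ[ℝ] Xω →ₗ[ℝ] Xω) (γ : Xω →ₗ[ℝ] (Zω ⧸ Bω.submoduleOf Zω))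
        (j : (Zω ⧸ Bω.submoduleOf Zω) →ₗ[ℝ] (Z ⧸ B.submoduleOf Z)),
        (∀ c, (incl c : M → ℝ) = c) ∧
        -- the Hamiltonian map is well defined by `i_{grad f} ω = df`
        (∀ (f : Cω) (X : A.Section), A.differential f = ω.contract X ↔ X = grad f) ∧
        -- the Poisson bracket
        (∀ f g p, (pb f g : M → ℝ) p = ω p ((grad g : A.Section) p) ((grad f : A.Section) p)) ∧
        (∀ f g p, (pb f g : M → ℝ) p = A.differential g p ((grad f : A.Section) p)) ∧
        IsLieBracket pb ∧
        (∀ f g h, pb f (g * h) = pb f g * h + g * pb f h) ∧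
        -- the Poisson bracket is bounded
        (∀ S T : Set Cω, ω.OmegaBounded ((fun f : Cω => (f : M → ℝ)) '' S) →
          ω.OmegaBounded ((fun f : Cω => (f : M → ℝ)) '' T) →
          ω.OmegaBounded {h | ∃ f ∈ S, ∃ g ∈ T, h = pb f g}) ∧
        -- the Lie algebra `𝔛(M, ω)`
        (∀ X Y, (lb X Y : A.Section) = A.lieBracket X Y) ∧
        IsLieBracket lb ∧
        -- the class `γ(X) = [i_X ω]`, and `H^1_ω(M)` as a linear subspace of `H^1(M)`
        (∀ X : Xω, ∃ φ : Zω, (φ : A.Cochain) = ω.contract X ∧ γ X = Submodule.Quotient.mk φ) ∧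
        (∀ (φ : Zω) (ψ : Z), (φ : A.Cochain) = ψ →
          j (Submodule.Quotient.mk φ) = Submodule.Quotient.mk ψ) ∧
        Function.Injective j ∧
        -- exactness of `0 → H^0(M) → C^∞_ω(M) → 𝔛(M, ω) → H^1_ω(M) → 0`
        Function.Injective incl ∧ Function.Exact incl grad ∧ Function.Exact grad γ ∧
        Function.Surjective γ ∧
        -- all maps are Lie algebra homomorphisms; `H^0(M)` and `H^1_ω(M)` are abelian
        (∀ a b, pb (incl a) (incl b) = 0) ∧
        (∀ f g, grad (pb f g) = lb (grad f) (grad g)) ∧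
        (∀ X Y, γ (lb X Y) = 0) := by
  refine ⟨ω.omegaFunctions, hω.symplecticFields, A.closedForms, A.exactForms, ω.closedOmegaForms,
    ω.exactOmegaForms, fun _ => Iff.rfl, fun _ => Iff.rfl, fun _ => Iff.rfl, fun _ => Iff.rfl,
    fun _ => Iff.rfl, fun _ => Iff.rfl, ConvenientManifold.exactForms_le_closedForms,
    ConvenientManifold.BilinSection.exactOmegaForms_le_closedOmegaForms,
    ω.inclH0, hω.grad, hω.poisson, hω.bracket, hω.classHom, ω.cohomologyMap,
    fun _ => rfl, fun _ _ => hω.grad_eq, hω.poisson_apply, hω.poisson_eq_differential,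
    hω.isLieBracket_poisson, hω.poisson_mul, fun _ _ => hω.omegaBounded_poisson,
    fun _ _ => rfl, hω.isLieBracket_bracket, fun X => ⟨hω.contractHom X, rfl, rfl⟩,
    fun φ ψ h => ?_, ConvenientManifold.BilinSection.cohomologyMap_injective, fun a b h => ?_,
    fun _ => hω.grad_eq_zero_iff, fun _ => hω.classHom_eq_zero_iff, hω.classHom_surjective,
    fun a b => ?_, hω.grad_poisson, hω.classHom_bracket⟩
  · exact congrArg Submodule.Quotient.mk (Subtype.ext h)
  · exact Subtype.ext (congrArg (fun f : ω.omegaFunctions => (f : M → ℝ)) h)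
  · refine Subtype.ext (funext fun p => ?_)
    rw [hω.poisson_eq_differential]
    exact congrFun (congrFun (ConvenientManifold.differential_of_mem_H0 b.2) p) _
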